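/- Let $0<q<1$ and $-1<\alpha<q$. Write $(a;q)_n=\prod_{k=0}^{n-1}(1-aq^k)$, $(a;q)_\infty=\prod_{k\ge 0}(1-aq^k)$, $(a_1,\dots,a_m;q)_n=\prod_j (a_j;q)_n$ ($n\le\infty$), $[n]_q=\frac{1-q^n}{1-q}$, $[n]_q!=\prod_{k=1}^n[k]_q$, $x_n^{q,\alpha}!=(-\alpha;q)_n[n]_q!$, let ${}_m\phi_s$ denote the basic hypergeometric series, and let $\sqrt\alpha$ be the principal square root. Put $\mathbb C_q=\{z\in\mathbb C:\ |z|^2<\frac1{1-q}\}$ and $\mathcal I_q=\left(-\frac{2}{\sqrt{1-q}},\frac{2}{\sqrt{1-q}}\right)$. *The space $\mathcal H_{q,\alpha}$.* Let $\mathcal H_{q,\alpha}=L^2(\mathcal I_q,\omega_{q,\alpha}(x)\,dx)$ (complex-valued functions), where $$\omega_{q,\alpha}(x)=\frac{(q,-\alpha;q)_\infty}{2\pi}\sqrt{\frac{1-q}{4-(1-q)x^2}}\;\frac{g(x,1)\,g(x,-1)\,g(x,\sqrt q)\,g(x,-\sqrt q)}{g(x,\sqrt\alpha)\,g(x,-\sqrt\alpha)},\qquad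 g(x,\gamma)=\prod_{k\ge 0}\left(1-\gamma x\sqrt{1-q}\,q^k+\gamma^2q^{2k}\right).$$ For $x\in\mathcal I_q$ let $\theta\in(0,\pi)$ be given by $x=\frac{2\cos\theta}{\sqrt{1-q}}$, and let $$\varphi_n(x)=\frac{1}{\sqrt{(-\alpha,q;q)_n}}\,Q_n\!\left(\cos\theta;\sqrt\alpha,-\sqrt\alpha\,|\,q\right),$$ where for $a\neq0$ $$Q_n(\cos\theta;a,b|q)=\frac{(ab;q)_n}{a^n}\,{}_3\phi_2\!\left(\begin{matrix}q^{-n},ae^{i\theta},ae^{-i\theta}\\ ab,\,0\end{matrix}\,\Big|\,q;q\right)$$ is the Al-Salam–Chihara polynomial and $Q_n(\cos\theta;0,0|q)=\sum_{k=0}^n\frac{(q;q)_n}{(q;q)_k(q;q)_{n-k}}e^{i(n-2k)\theta}$ is the continuous $q$-Hermite polynomial. *The space $\mathcal A^2_{q,\alpha}(\mathbb C)$.* With the Rogers–Szegő polynomials $h_n(y|q)=\sum_{k=0}^n\frac{(q;q)_n}{(q;q)_k(q;q)_{n-k}}y^k$, let $$\rho_{q,\alpha}=(-\alpha,q;q)_\infty\sum_{n\ge0}\frac{q^n}{(q;q)_n}\,h_n(-\alpha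 q^{-1}|q)\,\delta_{(1-q)^{-1/2}q^{n/2}},$$ let $\nu_{q,\alpha}$ be the measure $\frac1{2\pi}\,d\theta\,\rho_{q,\alpha}(dr)$, $z=re^{i\theta}$, $\theta\in[0,2\pi)$, on $\mathbb C$ (it is carried by the closed disc $\overline{\mathbb C_q}$), and let $\mathcal A^2_{q,\alpha}(\mathbb C)$ be the closure in $L^2(\mathbb C,\nu_{q,\alpha})$ of the linear span of the monomials $z^n/\sqrt{x_n^{q,\alpha}!}$, $n\ge0$. *The transform.* For $z\in\mathbb C_q$ let $\mathcal N_{q,\alpha}(z\bar z)={}_2\phi_1\!\left(\begin{matrix}0,0\\-\alpha\end{matrix}\Big|q;z\bar z(1-q)\right)$, $$\vartheta_z^{q,\alpha}(x)=\mathcal N_{q,\alpha}(z\bar z)^{-1/2}\sum_{n\ge0}\frac{\bar z^n}{\sqrt{x_n^{q,\alpha}!}}\,\varphi_n(x),\qquad \mathcal B_\alpha^{(q)}[\varphi](z)=\mathcal N_{q,\alpha}(z\bar z)^{1/2}\,\langle\varphi,\vartheta_z^{q,\alpha}\rangle_{\mathcal H_{q,\alpha}},$$ the inner product being linear in the first argument.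 **Theorem.** For all $0<q<1$ and $-1<\alpha<q$, the following hold. 1. $\vartheta_z^{q,\alpha}\in\mathcal H_{q,\alpha}$ for every $z\in\mathbb C_q$. 2. $\mathcal A^2_{q,\alpha}(\mathbb C)$ is a reproducing kernel Hilbert space on $\mathbb C_q$: each of its elements agrees $\nu_{q,\alpha}$-almost everywhere on $\mathbb C_q$ with a holomorphic function on $\mathbb C_q$, the resulting map to functions on $\mathbb C_q$ is linear and injective with continuous point evaluations, and the reproducing kernel is $K_{q,\alpha}(z,w)={}_2\phi_1\!\left(\begin{matrix}0,0\\-\alpha\end{matrix}\Big|q;z\bar w(1-q)\right)$. 3. With this identification, $\mathcal B_\alpha^{(q)}$ is an isometric isomorphism from $\mathcal H_{q,\alpha}$ onto $\mathcal A^2_{q,\alpha}(\mathbb C)$, and for $\varphi\in\mathcal H_{q,\alpha}$ and $z\in\mathbb C_q$ $$\mathcal B_\alpha^{(q)}[\varphi](z)=\int_{\mathcal I_q}\mathcal T(z,\xi)\,\varphi(\xi)\,\omega_{q,\alpha}(\xi)\,d\xi$$ with absolutely convergent integral, where, for $\xi=\frac{2\cos\theta}{\sqrt{1-q}}$ with $\theta\in(0,\pi)$,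 $$\mathcal T(z,\xi)=\frac{1}{(z\sqrt{1-q}\,e^{-i\theta};q)_\infty}\;{}_2\phi_1\!\left(\begin{matrix}\sqrt\alpha e^{-i\theta},\,-\sqrt\alpha e^{-i\theta}\\-\alpha\end{matrix}\,\Big|\,q;\,z\sqrt{1-q}\,e^{i\theta}\right).$$ -/

import Mathlib

open MeasureTheory Filter Topology ComplexConjugate

noncomputable section

/-- The finite `q`-shifted factorial `(a; q)_n`. -/
def qPoch {K : Type*} [Field K] (a q : K) (n : ℕ) : K :=
  ∏ k ∈ Finset.range n, (1 - a * q ^ k)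

/-- The infinite `q`-shifted factorial `(a; q)_∞`. -/
def qPochInf {K : Type*} [Field K] [TopologicalSpace K] (a q : K) : K :=
  ∏' k : ℕ, (1 - a * q ^ k)

/-- The basic hypergeometric series `_mφ_s(as; bs | q; ξ)`, where `m` and `s` are the lengths of
the lists `as` and `bs`. -/
def basicHyp {K : Type*} [Field K] [TopologicalSpace K] (as bs : List K) (q ξ : K) : K :=
  ∑' k : ℕ, (as.map fun a => qPoch a q k).prod / (bs.map fun b => qPoch b q k).prod *
    ((-1) ^ k * q ^ k.choose 2) ^ (1 + (bs.length : ℤ) - (as.length : ℤ)) *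
    (ξ ^ k / qPoch q q k)

/-- The `q`-number `[n]_q`. -/
def qNum (q : ℝ) (n : ℕ) : ℝ := (1 - q ^ n) / (1 - q)

/-- The `q`-factorial `[n]_q!`. -/
def qFact (q : ℝ) (n : ℕ) : ℝ := ∏ k ∈ Finset.range n, qNum q (k + 1)

/-- The generalized factorial `x_n^{q,α}! = (-α; q)_n [n]_q!`. -/
def genFact (q α : ℝ) (n : ℕ) : ℝ := qPoch (-α) q n * qFact q n

/-- The Rogers–Szegő polynomials `h_n(y | q)`. -/
def rogersSzego (q : ℝ) (n : ℕ) (y : ℝ) : ℝ :=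
  ∑ k ∈ Finset.range (n + 1), qPoch q q n / (qPoch q q k * qPoch q q (n - k)) * y ^ k

/-- The normalization factor `𝓝_{q,α}(t) = ₂φ₁(0, 0; -α | q; t (1 - q))`. -/
def normFactor (q α t : ℝ) : ℝ := basicHyp [0, 0] [-α] q (t * (1 - q))

/-- The open disc `ℂ_q = {z : |z|² < 1 / (1 - q)}`. -/
def discCq (q : ℝ) : Set ℂ := {z | Complex.normSq z < (1 - q)⁻¹}

/-- The radial measure `ρ_{q,α}`. -/
def radialMeasure (q α : ℝ) : Measure ℝ :=
  Measure.sum fun n : ℕ =>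
    ENNReal.ofReal (qPochInf (-α) q * qPochInf q q *
        (q ^ n / qPoch q q n * rogersSzego q n (-α * q⁻¹))) •
      Measure.dirac ((√(1 - q))⁻¹ * q ^ ((n : ℝ) / 2))

/-- The rotation invariant measure `ν_{q,α}(d²z) = (2π)⁻¹ dθ ρ_{q,α}(dr)`, `z = r e^{iθ}`, as a
measure on `ℂ`. -/
def planeMeasure (q α : ℝ) : Measure ℂ :=
  ((radialMeasure q α).prod
      (ENNReal.ofReal (1 / (2 * Real.pi)) • volume.restrict (Set.Ico 0 (2 * Real.pi)))).map
    fun p : ℝ × ℝ => (p.1 : ℂ) * Complex.exp (Complex.I * (p.2 : ℂ))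

/-- The Hilbert space `𝒜²_{q,α}(ℂ)`: the closure in `L²(ν_{q,α})` of the linear span of (the
classes of) the monomials `z ^ n / √(x_n!)`. -/
abbrev spaceA2 (q α : ℝ) : Submodule ℂ (Lp ℂ 2 (planeMeasure q α)) :=
  (Submodule.span ℂ {F : Lp ℂ 2 (planeMeasure q α) | ∃ n : ℕ,
    F =ᵐ[planeMeasure q α] fun z => z ^ n / (√(genFact q α n) : ℂ)}).topologicalClosure

/-- The kernel `K_{q,α}(z, w) = ₂φ₁(0, 0; -α | q; z w̄ (1 - q))`. -/
def kernelK (q α : ℝ) (z w : ℂ) : ℂ :=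
  basicHyp [0, 0] [-(α : ℂ)] (q : ℂ) (z * conj w * (1 - q))

/-- The interval `I_q`. -/
def intervalIq (q : ℝ) : Set ℝ := Set.Ioo (-2 / √(1 - q)) (2 / √(1 - q))

/-- The infinite product `g(x, γ; q)`. -/
def gProd (q x : ℝ) (γ : ℂ) : ℂ :=
  ∏' k : ℕ, (1 - γ * x * √(1 - q) * (q : ℂ) ^ k + γ ^ 2 * (q : ℂ) ^ (2 * k))

/-- The principal square root `√α` (purely imaginary if `α < 0`). -/
def sqrtC (α : ℝ) : ℂ := (α : ℂ) ^ (1 / 2 : ℂ)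

/-- The weight `ω_{q,α}(x)` on `I_q`. The quotient of infinite products is real, since
`γ ↦ g(x, γ; q)` commutes with complex conjugation and `√α` is real or purely imaginary. -/
def weight (q α x : ℝ) : ℝ :=
  qPochInf q q * qPochInf (-α) q / (2 * Real.pi) * √((1 - q) / (4 - (1 - q) * x ^ 2)) *
    (gProd q x 1 * gProd q x (-1) * gProd q x (√q : ℂ) * gProd q x (-(√q : ℂ)) /
      (gProd q x (sqrtC α) * gProd q x (-sqrtC α))).re

/-- The measure `ω_{q,α}(x) dx` on `I_q`; the space `ℋ_{q,α} = L²(I_q, ω_{q,α}(x) dx)` is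
`Lp ℂ 2 (weightMeasure q α)`. -/
def weightMeasure (q α : ℝ) : Measure ℝ :=
  (volume.restrict (intervalIq q)).withDensity fun x => ENNReal.ofReal (weight q α x)

/-- The Al-Salam–Chihara polynomials `Q_n(ξ; a, b | q)`, `a ≠ 0`, at `ξ = cos θ`. -/
def alSalamChihara (q : ℝ) (n : ℕ) (θ : ℝ) (a b : ℂ) : ℂ :=
  qPoch (a * b) (q : ℂ) n / a ^ n *
    basicHyp [(q : ℂ) ^ (-(n : ℤ)), a * Complex.exp (Complex.I * θ),
      a * Complex.exp (-(Complex.I * θ))] [a * b, 0] (q : ℂ) (q : ℂ)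

/-- The continuous `q`-Hermite polynomials `H_n(ξ | q)` at `ξ = cos θ`. -/
def qHermite (q : ℝ) (n : ℕ) (θ : ℝ) : ℂ :=
  ∑ k ∈ Finset.range (n + 1),
    ((qPoch q q n / (qPoch q q k * qPoch q q (n - k)) : ℝ) : ℂ) *
      Complex.exp (Complex.I * (((n : ℂ) - 2 * k) * θ))

/-- The angle `θ ∈ [0, π]` with `x √(1 - q) = 2 cos θ`. -/
def angle (q x : ℝ) : ℝ := Real.arccos (x * √(1 - q) / 2)

open Classical in
/-- The basis functions
`φ_n(x) = ((-α, q; q)_n)^{-1/2} Q_n(x √(1 - q) / 2; √α, -√α | q)` of `ℋ_{q,α}`. For `α = 0` the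
polynomial `Q_n(ξ; 0, 0 | q)` is the continuous `q`-Hermite polynomial. -/
def basisFun (q α : ℝ) (n : ℕ) (x : ℝ) : ℂ :=
  ((√(qPoch (-α) q n * qPoch q q n))⁻¹ : ℝ) *
    (if α = 0 then qHermite q n (angle q x)
      else alSalamChihara q n (angle q x) (sqrtC α) (-sqrtC α))

/-- The wave function of the coherent state `ϑ_z^{q,α}`. -/
def cohState (q α : ℝ) (z : ℂ) (x : ℝ) : ℂ :=
  ((√(normFactor q α (Complex.normSq z)))⁻¹ : ℝ) *
    ∑' n : ℕ, conj z ^ n / (√(genFact q α n) : ℂ) * basisFun q α n x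

/-- The coherent state transform
`B[φ](z) = 𝓝(z z̄)^{1/2} ⟨φ, ϑ_z⟩`, the inner product of `ℋ_{q,α}` being linear in `φ`. -/
def bargmann (q α : ℝ) (φ : ℝ → ℂ) (z : ℂ) : ℂ :=
  (√(normFactor q α (Complex.normSq z)) : ℂ) *
    ∫ x, φ x * conj (cohState q α z x) ∂(weightMeasure q α)

/-- The integral kernel `T(z, ξ)`, with `ξ = 2 cos θ / √(1 - q)`. -/
def kernelT (q α : ℝ) (z : ℂ) (ξ : ℝ) : ℂ :=
  1 / qPochInf (z * √(1 - q) * Complex.exp (-(Complex.I * angle q ξ))) (q : ℂ) *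
    basicHyp [sqrtC α * Complex.exp (-(Complex.I * angle q ξ)),
        -sqrtC α * Complex.exp (-(Complex.I * angle q ξ))]
      [-(α : ℂ)] (q : ℂ) (z * √(1 - q) * Complex.exp (Complex.I * angle q ξ))

end

/-! Write `e_n(z) = z^n / √(x_n!)`. The transform sends `φ_n` to `e_n`, and `T(z, ξ) = ∑ e_n(z)
φ_n(ξ)`, `K(z, w) = ∑ e_n(z) conj(e_n(w))`. Everything follows once the `φ_n` are known to be a
Hilbert basis of the weighted space, the `e_n` a Hilbert basis of their closed span in `L²(ν)`, and
the series for `T` to have the stated closed form. The hypotheses give `|α| < 1`, which is what most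
estimates need; `α < q` itself enters only through the positivity of the radial masses.

The polynomials are handled through their three-term recurrence (`ascQ`). Both the `₃φ₂` form and a
convolution formula satisfy that recurrence (`sum_phiCoeff_eq_ascQ`, `ascQ_eq_conv`). The
convolution formula is the generating function `tsum_ascQ` read coefficientwise, and it also gives a
bound linear in `n` and uniform in the angle.

Orthogonality is proved on the unit circle, where with `s = e^{iθ}` the weight becomes `|(s²; q)_∞ /
(α s²; q²)_∞|²`. A raising relation (`ascQ_raising`) writes the weighted `Q_{n+1}` as a `√q`-shift
of a function built from the weight with parameter `α q`. This function is holomorphic on `√q ≤ |s|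
≤ 1`, so the contour can be moved, and what remains is odd under `s ↦ s⁻¹`. Hence `Q_{n+1}` has mean
zero, and the recurrence upgrades this to orthogonality (`orthogonality_of_recurrence`). The same
shift relates the total masses at `α` and `α q`. Iterating reduces to `α = 0`, and the choice `α =
q` then relates the bases `q` and `q²`, so that the constant is found in the limit of base `0`
(`ascMass_mul_eq`). Completeness is Weierstrass approximation on a bounded interval.

On the other side, rotation invariance makes the monomials orthogonal. Their norms are the radial
moments, given by the product of two Euler expansions (`hasSum_radialCoeff_mul_pow`). Square
summable series in the `e_n` converge locally uniformly on the disc, which yields the holomorphic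
representatives and the reproducing kernel. -/

open Finset.HasAntidiagonal (antidiagonal)

/-! ### The `q`-shifted factorials -/

section QPoch

variable {K : Type*} [Field K]

lemma qPoch_zero (a q : K) : qPoch a q 0 = 1 := by simp [qPoch]

lemma qPoch_succ (a q : K) (n : ℕ) : qPoch a q (n + 1) = qPoch a q n * (1 - a * q ^ n) := by
  simp [qPoch, Finset.prod_range_succ]

lemma qPoch_succ' (a q : K) (n : ℕ) : qPoch a q (n + 1) = (1 - a) * qPoch (a * q) q n := by
  simp only [qPoch, Finset.prod_range_succ', pow_zero, mul_one]
  rw [mul_comm]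
  congr 1
  exact Finset.prod_congr rfl fun k _ => by ring

lemma qPoch_zero_left (q : K) (n : ℕ) : qPoch 0 q n = 1 := by simp [qPoch]

lemma qPoch_sq (a q : K) (n : ℕ) :
    qPoch a q n * qPoch (-a) q n = qPoch (a ^ 2) (q ^ 2) n := by
  simp only [qPoch, ← Finset.prod_mul_distrib]
  exact Finset.prod_congr rfl fun k _ => by ring

lemma map_qPoch {L : Type*} [Field L] (f : K →+* L) (a q : K) (n : ℕ) :
    f (qPoch a q n) = qPoch (f a) (f q) n := by
  simp [qPoch]

end QPoch

lemma qPoch_ofReal (a q : ℝ) (n : ℕ) : ((qPoch a q n : ℝ) : ℂ) = qPoch (a : ℂ) (q : ℂ) n :=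
  map_qPoch Complex.ofRealHom a q n

lemma qPoch_pos {a q : ℝ} (hq0 : 0 < q) (hq1 : q < 1) (ha : a < 1) (n : ℕ) :
    0 < qPoch a q n := by
  refine Finset.prod_pos fun k _ => ?_
  have h1 : 0 < q ^ k := by positivity
  have h2 : q ^ k ≤ 1 := pow_le_one₀ hq0.le hq1.le
  rcases le_total a 0 with h | h
  · nlinarith
  · nlinarith

/-! ### Infinite `q`-shifted factorials and Euler's expansion -/

section QPochInf

variable {K : Type*} [RCLike K]

lemma summable_norm_mul_pow {q : K} (hq : ‖q‖ < 1) (a : K) :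
    Summable fun k : ℕ => ‖-(a * q ^ k)‖ := by
  simp only [norm_neg, norm_mul, norm_pow]
  exact (summable_geometric_of_lt_one (norm_nonneg _) hq).mul_left _

lemma multipliable_qPochInf {q : K} (hq : ‖q‖ < 1) (a : K) :
    Multipliable fun k : ℕ => 1 - a * q ^ k := by
  simpa [sub_eq_add_neg] using multipliable_one_add_of_summable (summable_norm_mul_pow hq a)

lemma tendsto_qPoch {q : K} (hq : ‖q‖ < 1) (a : K) :
    Tendsto (qPoch a q) atTop (𝓝 (qPochInf a q)) :=
  (multipliable_qPochInf hq a).hasProd.tendsto_prod_nat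

lemma qPochInf_zero (q : K) : qPochInf 0 q = 1 := by simp [qPochInf]

lemma qPochInf_eq_mul {q : K} (hq : ‖q‖ < 1) (a : K) :
    qPochInf a q = (1 - a) * qPochInf (a * q) q := by
  refine tendsto_nhds_unique ((tendsto_qPoch hq a).comp (tendsto_add_atTop_nat 1)) ?_
  refine ((tendsto_qPoch hq (a * q)).const_mul (1 - a)).congr fun n => ?_
  simp [qPoch_succ']

lemma qPochInf_eq_qPoch_mul {q : K} (hq : ‖q‖ < 1) (a : K) (n : ℕ) :
    qPochInf a q = qPoch a q n * qPochInf (a * q ^ n) q := by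
  induction n with
  | zero => simp [qPoch_zero]
  | succ n ih => rw [ih, qPochInf_eq_mul hq (a * q ^ n), qPoch_succ]; ring_nf

lemma qPochInf_ne_zero {q : K} (hq : ‖q‖ < 1) {a : K} (ha : ‖a‖ < 1) : qPochInf a q ≠ 0 := by
  have := tprod_one_add_ne_zero_of_summable (f := fun k : ℕ => -(a * q ^ k)) (fun k h => ?_)
    (summable_norm_mul_pow hq a)
  · simpa [qPochInf, sub_eq_add_neg] using this
  · have h1 : a * q ^ k = 1 := by linear_combination -h
    have h2 : ‖a * q ^ k‖ < 1 := by
      rw [norm_mul, norm_pow]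
      have : ‖q‖ ^ k ≤ 1 := pow_le_one₀ (norm_nonneg _) hq.le
      nlinarith [norm_nonneg a, norm_nonneg q]
    simp [h1] at h2

/-- The bound is explicit in both `a` and `q`, so it also controls limits in which the base varies,
as in `tendsto_qPochInf_of_le`. -/
lemma norm_qPochInf_sub_one_le {q : K} (hq : ‖q‖ < 1) (a : K) :
    ‖qPochInf a q - 1‖ ≤ Real.exp (‖a‖ / (1 - ‖q‖)) - 1 := by
  refine le_of_tendsto ((tendsto_qPoch hq a).sub_const 1).norm (Eventually.of_forall fun n => ?_)
  have := (Finset.range n).norm_prod_one_add_sub_one_le fun k => -(a * q ^ k)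
  simp only [← sub_eq_add_neg] at this
  refine this.trans (sub_le_sub_right (Real.exp_le_exp.2 ?_) 1)
  refine ((summable_norm_mul_pow hq a).sum_le_tsum _ fun _ _ => norm_nonneg _).trans ?_
  simp only [norm_neg, norm_mul, norm_pow]
  rw [tsum_mul_left, tsum_geometric_of_lt_one (norm_nonneg _) hq, div_eq_mul_inv]

lemma qPochInf_sq {q : K} (hq : ‖q‖ < 1) (a : K) :
    qPochInf a q * qPochInf (-a) q = qPochInf (a ^ 2) (q ^ 2) := by
  have hq2 : ‖q ^ 2‖ < 1 := by rw [norm_pow]; exact pow_lt_one₀ (norm_nonneg _) hq two_ne_zero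
  refine tendsto_nhds_unique ((tendsto_qPoch hq a).mul (tendsto_qPoch hq (-a))) ?_
  exact (tendsto_qPoch hq2 (a ^ 2)).congr fun n => (qPoch_sq a q n).symm

lemma qPochInf_even_odd {q : K} (hq : ‖q‖ < 1) (a : K) :
    qPochInf a (q ^ 2) * qPochInf (a * q) (q ^ 2) = qPochInf a q := by
  have hq2 : ‖q ^ 2‖ < 1 := by rw [norm_pow]; exact pow_lt_one₀ (norm_nonneg _) hq two_ne_zero
  refine tendsto_nhds_unique ((tendsto_qPoch hq2 a).mul (tendsto_qPoch hq2 (a * q))) ?_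
  refine ((tendsto_qPoch hq a).comp (tendsto_id.const_mul_atTop' two_pos)).congr fun n => ?_
  simp only [Function.comp_apply, id]
  induction n with
  | zero => simp [qPoch_zero]
  | succ n ih =>
    rw [show 2 * (n + 1) = 2 * n + 1 + 1 by ring, qPoch_succ, qPoch_succ, ih, qPoch_succ,
      qPoch_succ]
    ring

/-- Euler's expansion of `1 / (u; q)_∞`. -/
lemma summable_norm_pow_div_qPoch {q : K} (hq : ‖q‖ < 1) {u : K} (hu : ‖u‖ < 1) :
    Summable fun m : ℕ => ‖u ^ m / qPoch q q m‖ := by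
  have hlim : Tendsto (fun m : ℕ => (qPoch q q m)⁻¹) atTop (𝓝 (qPochInf q q)⁻¹) :=
    (tendsto_qPoch hq q).inv₀ (qPochInf_ne_zero hq hq)
  obtain ⟨C, hC⟩ := hlim.norm.bddAbove_range
  refine Summable.of_nonneg_of_le (fun _ => norm_nonneg _) (fun m => ?_)
    ((summable_geometric_of_lt_one (norm_nonneg u) hu).mul_right C)
  rw [div_eq_mul_inv, norm_mul, norm_pow]
  exact mul_le_mul_of_nonneg_left (hC ⟨m, rfl⟩) (by positivity)

lemma qPoch_self_ne_zero {q : K} (hq : ‖q‖ < 1) (n : ℕ) : qPoch q q n ≠ 0 := by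
  intro h
  apply qPochInf_ne_zero hq hq
  rw [qPochInf_eq_qPoch_mul hq q n, h, zero_mul]

/-- The sum `S` satisfies `S(v q) = (1 - v) S(v)`. Iterating gives `S(u q^n) = (u; q)_n S(u)`, and
the left side tends to `S(0) = 1`. -/
lemma tsum_pow_div_qPoch {q : K} (hq : ‖q‖ < 1) {u : K} (hu : ‖u‖ < 1) :
    ∑' m : ℕ, u ^ m / qPoch q q m = 1 / qPochInf u q := by
  set S : K → K := fun u => ∑' m : ℕ, u ^ m / qPoch q q m with hS
  have hstep : ∀ v : K, ‖v‖ < 1 → S (v * q) = (1 - v) * S v := by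
    intro v hv
    have hs := (summable_norm_pow_div_qPoch hq hv).of_norm
    have hvq : ‖v * q‖ < 1 := by
      rw [norm_mul]; nlinarith [norm_nonneg v, norm_nonneg q]
    have hs' := (summable_norm_pow_div_qPoch hq hvq).of_norm
    have h1 : S v - S (v * q) = v * S v := by
      rw [hS]
      simp only
      rw [← hs.tsum_sub hs', ← tsum_mul_left, (hs.sub hs').tsum_eq_zero_add]
      simp only [pow_zero, sub_self, zero_add]
      refine tsum_congr fun m => ?_
      have h0 := qPoch_self_ne_zero hq m
      have h1 := qPoch_self_ne_zero hq (m + 1)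
      rw [qPoch_succ] at h1 ⊢
      have h2 : 1 - q * q ^ m ≠ 0 := right_ne_zero_of_mul h1
      field_simp
      ring
    linear_combination -h1
  have hiter : ∀ n : ℕ, S (u * q ^ n) = qPoch u q n * S u := by
    intro n
    induction n with
    | zero => simp [qPoch_zero]
    | succ n ih =>
      have hv : ‖u * q ^ n‖ < 1 := by
        rw [norm_mul, norm_pow]
        have : ‖q‖ ^ n ≤ 1 := pow_le_one₀ (norm_nonneg _) hq.le
        nlinarith [norm_nonneg u, norm_nonneg q]
      rw [pow_succ, ← mul_assoc, hstep _ hv, ih, qPoch_succ]; ring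
  have hcont : Tendsto (fun n : ℕ => S (u * q ^ n)) atTop (𝓝 1) := by
    have h := tendsto_tsum_of_dominated_convergence (𝓕 := atTop)
      (f := fun (n : ℕ) (m : ℕ) => (u * q ^ n) ^ m / qPoch q q m)
      (g := fun m : ℕ => (0 : K) ^ m / qPoch q q m) (summable_norm_pow_div_qPoch hq hu)
      (fun m => ?_) (Eventually.of_forall fun n m => ?_)
    · rw [tsum_eq_single 0 fun m hm => by simp [hm]] at h
      simpa [qPoch_zero] using h
    · have : Tendsto (fun n : ℕ => u * q ^ n) atTop (𝓝 0) := by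
        simpa using (tendsto_pow_atTop_nhds_zero_of_norm_lt_one hq).const_mul u
      exact (this.pow m).div_const _
    · rw [norm_div, norm_div, norm_pow, norm_pow, norm_mul, norm_pow]
      have : ‖q‖ ^ n ≤ 1 := pow_le_one₀ (norm_nonneg _) hq.le
      gcongr
      exact mul_le_of_le_one_right (norm_nonneg _) this
  have h := tendsto_nhds_unique (hcont.congr hiter) ((tendsto_qPoch hq u).mul_const (S u))
  rw [eq_div_iff (qPochInf_ne_zero hq hu), mul_comm]
  exact h.symm

end QPochInf

lemma qPochInf_ofReal {q : ℝ} (hq : ‖q‖ < 1) (a : ℝ) :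
    ((qPochInf a q : ℝ) : ℂ) = qPochInf (a : ℂ) (q : ℂ) := by
  have hq' : ‖(q : ℂ)‖ < 1 := by simpa using hq
  refine tendsto_nhds_unique
    ((Complex.continuous_ofReal.tendsto _).comp (tendsto_qPoch hq a)) ?_
  exact (tendsto_qPoch hq' (a : ℂ)).congr fun n => (qPoch_ofReal a q n).symm

lemma conj_qPochInf {q : ℝ} (hq : ‖q‖ < 1) (a : ℂ) :
    conj (qPochInf a (q : ℂ)) = qPochInf (conj a) (q : ℂ) := by
  have hq' : ‖(q : ℂ)‖ < 1 := by simpa using hq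
  refine tendsto_nhds_unique
    ((Complex.continuous_conj.tendsto _).comp (tendsto_qPoch hq' a)) ?_
  refine (tendsto_qPoch hq' (conj a)).congr fun n => ?_
  simp [map_qPoch]

lemma qPochInf_pos {a q : ℝ} (hq0 : 0 < q) (hq1 : q < 1) (ha : |a| < 1) : 0 < qPochInf a q := by
  have hq : ‖q‖ < 1 := by rwa [Real.norm_eq_abs, abs_of_pos hq0]
  refine lt_of_le_of_ne ?_ (qPochInf_ne_zero hq ha).symm
  exact ge_of_tendsto' (tendsto_qPoch hq a) fun n => (qPoch_pos hq0 hq1 (abs_lt.1 ha).2 n).le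

lemma differentiable_qPochInf {q : ℂ} (hq : ‖q‖ < 1) :
    Differentiable ℂ fun a : ℂ => qPochInf a q := by
  intro a
  have h : HasProdLocallyUniformlyOn (fun (k : ℕ) (a : ℂ) => 1 + -(a * q ^ k))
      (fun a => ∏' k : ℕ, (1 + -(a * q ^ k))) (Metric.ball 0 (‖a‖ + 1)) := by
    refine Summable.hasProdLocallyUniformlyOn_one_add (u := fun k => (‖a‖ + 1) * ‖q‖ ^ k)
      Metric.isOpen_ball ((summable_geometric_of_lt_one (norm_nonneg _) hq).mul_left _)
      (Eventually.of_forall fun k x hx => ?_) fun k => by fun_prop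
    rw [norm_neg, norm_mul, norm_pow]
    have : ‖x‖ ≤ ‖a‖ + 1 := by simpa using (mem_ball_zero_iff.1 hx).le
    gcongr
  have hd : DifferentiableOn ℂ (fun a => ∏' k : ℕ, (1 + -(a * q ^ k)))
      (Metric.ball 0 (‖a‖ + 1)) := by
    refine h.differentiableOn (.of_forall fun s => ?_) Metric.isOpen_ball
    simpa [Finset.prod_fn] using DifferentiableOn.finsetProd (fun _ _ ↦ by fun_prop)
  have := hd.differentiableAt (Metric.isOpen_ball.mem_nhds (x := a) (by simp))
  simpa [qPochInf, sub_eq_add_neg] using this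

/-! ### The polynomials `Q_n(·; √α, -√α | q)` through their recurrence -/

/-- The Al-Salam–Chihara polynomial `Q_n(z / 2; √α, -√α | q)`, as a polynomial in `z` and `α`,
given by its three-term recurrence. -/
def ascQ {K : Type*} [CommRing K] (q α z : K) : ℕ → K
  | 0 => 1
  | 1 => z
  | n + 2 => z * ascQ q α z (n + 1) - (1 - q ^ (n + 1)) * (1 + α * q ^ n) * ascQ q α z n

section Algebra

lemma map_ascQ {K L : Type*} [CommRing K] [CommRing L] (f : K →+* L) (q α z : K) (n : ℕ) :
    f (ascQ q α z n) = ascQ (f q) (f α) (f z) n := by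
  induction n using Nat.twoStepInduction with
  | zero => simp [ascQ]
  | one => simp [ascQ]
  | more n h0 h1 => simp [ascQ, h0, h1]

lemma ascQ_ofReal (q α z : ℝ) (n : ℕ) :
    ((ascQ q α z n : ℝ) : ℂ) = ascQ (q : ℂ) (α : ℂ) (z : ℂ) n :=
  map_ascQ Complex.ofRealHom q α z n

/-- A sequence with the initial values and the recurrence of `ascQ`. -/
lemma eq_ascQ {K : Type*} [CommRing K] {q α z : K} {f : ℕ → K} (h0 : f 0 = 1) (h1 : f 1 = z)
    (h : ∀ n, f (n + 2) = z * f (n + 1) - (1 - q ^ (n + 1)) * (1 + α * q ^ n) * f n) (n : ℕ) :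
    f n = ascQ q α z n := by
  induction n using Nat.twoStepInduction with
  | zero => simp [ascQ, h0]
  | one => simp [ascQ, h1]
  | more n i0 i1 => rw [h, i0, i1, ascQ]

variable {K : Type*} [Field K]

open PowerSeries in
/-- The product of `∑ vⁱ tⁱ / (q; q)_i` with a series `∑ f_j t^j` of `₂φ₁` type satisfies a
three-term recurrence. -/
lemma conv_recurrence {q α u v : K} (hq : q ≠ 0) (hne : ∀ n, qPoch q q n ≠ 0) {f : ℕ → K}
    (hf : ∀ j, f (j + 1) * ((1 - q ^ (j + 1)) * (1 + α * q ^ j)) = f j * (u - α * v * q ^ (2 * j)))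
    (n : ℕ) :
    (1 - q ^ (n + 2)) * (1 + α * q ^ (n + 1)) *
        (∑ p ∈ antidiagonal (n + 2), v ^ p.1 / qPoch q q p.1 * f p.2) =
      (u + v) * (∑ p ∈ antidiagonal (n + 1), v ^ p.1 / qPoch q q p.1 * f p.2) -
        u * v * (∑ p ∈ antidiagonal n, v ^ p.1 / qPoch q q p.1 * f p.2) := by
  set A : PowerSeries K := PowerSeries.mk fun i => v ^ i / qPoch q q i with hA
  set B : PowerSeries K := PowerSeries.mk f with hB
  have hAB : ∀ m, ∑ p ∈ antidiagonal m, v ^ p.1 / qPoch q q p.1 * f p.2 =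
      coeff m (A * B) := fun m => by simp [hA, hB, coeff_mul]
  -- As formal series in `t`, `A(q t) = (1 - v t) A(t)`, the functional equation of `1 / (v t;
  -- q)_∞`.
  have h1 : rescale q A = (1 - C v * X) * A := by
    ext m
    rw [sub_mul, one_mul, mul_assoc, map_sub, coeff_C_mul, coeff_rescale]
    cases m with
    | zero => simp
    | succ m =>
      rw [coeff_succ_X_mul]
      simp only [hA, coeff_mk]
      have h0 := hne m
      have h1 := hne (m + 1)
      rw [qPoch_succ] at h1 ⊢
      have h2 : 1 - q * q ^ m ≠ 0 := right_ne_zero_of_mul h1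
      field_simp
      ring
  have h2 : rescale q (rescale q A) = (1 - C (q * v) * X) * ((1 - C v * X) * A) := by
    rw [h1, map_mul, h1]
    congr 1
    simp only [map_sub, map_one, map_mul, rescale_X]
    congr 1
    rw [show rescale q (C v) = C v by
      ext m
      simp only [coeff_rescale, coeff_C]
      split_ifs with h <;> simp [h]]
    ring
  -- The coefficient recursion `hf` as a second-order `q`-difference equation: with `Q = q^(j+1)`,
  -- `q (1 - q^(j+1)) (1 + α q^j) = q - (q - α) Q - α Q²`, and powers of `Q` are dilations of the
  -- variable.
  have h3 : C q * ((1 - C u * X) * B) = C (q - α) * rescale q B +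
      C α * (1 - C (q * v) * X) * rescale q (rescale q B) := by
    ext m
    cases m with
    | zero =>
      have h0 : ∀ g : PowerSeries K, constantCoeff (rescale q g) = constantCoeff g := fun g => by
        rw [← coeff_zero_eq_constantCoeff_apply, coeff_rescale, pow_zero, one_mul,
          coeff_zero_eq_constantCoeff_apply]
      simp [h0, sub_mul, mul_assoc]
    | succ m =>
      simp only [sub_mul, mul_sub, one_mul, mul_one, mul_assoc, map_add, map_sub, coeff_C_mul,
        coeff_succ_X_mul, coeff_rescale, hB, coeff_mk]
      linear_combination q * hf m
  -- Multiplying by `(1 - v t) A(t)` absorbs the factors `1 - v t` and `1 - q v t` into `A(q t)` and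
  -- `A(q² t)`, so the equation closes on the product `A B`. Its coefficient at `t^(n+2)` is the
  -- claim.
  have key : C q * ((1 - C u * X) * (1 - C v * X) * (A * B)) =
      C (q - α) * rescale q (A * B) + C α * rescale q (rescale q (A * B)) := by
    rw [map_mul, map_mul, h2, h1]
    linear_combination ((1 - C v * X) * A) * h3
  have e : (1 - C u * X) * (1 - C v * X) * (A * B) =
      A * B - C (u + v) * (X * (A * B)) + C (u * v) * (X * (X * (A * B))) := by
    simp only [map_add, map_mul]; ring
  rw [hAB, hAB, hAB]
  rw [e] at key
  clear_value A B
  clear h1 h2 h3 e hf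
  generalize A * B = F at *
  have hc := congrArg (coeff (n + 2)) key
  rw [coeff_C_mul, LinearMap.map_add, LinearMap.map_sub, coeff_C_mul, coeff_C_mul,
    LinearMap.map_add, coeff_C_mul, coeff_C_mul,
    coeff_succ_X_mul, coeff_succ_X_mul, coeff_succ_X_mul, coeff_rescale, coeff_rescale,
    coeff_rescale] at hc
  apply mul_left_cancel₀ hq
  linear_combination hc

lemma conv_one {q α u v : K} (hq1 : 1 - q ≠ 0) {f : ℕ → K} (hf0 : f 0 = 1)
    (hf : f 1 * ((1 - q) * (1 + α)) = u - α * v) :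
    (1 - q) * (1 + α) *
      (∑ p ∈ antidiagonal 1, v ^ p.1 / qPoch q q p.1 * f p.2) = u + v := by
  simp only [Finset.Nat.antidiagonal_succ, Finset.Nat.antidiagonal_zero, Finset.map_singleton,
    Finset.sum_cons, Finset.sum_singleton]
  simp [qPoch, hf0]
  field_simp
  linear_combination hf

/-- The expansion of `Q_n` whose generating function is a product with a `₂φ₁`. -/
lemma ascQ_eq_conv {q α s σ : K} (hs : s * σ = 1) (hq : q ≠ 0) (hne : ∀ n, qPoch q q n ≠ 0)
    (hne' : ∀ n, qPoch (-α) q n ≠ 0) (n : ℕ) :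
    ascQ q α (s + σ) n = qPoch q q n * qPoch (-α) q n *
      ∑ p ∈ antidiagonal n, σ ^ p.1 / qPoch q q p.1 *
        (s ^ p.2 * qPoch (α * σ ^ 2) (q ^ 2) p.2 / (qPoch (-α) q p.2 * qPoch q q p.2)) := by
  set f : ℕ → K := fun j =>
    s ^ j * qPoch (α * σ ^ 2) (q ^ 2) j / (qPoch (-α) q j * qPoch q q j) with hfdef
  -- The ratio of consecutive terms contains `s (1 - α σ² q^(2j))`; `s σ = 1` turns it into `s - α σ
  -- q^(2j)`, as needed with `u = s`, `v = σ`. The base `q²` keeps `√α` out of the algebra.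
  have hf : ∀ j, f (j + 1) * ((1 - q ^ (j + 1)) * (1 + α * q ^ j)) =
      f j * (s - α * σ * q ^ (2 * j)) := by
    intro j
    have h1 := hne (j + 1)
    have h2 := hne' (j + 1)
    rw [qPoch_succ] at h1 h2
    have a1 := left_ne_zero_of_mul h1
    have a2 := right_ne_zero_of_mul h1
    have b1 := left_ne_zero_of_mul h2
    have b2 := right_ne_zero_of_mul h2
    simp only [hfdef, qPoch_succ]
    rw [neg_mul, sub_neg_eq_add] at b2 ⊢
    field_simp
    linear_combination (-s ^ j * qPoch (α * σ ^ 2) (q ^ 2) j * α * σ * q ^ (2 * j) *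
      (1 - q * q ^ j)) * hs
  have hf0 : f 0 = 1 := by simp [hfdef, qPoch_zero]
  symm
  refine eq_ascQ (f := fun n => qPoch q q n * qPoch (-α) q n *
      ∑ p ∈ antidiagonal n, σ ^ p.1 / qPoch q q p.1 * f p.2) ?_ ?_ (fun n => ?_) n
  · simp [hf0, qPoch_zero]
  · have h1 : 1 - q ≠ 0 := by simpa [qPoch] using hne 1
    have := conv_one (u := s) (v := σ) (α := α) h1 hf0 (by simpa [hf0] using hf 0)
    simpa [qPoch] using this
  · have := conv_recurrence (u := s) (v := σ) (α := α) hq hne hf n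
    simp only [qPoch_succ]
    linear_combination (qPoch q q n * qPoch (-α) q n * (1 - q * q ^ n) * (1 - -α * q ^ n)) * this -
      (qPoch q q n * qPoch (-α) q n * (1 - q * q ^ n) * (1 - -α * q ^ n)) *
      (∑ p ∈ antidiagonal n, σ ^ p.1 / qPoch q q p.1 * f p.2) * hs

/-- The raising relation between the parameters `α q` and `α`, together with a companion. -/
lemma ascQ_raising {q r α s σ : K} (hs : s * σ = 1) (hr : r * r = q) (hr0 : r ≠ 0) (n : ℕ) :
    (σ * (1 - σ ^ 2) * (1 - α * s ^ 2)) * (r ^ n * ascQ q (α * q) (r * s + r⁻¹ * σ) n) +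
      (s * (1 - s ^ 2) * (1 - α * σ ^ 2)) * (r ^ n * ascQ q (α * q) (r * σ + r⁻¹ * s) n) =
      (1 - s ^ 2) * (1 - σ ^ 2) * ascQ q α (s + σ) (n + 1) := by
  subst hr
  -- The factor `r^n` clears the square root: the recurrence of `P` involves only `r²`, so `r` can
  -- be forgotten afterwards.
  obtain ⟨P, hP⟩ : ∃ P : K → K → ℕ → K,
    P = fun s σ n => r ^ n * ascQ (r * r) (α * (r * r)) (r * s + r⁻¹ * σ) n := ⟨_, rfl⟩
  have hPs : ∀ s σ n, r ^ n * ascQ (r * r) (α * (r * r)) (r * s + r⁻¹ * σ) n = P s σ n :=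
    fun s σ n => by rw [hP]
  have hrec : ∀ s σ n, P s σ (n + 2) = (r * r * s + σ) * P s σ (n + 1) -
      r * r * (1 - (r * r) ^ (n + 1)) * (1 + α * (r * r) ^ (n + 1)) * P s σ n := by
    intro s σ n
    simp only [hP, ascQ]
    have : r ^ (n + 2) * (r⁻¹ * σ) = r ^ (n + 1) * σ := by
      rw [pow_succ r (n + 1)]; field_simp
    linear_combination (ascQ (r * r) (α * (r * r)) (r * s + r⁻¹ * σ) (n + 1)) * this
  have p0 : ∀ s σ, P s σ 0 = 1 := fun s σ => by simp [hP, ascQ]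
  have p1 : ∀ s σ, P s σ 1 = r * r * s + σ := fun s σ => by simp only [hP, ascQ]; field_simp
  simp only [hPs]
  clear hPs hP
  generalize r * r = q at *
  -- A connection formula between the parameters `α` and `α q`. It serves to replace the
  -- second-order recurrence of `P` by the first-order one in `hfirst`.
  have hI : ∀ s σ, s * σ = 1 → ∀ n, q ^ (n + 1) * ascQ q α (s + σ) (n + 1) =
      P s σ (n + 1) - (1 - q ^ (n + 1)) * σ * P s σ n := by
    intro s σ hs n
    induction n using Nat.twoStepInduction with
    | zero => simp [p0, p1, ascQ]; ring
    | one =>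
      have := hrec s σ 0
      simp only [p0, p1, zero_add] at this ⊢
      rw [this]
      simp only [ascQ]
      linear_combination (2 * q ^ 2 - q - q ^ 3) * hs
    | more n i0 i1 =>
      have e1 := hrec s σ (n + 1)
      have e0 := hrec s σ n
      have e2 : ascQ q α (s + σ) (n + 2 + 1) = (s + σ) * ascQ q α (s + σ) (n + 1 + 1) -
        (1 - q ^ (n + 2)) * (1 + α * q ^ (n + 1)) * ascQ q α (s + σ) (n + 1) := by rw [ascQ]
      rw [e2]
      linear_combination q * (s + σ) * i1 - q ^ 2 * (1 - q ^ (n + 2)) *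
        (1 + α * q ^ (n + 1)) * i0 - e1 + q * (1 - q ^ (n + 2)) * σ * e0 +
        (1 - q ^ (n + 2)) * q * (q - 1) * P s σ (n + 1) * hs
  have hfirst : ∀ s σ, s * σ = 1 → ∀ n, P s σ (n + 1) = (σ - α * q ^ (n + 1) * s) * P s σ n +
      (1 + α * q ^ n) * q ^ (n + 1) * s * ascQ q α (s + σ) n := by
    intro s σ hs n
    cases n with
    | zero => simp only [p0, p1, ascQ]; ring
    | succ n =>
      linear_combination hrec s σ n + (1 + α * q ^ (n + 1)) * q * s * (-hI s σ hs n) +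
        q * (1 + α * q ^ (n + 1)) * (1 - q ^ (n + 1)) * P s σ n * hs
  have hs' : σ * s = 1 := by rw [mul_comm]; exact hs
  -- The relation alone is not inductive: a step by `hfirst` brings in the same sum with extra
  -- weights `s` and `σ`. The second identity evaluates that sum, and the pair is inductive.
  suffices h : (σ * (1 - σ ^ 2) * (1 - α * s ^ 2)) * P s σ n +
      (s * (1 - s ^ 2) * (1 - α * σ ^ 2)) * P σ s n =
        (1 - s ^ 2) * (1 - σ ^ 2) * ascQ q α (s + σ) (n + 1) ∧
      (σ * (1 - σ ^ 2) * (1 - α * s ^ 2)) * s * P s σ n +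
      (s * (1 - s ^ 2) * (1 - α * σ ^ 2)) * σ * P σ s n =
        (1 - s ^ 2) * (1 - σ ^ 2) * (1 + α * q ^ n) * ascQ q α (s + σ) n from h.1
  have hσ : σ = s⁻¹ := eq_inv_of_mul_eq_one_right hs
  have hs0 : s ≠ 0 := left_ne_zero_of_mul_eq_one hs
  induction n with
  | zero =>
    simp only [p0, ascQ]
    subst hσ
    constructor
    · field_simp; ring
    · field_simp; ring
  | succ n ih =>
    obtain ⟨hA, hB⟩ := ih
    have f1 := hfirst s σ hs n
    have f2 := hfirst σ s hs' n
    rw [add_comm σ s] at f2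
    have e2 : ascQ q α (s + σ) (n + 1 + 1) = (s + σ) * ascQ q α (s + σ) (n + 1) -
        (1 - q ^ (n + 1)) * (1 + α * q ^ n) * ascQ q α (s + σ) n := by rw [ascQ]
    have k1 : σ * (1 - σ ^ 2) * (1 - α * s ^ 2) * s + s * (1 - s ^ 2) * (1 - α * σ ^ 2) * σ =
        (1 - s ^ 2) * (1 - σ ^ 2) * (1 + α) := by subst hσ; field_simp; ring
    have k2 : σ * (1 - σ ^ 2) * (1 - α * s ^ 2) * s ^ 2 +
        s * (1 - s ^ 2) * (1 - α * σ ^ 2) * σ ^ 2 =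
        (1 - s ^ 2) * (1 - σ ^ 2) * α * (s + σ) := by subst hσ; field_simp; ring
    generalize σ * (1 - σ ^ 2) * (1 - α * s ^ 2) = X at *
    generalize s * (1 - s ^ 2) * (1 - α * σ ^ 2) = Y at *
    generalize (1 - s ^ 2) * (1 - σ ^ 2) = D at *
    rw [e2, f1, f2]
    generalize ascQ q α (s + σ) n = Q0 at *
    generalize ascQ q α (s + σ) (n + 1) = Q1 at *
    generalize P s σ n = P0 at *
    generalize P σ s n = M0 at *
    constructor
    · linear_combination (s + σ) * hA - (1 + α * q ^ (n + 1)) * hB +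
        (1 + α * q ^ n) * q ^ (n + 1) * Q0 * k1
    · linear_combination (1 + α * q ^ (n + 1)) * hA - α * q ^ (n + 1) * (s + σ) * hB +
        (X * P0 + Y * M0) * (1 + α * q ^ (n + 1)) * hs + (1 + α * q ^ n) * q ^ (n + 1) * Q0 * k2

end Algebra

/-! ### The basic hypergeometric form of the polynomials -/

section ThreePhiTwo

variable {K : Type*} [Field K]

/-- The coefficients of the `₃φ₂` representation of `Q_n`. -/
def phiCoeff (q a : K) (n k : ℕ) : K :=
  qPoch (-a ^ 2) q n / a ^ n * (qPoch (q ^ (-(n : ℤ))) q k * q ^ k /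
    (qPoch (-a ^ 2) q k * qPoch q q k))

lemma qPoch_neg_zpow_eq_zero {q : K} (hq : q ≠ 0) {n k : ℕ} (h : n < k) :
    qPoch (q ^ (-(n : ℤ))) q k = 0 := by
  refine Finset.prod_eq_zero (Finset.mem_range.2 h) ?_
  rw [zpow_neg, zpow_natCast, inv_mul_cancel₀ (pow_ne_zero _ hq), sub_self]

lemma phiCoeff_recurrence_zero {q a : K} (ha : a ≠ 0) (n : ℕ) :
    phiCoeff q a (n + 2) 0 + (1 - q ^ (n + 1)) * (1 + a ^ 2 * q ^ n) * phiCoeff q a n 0 =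
      phiCoeff q a (n + 1) 0 * (1 + a ^ 2) / a := by
  simp only [phiCoeff, qPoch_zero, qPoch_succ]
  field_simp
  ring

/-- The three-term recurrence compared at the basis element `(a s, a σ; q)_(k+1)`. Multiplication by
`s + σ` maps the `k`-th basis element into the span of the `k`-th and the next one, which produces
the term with index `k`. -/
lemma phiCoeff_recurrence {q a : K} (hq : q ≠ 0) (ha : a ≠ 0) (hne : ∀ n, qPoch q q n ≠ 0)
    (hne' : ∀ n, qPoch (-a ^ 2) q n ≠ 0) (n k : ℕ) :
    phiCoeff q a (n + 2) (k + 1) +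
        (1 - q ^ (n + 1)) * (1 + a ^ 2 * q ^ n) * phiCoeff q a n (k + 1) +
        phiCoeff q a (n + 1) k / (a * q ^ k) =
      phiCoeff q a (n + 1) (k + 1) * (1 + a ^ 2 * q ^ (2 * (k + 1))) / (a * q ^ (k + 1)) := by
  have e0 : q ^ (-(n : ℤ)) = (q ^ n)⁻¹ := by rw [zpow_neg, zpow_natCast]
  have e1 : q ^ (-((n + 1 : ℕ) : ℤ)) = (q ^ n)⁻¹ * q⁻¹ := by
    rw [zpow_neg, zpow_natCast, pow_succ, mul_inv]
  have e2 : q ^ (-((n + 2 : ℕ) : ℤ)) = (q ^ n)⁻¹ * q⁻¹ * q⁻¹ := by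
    rw [zpow_neg, zpow_natCast, pow_succ, pow_succ, mul_inv, mul_inv]
  simp only [phiCoeff, e0, e1, e2]
  have hm : q ^ n ≠ 0 := pow_ne_zero _ hq
  have hP := hne' n
  have s1 : ∀ v : K, v * q⁻¹ * q = v := fun v => by field_simp
  cases k with
  | zero =>
    have h1 := hne 1
    have h2 := hne' 1
    simp only [zero_add, qPoch_succ, qPoch_zero, pow_zero, mul_one, one_mul] at h1 h2 ⊢
    rw [sub_neg_eq_add] at h2 ⊢
    rw [pow_succ q n]
    simp only [neg_mul, sub_neg_eq_add]
    clear e0 e1 e2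
    generalize q ^ n = m at *
    field_simp
    ring
  | succ j =>
    have h1 := hne (j + 2)
    have h2 := hne' (j + 2)
    -- Splitting off leading or trailing factors reduces all shifted factorials of `q^(-n)`,
    -- `q^(-n-1)`, `q^(-n-2)` to the common factor `(q^(-n); q)_j`; a rational identity remains. Two
    -- factors have to be available, hence the separate case `k = 0`.
    have t0 : ∀ v : K, qPoch v q (j + 1 + 1) = qPoch v q j * (1 - v * q ^ j) *
      (1 - v * q ^ (j + 1)) := fun v => by rw [qPoch_succ, qPoch_succ]
    have t1 : ∀ v : K, qPoch (v * q⁻¹) q (j + 1 + 1) = (1 - v * q⁻¹) * (qPoch v q j *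
      (1 - v * q ^ j)) := fun v => by rw [qPoch_succ', s1, qPoch_succ]
    have t2 : ∀ v : K, qPoch (v * q⁻¹ * q⁻¹) q (j + 1 + 1) = (1 - v * q⁻¹ * q⁻¹) *
      ((1 - v * q⁻¹) * qPoch v q j) := fun v => by rw [qPoch_succ', s1, qPoch_succ', s1]
    have t3 : ∀ v : K, qPoch (v * q⁻¹) q (j + 1) = (1 - v * q⁻¹) * qPoch v q j :=
      fun v => by rw [qPoch_succ', s1]
    rw [t2, t1, t0 (q ^ n)⁻¹, t3]
    simp only [qPoch_succ, mul_ne_zero_iff, neg_mul, sub_neg_eq_add] at h1 h2 ⊢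
    obtain ⟨⟨a1, a2⟩, a3⟩ := h1
    obtain ⟨⟨b1, b2⟩, b3⟩ := h2
    rw [pow_succ q n]
    clear e0 e1 e2 t0 t1 t2 t3
    generalize qPoch (q ^ n)⁻¹ q j = V
    generalize q ^ n = m at *
    have c3 : 1 - q ^ 2 * q ^ j ≠ 0 := by convert a3 using 1; ring
    have d3 : 1 + a ^ 2 * q * q ^ j ≠ 0 := by convert b3 using 1; ring
    rw [pow_succ q j] at *
    rw [show q ^ (2 * (j + 1 + 1)) = (q ^ j) ^ 2 * q ^ 4 by ring,
      show q ^ (j + 1 + 1) = q ^ j * q * q by ring]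
    have hy : q ^ j ≠ 0 := pow_ne_zero _ hq
    generalize q ^ j = y at *
    field_simp
    ring

lemma sum_phiCoeff_eq_ascQ {q a s σ : K} (hs : s * σ = 1) (hq : q ≠ 0) (ha : a ≠ 0)
    (hne : ∀ n, qPoch q q n ≠ 0) (hne' : ∀ n, qPoch (-a ^ 2) q n ≠ 0) (n : ℕ) :
    ∑ k ∈ Finset.range (n + 1), phiCoeff q a n k * (qPoch (a * s) q k * qPoch (a * σ) q k) =
      ascQ q (a ^ 2) (s + σ) n := by
  set B : ℕ → K := fun k => qPoch (a * s) q k * qPoch (a * σ) q k with hB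
  have hext : ∀ n N, n + 1 ≤ N → ∑ k ∈ Finset.range (n + 1), phiCoeff q a n k * B k =
      ∑ k ∈ Finset.range N, phiCoeff q a n k * B k := by
    intro n N hN
    refine Finset.sum_subset (Finset.range_subset_range.2 hN) fun k _ hk => ?_
    rw [phiCoeff, qPoch_neg_zpow_eq_zero hq (by simpa using hk)]
    simp
  have hBz : ∀ k, (s + σ) * B k = (1 + a ^ 2 * q ^ (2 * k)) / (a * q ^ k) * B k -
      B (k + 1) / (a * q ^ k) := by
    intro k
    simp only [hB, qPoch_succ]
    generalize qPoch (a * s) q k = S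
    generalize qPoch (a * σ) q k = T
    field_simp
    linear_combination (S * T * a ^ 2 * q ^ (2 * k)) * hs
  refine eq_ascQ (f := fun n => ∑ k ∈ Finset.range (n + 1), phiCoeff q a n k * B k) ?_ ?_ ?_ n
  · simp [phiCoeff, hB, qPoch_zero]
  · have h1 := hne 1
    have h2 := hne' 1
    simp only [qPoch_succ, qPoch_zero, pow_zero, mul_one, one_mul, sub_neg_eq_add] at h1 h2
    simp [Finset.sum_range_succ, phiCoeff, hB, qPoch_succ, qPoch_zero]
    field_simp
    linear_combination (a ^ 2 * (q - 1)) * hs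
  · intro n
    rw [hext n (n + 3) (by lia), hext (n + 1) (n + 3) (by lia)]
    -- The defect of the recurrence telescopes in `k`. The boundary term at `M = n + 2` vanishes
    -- because `(q^(-n-1); q)_(n+2) = 0`.
    have key : ∀ M, ∑ k ∈ Finset.range (M + 1), (phiCoeff q a (n + 2) k * B k -
        (s + σ) * (phiCoeff q a (n + 1) k * B k) +
        (1 - q ^ (n + 1)) * (1 + a ^ 2 * q ^ n) * (phiCoeff q a n k * B k)) =
        phiCoeff q a (n + 1) M / (a * q ^ M) * B (M + 1) := by
      intro M
      induction M with
      | zero =>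
        have h := phiCoeff_recurrence_zero (q := q) ha n
        have hz := hBz 0
        simp only [zero_add, Finset.sum_range_one, mul_zero, pow_zero, mul_one] at hz ⊢
        linear_combination B 0 * h - phiCoeff q a (n + 1) 0 * hz
      | succ M ih =>
        rw [Finset.sum_range_succ, ih]
        have h := phiCoeff_recurrence hq ha hne hne' n M
        linear_combination B (M + 1) * h - phiCoeff q a (n + 1) (M + 1) * hBz (M + 1)
    have h := key (n + 2)
    rw [Finset.sum_add_distrib, Finset.sum_sub_distrib, ← Finset.mul_sum, ← Finset.mul_sum,
      show phiCoeff q a (n + 1) (n + 2) = 0 by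
        rw [phiCoeff, qPoch_neg_zpow_eq_zero hq (by lia)]; simp] at h
    linear_combination h

end ThreePhiTwo

lemma sqrtC_sq (α : ℝ) : sqrtC α ^ 2 = α := by
  rw [sqrtC, one_div]
  exact Complex.cpow_ofNat_inv_pow _ 2

lemma sqrtC_ne_zero {α : ℝ} (h : α ≠ 0) : sqrtC α ≠ 0 := by
  intro h0
  have := sqrtC_sq α
  rw [h0] at this
  exact h (by exact_mod_cast (by simpa using this.symm))

lemma norm_ofReal_lt_one {q : ℝ} (hq0 : 0 < q) (hq1 : q < 1) : ‖(q : ℂ)‖ < 1 := by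
  simpa [abs_of_pos hq0] using hq1

lemma qPoch_neg_ne_zero {q α : ℝ} (hq0 : 0 < q) (hq1 : q < 1) (hα : -1 < α) (n : ℕ) :
    qPoch (-(α : ℂ)) (q : ℂ) n ≠ 0 := by
  have := (qPoch_pos hq0 hq1 (a := -α) (by linarith) n).ne'
  rw [← Complex.ofReal_neg, ← qPoch_ofReal]
  exact_mod_cast this

lemma exp_mul_exp_neg (x : ℂ) : Complex.exp x * Complex.exp (-x) = 1 := by
  rw [← Complex.exp_add]; simp

lemma two_cos_eq (θ : ℝ) : ((2 * Real.cos θ : ℝ) : ℂ) =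
    Complex.exp (Complex.I * θ) + Complex.exp (-(Complex.I * θ)) := by
  push_cast
  rw [Complex.two_cos, mul_comm, neg_mul, mul_comm]

lemma alSalamChihara_eq_ascQ {q α : ℝ} (hq0 : 0 < q) (hq1 : q < 1) (hα : -1 < α) (hα0 : α ≠ 0)
    (n : ℕ) (θ : ℝ) :
    alSalamChihara q n θ (sqrtC α) (-sqrtC α) = ascQ q α (2 * Real.cos θ) n := by
  have hq : (q : ℂ) ≠ 0 := by exact_mod_cast hq0.ne'
  have hqn := norm_ofReal_lt_one hq0 hq1
  have hab : sqrtC α * -sqrtC α = -sqrtC α ^ 2 := by ring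
  have h := sum_phiCoeff_eq_ascQ (q := (q : ℂ)) (a := sqrtC α) (exp_mul_exp_neg (Complex.I * θ)) hq
    (sqrtC_ne_zero hα0) (qPoch_self_ne_zero hqn)
    (fun n => by rw [sqrtC_sq]; exact qPoch_neg_ne_zero hq0 hq1 hα n) n
  rw [sqrtC_sq] at h
  rw [ascQ_ofReal, two_cos_eq, ← h, alSalamChihara, basicHyp, hab]
  rw [tsum_eq_sum (s := Finset.range (n + 1)) fun k hk => by
    rw [List.map_cons, List.prod_cons, qPoch_neg_zpow_eq_zero hq (by simpa using hk)]; simp]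
  rw [Finset.mul_sum]
  refine Finset.sum_congr rfl fun k _ => ?_
  simp only [phiCoeff, List.map_cons, List.map_nil, List.prod_cons, List.prod_nil, mul_one,
    List.length_cons, List.length_nil, qPoch_zero_left]
  norm_num
  field_simp

/-- At `α = 0` the convolution formula `ascQ_eq_conv` is the `q`-binomial sum defining the
continuous `q`-Hermite polynomial. -/
lemma qHermite_eq_ascQ {q : ℝ} (hq0 : 0 < q) (hq1 : q < 1) (n : ℕ) (θ : ℝ) :
    qHermite q n θ = ascQ q 0 (2 * Real.cos θ) n := by
  have hq : (q : ℂ) ≠ 0 := by exact_mod_cast hq0.ne'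
  have hqn := norm_ofReal_lt_one hq0 hq1
  have h := ascQ_eq_conv (q := (q : ℂ)) (α := 0) (exp_mul_exp_neg (Complex.I * θ)) hq
    (qPoch_self_ne_zero hqn) (fun n => by simp [qPoch_zero_left]) n
  rw [ascQ_ofReal, two_cos_eq, Complex.ofReal_zero, h, qHermite, Finset.mul_sum,
    Finset.Nat.sum_antidiagonal_eq_sum_range_succ_mk]
  refine Finset.sum_congr rfl fun k hk => ?_
  have hk : k ≤ n := by simpa [Nat.lt_succ_iff] using hk
  have e : Complex.exp (Complex.I * (((n : ℂ) - 2 * k) * θ)) =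
      Complex.exp (-(Complex.I * θ)) ^ k * Complex.exp (Complex.I * θ) ^ (n - k) := by
    rw [← Complex.exp_nat_mul, ← Complex.exp_nat_mul, ← Complex.exp_add]
    congr 1
    push_cast [hk]
    ring
  rw [e]
  simp [qPoch_zero_left, qPoch_ofReal]
  ring

/-- The normalized basis functions in terms of the recurrence polynomials. -/
lemma basisFun_eq {q α : ℝ} (hq0 : 0 < q) (hq1 : q < 1) (hα : -1 < α) (n : ℕ) (x : ℝ) :
    basisFun q α n x = (((√(qPoch (-α) q n * qPoch q q n))⁻¹ *
      ascQ q α (2 * Real.cos (angle q x)) n : ℝ) : ℂ) := by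
  rw [basisFun]
  split_ifs with h
  · subst h; rw [qHermite_eq_ascQ hq0 hq1]; push_cast; rfl
  · rw [alSalamChihara_eq_ascQ hq0 hq1 hα h]; push_cast; rfl

/-! ### Bounds and generating functions -/

lemma exists_norm_qPoch_le {q : ℝ} (hq0 : 0 < q) (hq1 : q < 1) :
    ∃ C : ℝ, 0 < C ∧ ∀ a : ℂ, ‖a‖ ≤ 1 → ∀ n, ‖qPoch a (q : ℂ) n‖ ≤ C := by
  have hq : ‖q‖ < 1 := by rwa [Real.norm_eq_abs, abs_of_pos hq0]
  obtain ⟨C, hC⟩ := (tendsto_qPoch hq (-1)).bddAbove_range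
  refine ⟨C, lt_of_lt_of_le one_pos (by simpa [qPoch_zero] using hC ⟨0, rfl⟩), fun a ha n => ?_⟩
  refine le_trans ?_ (hC ⟨n, rfl⟩)
  rw [qPoch, qPoch, norm_prod]
  refine Finset.prod_le_prod (fun _ _ => norm_nonneg _) fun k _ => ?_
  refine (norm_sub_le _ _).trans ?_
  rw [norm_one, norm_mul, norm_pow, Complex.norm_real, Real.norm_eq_abs, abs_of_pos hq0]
  have : 0 < q ^ k := by positivity
  nlinarith

lemma exists_qPoch_inv_le {q a : ℝ} (hq0 : 0 < q) (hq1 : q < 1) (ha : |a| < 1) :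
    ∃ C : ℝ, 0 < C ∧ ∀ n, (qPoch a q n)⁻¹ ≤ C := by
  have hq : ‖q‖ < 1 := by rwa [Real.norm_eq_abs, abs_of_pos hq0]
  obtain ⟨C, hC⟩ := ((tendsto_qPoch hq a).inv₀ (qPochInf_ne_zero hq ha)).bddAbove_range
  exact ⟨C, lt_of_lt_of_le one_pos (by simpa [qPoch_zero] using hC ⟨0, rfl⟩), fun n => hC ⟨n, rfl⟩⟩

lemma norm_exp_I_mul (θ : ℝ) : ‖Complex.exp (Complex.I * θ)‖ = 1 := by
  rw [mul_comm, Complex.norm_exp_ofReal_mul_I]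

lemma norm_exp_neg_I_mul (θ : ℝ) : ‖Complex.exp (-(Complex.I * θ))‖ = 1 := by
  rw [Complex.exp_neg, norm_inv, norm_exp_I_mul, inv_one]

/-- The coefficients of the `₂φ₁` in the generating function of the `Q_n`. -/
noncomputable def genCoeff (q α : ℝ) (σ : ℂ) (j : ℕ) : ℂ :=
  qPoch (α * σ ^ 2) ((q : ℂ) ^ 2) j / (qPoch (-(α : ℂ)) (q : ℂ) j * qPoch (q : ℂ) (q : ℂ) j)

lemma exists_norm_genCoeff_le {q α : ℝ} (hq0 : 0 < q) (hq1 : q < 1) (hα : |α| < 1) :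
    ∃ C : ℝ, 0 < C ∧ ∀ σ : ℂ, ‖σ‖ = 1 → ∀ j, ‖genCoeff q α σ j‖ ≤ C := by
  obtain ⟨C1, h1, H1⟩ := exists_norm_qPoch_le (q := q ^ 2) (by positivity)
    (pow_lt_one₀ hq0.le hq1 two_ne_zero)
  obtain ⟨C2, h2, H2⟩ := exists_qPoch_inv_le hq0 hq1 (a := -α) (by simpa using hα)
  obtain ⟨C3, h3, H3⟩ := exists_qPoch_inv_le hq0 hq1 (a := q) (by rwa [abs_of_pos hq0])
  refine ⟨C1 * (C2 * C3), by positivity, fun σ hσ j => ?_⟩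
  have p2 := qPoch_pos hq0 hq1 (a := -α) (by linarith [(abs_lt.1 hα).1]) j
  have p3 := qPoch_pos hq0 hq1 (a := q) hq1 j
  rw [genCoeff, norm_div, div_eq_mul_inv, norm_mul, mul_inv]
  rw [← Complex.ofReal_neg, ← qPoch_ofReal, ← qPoch_ofReal, Complex.norm_real, Complex.norm_real,
    Real.norm_eq_abs, Real.norm_eq_abs, abs_of_pos p2, abs_of_pos p3]
  have e1 := H1 (α * σ ^ 2) (by rw [norm_mul, norm_pow, hσ]; simpa using hα.le) j
  push_cast at e1
  gcongr
  exacts [H2 j, H3 j]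

lemma ascQ_eq_sum_genCoeff {q α : ℝ} (hq0 : 0 < q) (hq1 : q < 1) (hα : -1 < α) (θ : ℝ) (n : ℕ) :
    ((ascQ q α (2 * Real.cos θ) n / (qPoch (-α) q n * qPoch q q n) : ℝ) : ℂ) =
      ∑ p ∈ antidiagonal n, Complex.exp (-(Complex.I * θ)) ^ p.1 / qPoch (q : ℂ) q p.1 *
        (Complex.exp (Complex.I * θ) ^ p.2 * genCoeff q α (Complex.exp (-(Complex.I * θ))) p.2) := by
  have hq : (q : ℂ) ≠ 0 := by exact_mod_cast hq0.ne'
  have h1 := qPoch_self_ne_zero (norm_ofReal_lt_one hq0 hq1)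
  have h2 := qPoch_neg_ne_zero hq0 hq1 hα
  have h := ascQ_eq_conv (α := (α : ℂ)) (exp_mul_exp_neg (Complex.I * θ)) hq h1 h2 n
  rw [Complex.ofReal_div, ascQ_ofReal, two_cos_eq, h]
  simp only [Complex.ofReal_mul, qPoch_ofReal, Complex.ofReal_neg, genCoeff, mul_div_assoc]
  rw [mul_comm (qPoch (q : ℂ) q n), ← mul_div_assoc,
    mul_div_cancel_left₀ _ (mul_ne_zero (h2 n) (h1 n))]

/-- On the circle the powers of `e^{±iθ}` are unimodular and the coefficients in the convolution are
bounded, so the `n + 1` summands give linear growth, uniformly in `θ`. -/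
lemma exists_abs_ascQ_le {q α : ℝ} (hq0 : 0 < q) (hq1 : q < 1) (hα : |α| < 1) :
    ∃ C : ℝ, 0 < C ∧ ∀ θ n, |ascQ q α (2 * Real.cos θ) n / (qPoch (-α) q n * qPoch q q n)| ≤
      C * (n + 1) := by
  obtain ⟨C1, h1, H1⟩ := exists_norm_genCoeff_le hq0 hq1 hα
  obtain ⟨C3, h3, H3⟩ := exists_qPoch_inv_le hq0 hq1 (a := q) (by rwa [abs_of_pos hq0])
  refine ⟨C3 * C1, by positivity, fun θ n => ?_⟩
  rw [← Real.norm_eq_abs, ← Complex.norm_real, ascQ_eq_sum_genCoeff hq0 hq1 (abs_lt.1 hα).1]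
  refine (norm_sum_le_of_le _ (f := _) (n := fun _ => C3 * C1) fun p _ => ?_).trans (by simp; linarith)
  have p3 := qPoch_pos hq0 hq1 (a := q) hq1 p.1
  rw [norm_mul, norm_div, norm_mul, norm_pow, norm_pow, norm_exp_I_mul, norm_exp_neg_I_mul,
    one_pow, one_pow, one_mul, ← qPoch_ofReal, Complex.norm_real, Real.norm_eq_abs, abs_of_pos p3,
    one_div]
  gcongr
  exacts [H3 _, H1 _ (norm_exp_neg_I_mul θ) _]

/-- The generating function of the `Q_n` with a `₂φ₁`. -/
lemma tsum_ascQ {q α : ℝ} (hq0 : 0 < q) (hq1 : q < 1) (hα : |α| < 1) (θ : ℝ) {t : ℂ}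
    (ht : ‖t‖ < 1) :
    ∑' n, t ^ n * (ascQ q α (2 * Real.cos θ) n / (qPoch (-α) q n * qPoch q q n) : ℝ) =
      1 / qPochInf (t * Complex.exp (-(Complex.I * θ))) (q : ℂ) *
        basicHyp [sqrtC α * Complex.exp (-(Complex.I * θ)),
          -sqrtC α * Complex.exp (-(Complex.I * θ))] [-(α : ℂ)] (q : ℂ)
          (t * Complex.exp (Complex.I * θ)) := by
  have hqn := norm_ofReal_lt_one hq0 hq1
  set s := Complex.exp (Complex.I * θ) with hs
  set σ := Complex.exp (-(Complex.I * θ)) with hσ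
  have ns : ‖s‖ = 1 := norm_exp_I_mul θ
  have nσ : ‖σ‖ = 1 := norm_exp_neg_I_mul θ
  have hts : ‖t * σ‖ < 1 := by rwa [norm_mul, nσ, mul_one]
  have hb : basicHyp [sqrtC α * σ, -sqrtC α * σ] [-(α : ℂ)] (q : ℂ) (t * s) =
      ∑' j, (t * s) ^ j * genCoeff q α σ j := by
    refine tsum_congr fun j => ?_
    have e : qPoch (sqrtC α * σ) (q : ℂ) j * qPoch (-sqrtC α * σ) (q : ℂ) j =
        qPoch (α * σ ^ 2) ((q : ℂ) ^ 2) j := by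
      rw [neg_mul, qPoch_sq, mul_pow, sqrtC_sq]
    simp only [List.map_cons, List.map_nil, List.prod_cons, List.prod_nil, mul_one,
      List.length_cons, List.length_nil, e, genCoeff]
    norm_num
    ring
  have hg : Summable fun j => ‖(t * s) ^ j * genCoeff q α σ j‖ := by
    obtain ⟨C, h, H⟩ := exists_norm_genCoeff_le hq0 hq1 hα
    refine Summable.of_nonneg_of_le (fun _ => norm_nonneg _) (fun j => ?_)
      ((summable_geometric_of_lt_one (norm_nonneg t) ht).mul_right C)
    rw [norm_mul, norm_pow, norm_mul, ns, mul_one]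
    exact mul_le_mul_of_nonneg_left (H σ nσ j) (by positivity)
  rw [hb, ← tsum_pow_div_qPoch hqn hts, tsum_mul_tsum_eq_tsum_sum_antidiagonal_of_summable_norm
    (summable_norm_pow_div_qPoch hqn hts) hg]
  refine tsum_congr fun n => ?_
  rw [ascQ_eq_sum_genCoeff hq0 hq1 (abs_lt.1 hα).1, Finset.mul_sum]
  refine Finset.sum_congr rfl fun p hp => ?_
  rw [← Finset.HasAntidiagonal.mem_antidiagonal.1 hp, pow_add]
  ring

lemma qFact_mul_pow {q : ℝ} (hq1 : q < 1) (n : ℕ) : qFact q n * (1 - q) ^ n = qPoch q q n := by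
  have : 1 - q ≠ 0 := by linarith
  induction n with
  | zero => simp [qFact, qPoch_zero]
  | succ n ih =>
    rw [qPoch_succ, ← ih, qFact, qFact, Finset.prod_range_succ, qNum]
    field_simp
    ring

lemma genFact_mul_pow {q : ℝ} (hq1 : q < 1) (α : ℝ) (n : ℕ) :
    genFact q α n * (1 - q) ^ n = qPoch (-α) q n * qPoch q q n := by
  rw [genFact, mul_assoc, qFact_mul_pow hq1]

lemma genFact_pos {q α : ℝ} (hq0 : 0 < q) (hq1 : q < 1) (hα : -1 < α) (n : ℕ) :
    0 < genFact q α n := by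
  have h := genFact_mul_pow hq1 α n
  have h2 := qPoch_pos hq0 hq1 (a := -α) (by linarith) n
  have h3 := qPoch_pos hq0 hq1 (a := q) hq1 n
  have h4 : 0 < (1 - q) ^ n := pow_pos (by linarith) n
  exact pos_of_mul_pos_left (h ▸ mul_pos h2 h3) h4.le

lemma norm_mul_sqrt_lt_one {q : ℝ} (hq1 : q < 1) {z : ℂ} (hz : z ∈ discCq q) :
    ‖z * (√(1 - q) : ℝ)‖ < 1 := by
  have h1 : 0 < 1 - q := by linarith
  have h2 : Complex.normSq z < (1 - q)⁻¹ := hz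
  rw [← sq_lt_one_iff₀ (norm_nonneg _), norm_mul, mul_pow, Complex.norm_real, Real.norm_eq_abs,
    sq_abs, Real.sq_sqrt h1.le, ← Complex.normSq_eq_norm_sq]
  calc Complex.normSq z * (1 - q) < (1 - q)⁻¹ * (1 - q) := by gcongr
    _ = 1 := inv_mul_cancel₀ h1.ne'

/-- The two normalizations differ by `(1 - q)^(n/2)`, which rescales `z` to the variable `z √(1 -
q)` of the generating function. -/
lemma pow_div_sqrt_mul_basisFun {q α : ℝ} (hq0 : 0 < q) (hq1 : q < 1) (hα : -1 < α) (z : ℂ)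
    (n : ℕ) (x : ℝ) :
    z ^ n / (√(genFact q α n) : ℂ) * basisFun q α n x = (z * (√(1 - q) : ℝ)) ^ n *
      (ascQ q α (2 * Real.cos (angle q x)) n / (qPoch (-α) q n * qPoch q q n) : ℝ) := by
  have h1 : 0 < 1 - q := by linarith
  have hg := genFact_pos hq0 hq1 hα n
  have h2 := qPoch_pos hq0 hq1 (a := -α) (by linarith) n
  have h3 := qPoch_pos hq0 hq1 (a := q) hq1 n
  have e : √(qPoch (-α) q n * qPoch q q n) = √(genFact q α n) * √(1 - q) ^ n := by
    rw [← genFact_mul_pow hq1, Real.sqrt_mul hg.le]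
    congr 1
    rw [Real.sqrt_eq_iff_mul_self_eq (by positivity) (by positivity), ← mul_pow,
      Real.mul_self_sqrt h1.le]
  have e2 : qPoch (-α) q n * qPoch q q n = (√(genFact q α n) * √(1 - q) ^ n) ^ 2 := by
    rw [← e, Real.sq_sqrt (by positivity)]
  have n1 : (√(genFact q α n) : ℂ) ≠ 0 := by exact_mod_cast (Real.sqrt_pos.2 hg).ne'
  have n2 : (√(1 - q) : ℂ) ≠ 0 := by exact_mod_cast (Real.sqrt_pos.2 h1).ne'
  rw [basisFun_eq hq0 hq1 hα, e, e2]
  push_cast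
  field_simp
  rw [mul_pow]
  ring

/-- The wave functions in terms of the integral kernel: the series converges absolutely, with a
bound which is uniform in `x`, and its sum is the kernel `T`. -/
lemma exists_summable_bound_wave {q α : ℝ} (hq0 : 0 < q) (hq1 : q < 1) (hα : |α| < 1) {z : ℂ}
    (hz : z ∈ discCq q) :
    ∃ u : ℕ → ℝ, Summable u ∧
      ∀ n x, ‖z ^ n / (√(genFact q α n) : ℂ) * basisFun q α n x‖ ≤ u n := by
  obtain ⟨C, h, H⟩ := exists_abs_ascQ_le hq0 hq1 hα
  have ht := norm_mul_sqrt_lt_one hq1 hz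
  refine ⟨fun n => ‖z * (√(1 - q) : ℝ)‖ ^ n * (C * (n + 1)), ?_, fun n x => ?_⟩
  · have h1 := (summable_pow_mul_geometric_of_norm_lt_one (R := ℝ) 1
      (r := ‖z * (√(1 - q) : ℝ)‖) (by simpa using ht))
    have h2 := summable_geometric_of_lt_one (norm_nonneg _) ht
    refine ((h1.add h2).mul_left C).congr fun n => ?_
    ring
  · rw [pow_div_sqrt_mul_basisFun hq0 hq1 (abs_lt.1 hα).1, norm_mul, norm_pow, Complex.norm_real,
      Real.norm_eq_abs]
    exact mul_le_mul_of_nonneg_left (H _ _) (by positivity)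

lemma tsum_wave {q α : ℝ} (hq0 : 0 < q) (hq1 : q < 1) (hα : |α| < 1) {z : ℂ}
    (hz : z ∈ discCq q) (x : ℝ) :
    ∑' n, z ^ n / (√(genFact q α n) : ℂ) * basisFun q α n x = kernelT q α z x := by
  simp only [pow_div_sqrt_mul_basisFun hq0 hq1 (abs_lt.1 hα).1]
  exact tsum_ascQ hq0 hq1 hα _ (norm_mul_sqrt_lt_one hq1 hz)

lemma conj_basisFun {q α : ℝ} (hq0 : 0 < q) (hq1 : q < 1) (hα : -1 < α) (n : ℕ) (x : ℝ) :
    conj (basisFun q α n x) = basisFun q α n x := by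
  rw [basisFun_eq hq0 hq1 hα, Complex.conj_ofReal]

lemma continuous_ascQ {q α : ℝ} (n : ℕ) : Continuous fun z : ℝ => ascQ q α z n := by
  induction n using Nat.twoStepInduction with
  | zero => exact continuous_const
  | one => exact continuous_id
  | more n h0 h1 => simp only [ascQ]; fun_prop

lemma continuous_basisFun {q α : ℝ} (hq0 : 0 < q) (hq1 : q < 1) (hα : -1 < α) (n : ℕ) :
    Continuous (basisFun q α n) := by
  have h : basisFun q α n = fun x => (((√(qPoch (-α) q n * qPoch q q n))⁻¹ *
      ascQ q α (2 * Real.cos (angle q x)) n : ℝ) : ℂ) := funext (basisFun_eq hq0 hq1 hα n)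
  rw [h]
  have h1 : Continuous fun x => 2 * Real.cos (angle q x) :=
    continuous_const.mul (Real.continuous_cos.comp
      (Real.continuous_arccos.comp (by fun_prop)))
  exact Complex.continuous_ofReal.comp (continuous_const.mul ((continuous_ascQ n).comp h1))

lemma exists_norm_basisFun_le {q α : ℝ} (hq0 : 0 < q) (hq1 : q < 1) (hα : |α| < 1) (n : ℕ) :
    ∃ C : ℝ, ∀ x, ‖basisFun q α n x‖ ≤ C := by
  obtain ⟨C, h, H⟩ := exists_abs_ascQ_le hq0 hq1 hα
  have p := mul_pos (qPoch_pos hq0 hq1 (a := -α) (by linarith [(abs_lt.1 hα).1]) n)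
    (qPoch_pos hq0 hq1 (a := q) hq1 n)
  refine ⟨(√(qPoch (-α) q n * qPoch q q n))⁻¹ * (C * (n + 1) * (qPoch (-α) q n * qPoch q q n)),
    fun x => ?_⟩
  rw [basisFun_eq hq0 hq1 (abs_lt.1 hα).1, Complex.norm_real, Real.norm_eq_abs, abs_mul,
    abs_of_nonneg (by positivity : 0 ≤ (√(qPoch (-α) q n * qPoch q q n))⁻¹)]
  have := H (angle q x) n
  rw [abs_div, abs_of_pos p, div_le_iff₀ p] at this
  gcongr

/-! ### The weight on the unit circle -/

section Circle

/-- The weight of the Al-Salam–Chihara polynomials on the unit circle, up to the factor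
`(1 - s²)(1 - s⁻²)`. -/
noncomputable def ascCore (q α : ℝ) (s : ℂ) : ℂ :=
  qPochInf (q * s ^ 2) (q : ℂ) * qPochInf (q * s⁻¹ ^ 2) (q : ℂ) *
    ((qPochInf (α * s ^ 2) ((q : ℂ) ^ 2))⁻¹ * (qPochInf (α * s⁻¹ ^ 2) ((q : ℂ) ^ 2))⁻¹)

/-- The weight of the Al-Salam–Chihara polynomials on the unit circle. -/
noncomputable def ascWeight (q α : ℝ) (s : ℂ) : ℂ :=
  (1 - s ^ 2) * (1 - s⁻¹ ^ 2) * ascCore q α s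

lemma ascCore_inv (q α : ℝ) (s : ℂ) : ascCore q α s⁻¹ = ascCore q α s := by
  simp only [ascCore, inv_inv]; ring

/-- The total mass of the weight on the circle. -/
noncomputable def ascMass (q α : ℝ) : ℂ := ∫ θ in 0..2 * Real.pi, ascWeight q α (circleMap 0 1 θ)

lemma integral_circle_inv (f : ℂ → ℂ) :
    ∫ θ in 0..2 * Real.pi, f (circleMap 0 1 θ)⁻¹ = ∫ θ in 0..2 * Real.pi, f (circleMap 0 1 θ) := by
  have h := intervalIntegral.integral_comp_sub_left (fun θ => f (circleMap 0 1 θ))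
    (a := 0) (b := 2 * Real.pi) (2 * Real.pi)
  simp only [sub_self, sub_zero] at h
  refine Eq.trans ?_ h
  refine intervalIntegral.integral_congr fun θ _ => ?_
  congr 1
  simp [circleMap, ← Complex.exp_neg, sub_mul, Complex.exp_sub]

/-- Cauchy's theorem on the annulus for `f(z) / z`, since `dz / z = i dθ`. -/
lemma integral_circle_eq_of_differentiable {f : ℂ → ℂ} {r : ℝ} (hr0 : 0 < r) (hr1 : r ≤ 1)
    (hf : ∀ s : ℂ, r ≤ ‖s‖ → ‖s‖ ≤ 1 → DifferentiableAt ℂ f s) :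
    ∫ θ in 0..2 * Real.pi, f (r * circleMap 0 1 θ) =
      ∫ θ in 0..2 * Real.pi, f (circleMap 0 1 θ) := by
  have key := Complex.circleIntegral_sub_center_inv_smul_eq_of_differentiable_on_annulus_off_countable
    (c := 0) (f := f) hr0 hr1 Set.countable_empty
    (fun z hz => (hf z (by simpa using hz.2) (by simpa using hz.1)).continuousAt.continuousWithinAt)
    (fun z hz => hf z (by simpa using (not_le.1 (by simpa using hz.1.2)).le)
      (by simpa using (mem_ball_zero_iff.1 hz.1.1).le))
  have hc : ∀ R : ℝ, R ≠ 0 → (∮ z in C(0, R), (z - 0)⁻¹ • f z) =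
      Complex.I * ∫ θ in 0..2 * Real.pi, f (R * circleMap 0 1 θ) := by
    intro R hR
    rw [circleIntegral, ← intervalIntegral.integral_const_mul]
    refine intervalIntegral.integral_congr fun θ _ => ?_
    have h0 : circleMap 0 R θ ≠ 0 := circleMap_ne_center hR
    have h1 : circleMap 0 R θ = R * circleMap 0 1 θ := by simp [circleMap]
    simp only [deriv_circleMap, sub_zero, smul_eq_mul]
    rw [← h1]
    field_simp
  rw [hc 1 one_ne_zero, hc r hr0.ne'] at key
  simpa using (mul_left_cancel₀ Complex.I_ne_zero key).symm

variable {q α : ℝ}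

lemma norm_sq_ofReal_lt_one (hq0 : 0 < q) (hq1 : q < 1) : ‖(q : ℂ) ^ 2‖ < 1 := by
  rw [norm_pow]; exact pow_lt_one₀ (norm_nonneg _) (norm_ofReal_lt_one hq0 hq1) two_ne_zero

lemma qPochInf_sq_ne_zero (hq0 : 0 < q) (hq1 : q < 1) {a : ℂ} (ha : ‖a‖ < 1) :
    qPochInf a ((q : ℂ) ^ 2) ≠ 0 :=
  qPochInf_ne_zero (norm_sq_ofReal_lt_one hq0 hq1) ha

/-- The core of the weight is holomorphic in an annulus around the unit circle. -/
lemma differentiableAt_ascCore (hq0 : 0 < q) (hq1 : q < 1) {s : ℂ} (hs : s ≠ 0)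
    (h1 : ‖(α : ℂ) * s ^ 2‖ < 1) (h2 : ‖(α : ℂ) * s⁻¹ ^ 2‖ < 1) :
    DifferentiableAt ℂ (ascCore q α) s := by
  have hqn := norm_ofReal_lt_one hq0 hq1
  have hq2 := norm_sq_ofReal_lt_one hq0 hq1
  have d1 : ∀ c : ℂ, DifferentiableAt ℂ (fun s : ℂ => c * s ^ 2) s := fun c => by fun_prop
  have d2 : ∀ c : ℂ, DifferentiableAt ℂ (fun s : ℂ => c * s⁻¹ ^ 2) s := fun c =>
    ((differentiableAt_inv hs).pow 2).const_mul c
  have e : ∀ {p : ℂ} (_ : ‖p‖ < 1) {g : ℂ → ℂ}, DifferentiableAt ℂ g s →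
      DifferentiableAt ℂ (fun s => qPochInf (g s) p) s := fun hp g hg =>
    (differentiable_qPochInf hp _).comp s hg
  exact ((e hqn (d1 q)).mul (e hqn (d2 q))).mul
    (((e hq2 (d1 α)).inv (qPochInf_sq_ne_zero hq0 hq1 h1)).mul
      ((e hq2 (d2 α)).inv (qPochInf_sq_ne_zero hq0 hq1 h2)))

lemma continuous_ascCore_circle (hq0 : 0 < q) (hq1 : q < 1) (hα : |α| < 1) :
    Continuous fun θ : ℝ => ascCore q α (circleMap 0 1 θ) := by
  refine continuous_iff_continuousAt.2 fun θ => ?_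
  have hn : ‖circleMap 0 1 θ‖ = 1 := by simp
  refine ContinuousAt.comp (f := circleMap 0 1) (g := ascCore q α)
    (differentiableAt_ascCore hq0 hq1 (by simp) ?_ ?_).continuousAt
    (continuous_circleMap 0 1).continuousAt
  · simpa [hn] using hα
  · simpa [hn] using hα

lemma continuous_ascWeight_circle (hq0 : 0 < q) (hq1 : q < 1) (hα : |α| < 1) :
    Continuous fun θ : ℝ => ascWeight q α (circleMap 0 1 θ) := by
  have h : Continuous fun θ : ℝ => (circleMap 0 1 θ)⁻¹ :=
    (continuous_circleMap 0 1).inv₀ (by simp)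
  have := continuous_ascCore_circle hq0 hq1 hα
  unfold ascWeight
  fun_prop

/-- The function whose shifts give the raising operator. -/
noncomputable def raisingFun (q α : ℝ) (p : ℂ → ℂ) (s : ℂ) : ℂ :=
  s⁻¹ * (1 - s ^ 2) * ascCore q (α * q) s * p s

/-- Replacing `s` by `√q s` multiplies `s²` by `q` and `s⁻²` by `q⁻¹`, so each infinite product
gains or loses at most one factor. The lost `1 - q s²` is restored by the prefactor `1 - s²`, and
the parameter `α q` is what makes the denominators return to those of `α`. -/
lemma raisingFun_shift (hq0 : 0 < q) (hq1 : q < 1) (hα : |α| < 1) (p : ℂ → ℂ) {s : ℂ}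
    (hs : ‖s‖ = 1) :
    (√q : ℂ) * raisingFun q α p (√q * s) =
      ascCore q α s * (s⁻¹ * (1 - s⁻¹ ^ 2) * (1 - α * s ^ 2)) * p (√q * s) := by
  have hqn := norm_ofReal_lt_one hq0 hq1
  have hq2 := norm_sq_ofReal_lt_one hq0 hq1
  have hr : (√q : ℂ) ^ 2 = q := by exact_mod_cast Real.sq_sqrt hq0.le
  have hr0 : (√q : ℂ) ≠ 0 := by exact_mod_cast (Real.sqrt_pos.2 hq0).ne'
  have hs0 : s ≠ 0 := by rintro rfl; simp at hs
  have hq : (q : ℂ) ≠ 0 := by exact_mod_cast hq0.ne'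
  have n1 : ‖(α : ℂ) * s ^ 2‖ < 1 := by simpa [hs] using hα
  have n2 : ‖(α : ℂ) * s⁻¹ ^ 2‖ < 1 := by simpa [hs] using hα
  have a1 : (q : ℂ) * (√q * s) ^ 2 = (q * s ^ 2) * q := by rw [mul_pow, hr]; ring
  have a2 : (q : ℂ) * (√q * s)⁻¹ ^ 2 = s⁻¹ ^ 2 := by
    rw [mul_inv, mul_pow, inv_pow, hr, ← mul_assoc, mul_inv_cancel₀ hq, one_mul]
  have a3 : ((α * q : ℝ) : ℂ) * (√q * s) ^ 2 = α * s ^ 2 * q ^ 2 := by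
    rw [mul_pow, hr]; push_cast; ring
  have a4 : ((α * q : ℝ) : ℂ) * (√q * s)⁻¹ ^ 2 = α * s⁻¹ ^ 2 := by
    rw [← a2]; push_cast; ring
  have b1 := qPochInf_eq_mul hqn (q * s ^ 2)
  have b2 := qPochInf_eq_mul hqn (s⁻¹ ^ 2)
  have b3 := qPochInf_eq_mul hq2 (α * s ^ 2)
  have c1 : qPochInf (α * s ^ 2 * q ^ 2) ((q : ℂ) ^ 2) ≠ 0 := fun h =>
    qPochInf_sq_ne_zero hq0 hq1 n1 (by rw [b3, h, mul_zero])
  have c2 : 1 - α * s ^ 2 ≠ 0 := fun h =>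
    qPochInf_sq_ne_zero hq0 hq1 n1 (by rw [b3, h, zero_mul])
  have c2' : 1 - s ^ 2 * α ≠ 0 := by rwa [mul_comm]
  rw [raisingFun, ascCore, ascCore, a1, a2, a3, a4, b2, b1, b3, mul_comm (s⁻¹ ^ 2) (q : ℂ)]
  have d : (1 - (√q * s) ^ 2 : ℂ) = 1 - q * s ^ 2 := by rw [mul_pow, hr]
  rw [d]
  generalize qPochInf (α * s ^ 2 * q ^ 2) ((q : ℂ) ^ 2) = D1 at *
  generalize (qPochInf (α * s⁻¹ ^ 2) ((q : ℂ) ^ 2))⁻¹ = D2 at *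
  generalize p (√q * s) = P
  generalize qPochInf (q * s ^ 2 * q) (q : ℂ) = N1
  generalize qPochInf (q * s⁻¹ ^ 2) (q : ℂ) = N2
  field_simp

/-- For `|s|² ≥ q` one has `|α q s⁻²| ≤ |α| < 1`, so no pole of the weight with parameter `α q` lies
in the annulus swept by the contour. -/
lemma differentiableAt_raisingFun (hq0 : 0 < q) (hq1 : q < 1) (hα : |α| < 1) {p : ℂ → ℂ}
    (hp : ∀ s : ℂ, s ≠ 0 → DifferentiableAt ℂ p s) {s : ℂ} (h1 : √q ≤ ‖s‖) (h2 : ‖s‖ ≤ 1) :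
    DifferentiableAt ℂ (raisingFun q α p) s := by
  have hr0 : 0 < √q := Real.sqrt_pos.2 hq0
  have hn : 0 < ‖s‖ := hr0.trans_le h1
  have hs : s ≠ 0 := norm_pos_iff.1 hn
  have hsq : q ≤ ‖s‖ ^ 2 := by
    rw [← Real.sq_sqrt hq0.le]; gcongr
  have hd : DifferentiableAt ℂ (ascCore q (α * q)) s := by
    refine differentiableAt_ascCore hq0 hq1 hs ?_ ?_
    · rw [norm_mul, norm_pow, Complex.norm_real, Real.norm_eq_abs, abs_mul, abs_of_pos hq0]
      have : ‖s‖ ^ 2 ≤ 1 := pow_le_one₀ hn.le h2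
      have := abs_nonneg α
      have : |α| * q < 1 := by nlinarith
      nlinarith [mul_nonneg (abs_nonneg α) hq0.le]
    · rw [norm_mul, norm_pow, norm_inv, Complex.norm_real, Real.norm_eq_abs, abs_mul,
        abs_of_pos hq0, inv_pow, ← div_eq_mul_inv, div_lt_one (by positivity)]
      have := abs_nonneg α
      nlinarith
  exact (((differentiableAt_inv hs).mul (by fun_prop)).mul hd).mul (hp s hs)

lemma continuous_raisingFun_circle (hq0 : 0 < q) (hq1 : q < 1) (hα : |α| < 1) {p : ℂ → ℂ}
    (hp : ∀ s : ℂ, s ≠ 0 → DifferentiableAt ℂ p s) {r : ℝ} (h1 : √q ≤ r) (h2 : r ≤ 1) :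
    Continuous fun θ : ℝ => raisingFun q α p (r * circleMap 0 1 θ) := by
  have hr0 : 0 < r := (Real.sqrt_pos.2 hq0).trans_le h1
  refine continuous_iff_continuousAt.2 fun θ => ?_
  have hn : ‖(r : ℂ) * circleMap 0 1 θ‖ = r := by simp [abs_of_pos hr0]
  refine ContinuousAt.comp (f := fun θ => (r : ℂ) * circleMap 0 1 θ) (g := raisingFun q α p)
    (differentiableAt_raisingFun hq0 hq1 hα hp (by rw [hn]; exact h1)
      (by rw [hn]; exact h2)).continuousAt
    (continuous_const.mul (continuous_circleMap 0 1)).continuousAt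

/-- The contour shift behind the raising operator. -/
lemma integral_raising (hq0 : 0 < q) (hq1 : q < 1) (hα : |α| < 1) {p : ℂ → ℂ}
    (hp : ∀ s : ℂ, s ≠ 0 → DifferentiableAt ℂ p s) :
    ∫ θ in 0..2 * Real.pi, (ascCore q α (circleMap 0 1 θ) *
        ((circleMap 0 1 θ)⁻¹ * (1 - (circleMap 0 1 θ)⁻¹ ^ 2) * (1 - α * (circleMap 0 1 θ) ^ 2) *
            p (√q * circleMap 0 1 θ) +
          circleMap 0 1 θ * (1 - circleMap 0 1 θ ^ 2) * (1 - α * (circleMap 0 1 θ)⁻¹ ^ 2) *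
            p (√q * (circleMap 0 1 θ)⁻¹))) =
      √q * ∫ θ in 0..2 * Real.pi, (raisingFun q α p (circleMap 0 1 θ) +
        raisingFun q α p (circleMap 0 1 θ)⁻¹) := by
  have hr0 : 0 < √q := Real.sqrt_pos.2 hq0
  have hr1 : √q ≤ 1 := Real.sqrt_le_iff.2 ⟨zero_le_one, by simpa using hq1.le⟩
  have hneg : Continuous fun θ : ℝ => 2 * Real.pi - θ := by fun_prop
  have hinv : ∀ θ : ℝ, (circleMap 0 1 θ)⁻¹ = circleMap 0 1 (2 * Real.pi - θ) := fun θ => by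
    simp [circleMap, ← Complex.exp_neg, sub_mul, Complex.exp_sub]
  have c1 := continuous_raisingFun_circle hq0 hq1 hα hp le_rfl hr1
  have c2 : Continuous fun θ : ℝ => raisingFun q α p (√q * (circleMap 0 1 θ)⁻¹) := by
    simp only [hinv]; exact c1.comp hneg
  have c3 := continuous_raisingFun_circle hq0 hq1 hα hp hr1 le_rfl
  simp only [Complex.ofReal_one, one_mul] at c3
  have c4 : Continuous fun θ : ℝ => raisingFun q α p (circleMap 0 1 θ)⁻¹ := by
    simp only [hinv]; exact c3.comp hneg
  have hshift := integral_circle_eq_of_differentiable hr0 hr1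
    fun s h1 h2 => differentiableAt_raisingFun hq0 hq1 hα hp h1 h2
  rw [intervalIntegral.integral_add (c3.intervalIntegrable _ _) (c4.intervalIntegrable _ _),
    integral_circle_inv (raisingFun q α p), ← hshift]
  -- The right side is now twice one integral; inverting the variable in one copy restores the
  -- symmetric form of the left side.
  nth_rewrite 2 [← integral_circle_inv (fun s => raisingFun q α p (√q * s))]
  rw [← intervalIntegral.integral_add (c1.intervalIntegrable _ _) (c2.intervalIntegrable _ _),
    ← intervalIntegral.integral_const_mul]
  refine intervalIntegral.integral_congr fun θ _ => ?_
  have hn : ‖circleMap 0 1 θ‖ = 1 := by simp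
  have hn' : ‖(circleMap 0 1 θ)⁻¹‖ = 1 := by simp
  rw [mul_add, mul_add, raisingFun_shift hq0 hq1 hα p hn, raisingFun_shift hq0 hq1 hα p hn',
    ascCore_inv, inv_inv]
  ring

lemma differentiable_ascQ (q α : ℂ) (n : ℕ) : Differentiable ℂ fun z => ascQ q α z n := by
  induction n using Nat.twoStepInduction with
  | zero => exact differentiable_const _
  | one => exact differentiable_id
  | more n h0 h1 => simp only [ascQ]; fun_prop

/-- The polynomials of positive degree have mean zero. -/
lemma integral_ascWeight_mul_ascQ_succ (hq0 : 0 < q) (hq1 : q < 1) (hα : |α| < 1) (n : ℕ) :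
    ∫ θ in 0..2 * Real.pi, ascWeight q α (circleMap 0 1 θ) *
      ascQ (q : ℂ) α (circleMap 0 1 θ + (circleMap 0 1 θ)⁻¹) (n + 1) = 0 := by
  have hr0 : (√q : ℂ) ≠ 0 := by exact_mod_cast (Real.sqrt_pos.2 hq0).ne'
  have hr : (√q : ℂ) * √q = q := by exact_mod_cast Real.mul_self_sqrt hq0.le
  set p : ℂ → ℂ := fun s => (√q : ℂ) ^ n * ascQ (q : ℂ) (α * q) (s + s⁻¹) n with hpdef
  have hp : ∀ s : ℂ, s ≠ 0 → DifferentiableAt ℂ p s := fun s hs =>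
    (((differentiable_ascQ (q : ℂ) (α * q) n) _).comp s
      (differentiableAt_id.add (differentiableAt_inv hs))).const_mul _
  have h := integral_raising hq0 hq1 hα hp
  -- Both `p` and the core are invariant under inversion, while `s⁻¹ (1 - s²) = s⁻¹ - s` changes
  -- sign.
  have hodd : ∀ s, raisingFun q α p s + raisingFun q α p s⁻¹ = 0 := by
    intro s
    rcases eq_or_ne s 0 with rfl | hs
    · simp [raisingFun]
    · simp only [raisingFun, ascCore_inv, hpdef, inv_inv, add_comm s⁻¹ s]
      field_simp
      ring
  simp only [hodd, intervalIntegral.integral_zero, mul_zero] at h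
  refine Eq.trans ?_ h
  refine intervalIntegral.integral_congr fun θ _ => ?_
  have hs : circleMap 0 1 θ * (circleMap 0 1 θ)⁻¹ = 1 := mul_inv_cancel₀ (by simp)
  have hR := ascQ_raising (α := (α : ℂ)) hs hr hr0 n
  simp only [hpdef, ascWeight, mul_inv, inv_inv]
  rw [hR]
  ring

lemma integral_ascWeight_mul_sq (hq0 : 0 < q) (hq1 : q < 1) (hα : |α| < 1) :
    ∫ θ in 0..2 * Real.pi, ascWeight q α (circleMap 0 1 θ) *
      (circleMap 0 1 θ + (circleMap 0 1 θ)⁻¹) ^ 2 = (1 - q) * ascMass q (α * q) := by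
  have hr0 : (√q : ℂ) ≠ 0 := by exact_mod_cast (Real.sqrt_pos.2 hq0).ne'
  have hr : (√q : ℂ) * √q = q := by exact_mod_cast Real.mul_self_sqrt hq0.le
  -- Chosen so that `p(√q s) = s + s⁻¹`. Then `α` drops out of the factor multiplying the core on
  -- the left, and `√q (p(s) - p(s⁻¹)) = (1 - q) (s - s⁻¹)` on the right.
  set p : ℂ → ℂ := fun s => (√q : ℂ)⁻¹ * s + √q * s⁻¹ with hpdef
  have hp : ∀ s : ℂ, s ≠ 0 → DifferentiableAt ℂ p s := fun s hs =>
    (differentiableAt_id.const_mul _).add ((differentiableAt_inv hs).const_mul _)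
  have h := integral_raising hq0 hq1 hα hp
  rw [ascMass, ← intervalIntegral.integral_const_mul]
  rw [← intervalIntegral.integral_const_mul] at h
  refine Eq.trans ?_ (h.trans ?_)
  · refine intervalIntegral.integral_congr fun θ _ => ?_
    have hs : circleMap 0 1 θ ≠ 0 := by simp
    simp only [hpdef, ascWeight]
    generalize ascCore q α (circleMap 0 1 θ) = W
    generalize circleMap 0 1 θ = s at *
    field_simp
    ring
  · refine intervalIntegral.integral_congr fun θ _ => ?_
    have hs : circleMap 0 1 θ ≠ 0 := by simp
    simp only [hpdef, ascWeight, raisingFun, ascCore_inv]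
    generalize ascCore q (α * q) (circleMap 0 1 θ) = W
    generalize circleMap 0 1 θ = s at *
    rw [← hr]
    field_simp
    ring

/-- The second moment is computed twice: from the vanishing mean of `Q_2 = z² - (1 - q)(1 + α)`, and
from the contour shift in `integral_ascWeight_mul_sq`. -/
lemma ascMass_mul (hq0 : 0 < q) (hq1 : q < 1) (hα : |α| < 1) :
    (1 + α) * ascMass q α = ascMass q (α * q) := by
  have h1 := integral_ascWeight_mul_ascQ_succ hq0 hq1 hα 1
  have h2 := integral_ascWeight_mul_sq hq0 hq1 hα
  have c := continuous_ascWeight_circle hq0 hq1 hα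
  have ci : Continuous fun θ : ℝ => (circleMap 0 1 θ)⁻¹ :=
    (continuous_circleMap 0 1).inv₀ (by simp)
  have e : ∀ θ : ℝ, ascWeight q α (circleMap 0 1 θ) *
      ascQ (q : ℂ) α (circleMap 0 1 θ + (circleMap 0 1 θ)⁻¹) (1 + 1) =
      ascWeight q α (circleMap 0 1 θ) * (circleMap 0 1 θ + (circleMap 0 1 θ)⁻¹) ^ 2 -
        ((1 - q) * (1 + α)) * ascWeight q α (circleMap 0 1 θ) := by
    intro θ; simp [ascQ]; ring
  simp only [e] at h1
  rw [intervalIntegral.integral_sub (Continuous.intervalIntegrable (by fun_prop) _ _)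
    (Continuous.intervalIntegrable (by fun_prop) _ _), h2,
    intervalIntegral.integral_const_mul, ← ascMass] at h1
  have hq : (1 : ℂ) - q ≠ 0 := by
    rw [sub_ne_zero]; exact_mod_cast hq1.ne'
  apply mul_left_cancel₀ hq
  linear_combination -h1

end Circle

/-! ### The total mass of the weight -/

section Mass

lemma norm_qPochInf_le {q : ℝ} (hq0 : 0 < q) (hq1 : q < 1) {a : ℂ} (ha : ‖a‖ ≤ 1) :
    ‖qPochInf a (q : ℂ)‖ ≤ Real.exp (1 / (1 - q)) := by
  have h := norm_qPochInf_sub_one_le (norm_ofReal_lt_one hq0 hq1) a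
  rw [Complex.norm_real, Real.norm_eq_abs, abs_of_pos hq0] at h
  have h1 : 0 < 1 - q := by linarith
  have h2 : Real.exp (‖a‖ / (1 - q)) ≤ Real.exp (1 / (1 - q)) := by gcongr
  have h3 := norm_add_le (qPochInf a (q : ℂ) - 1) 1
  rw [sub_add_cancel, norm_one] at h3
  linarith

lemma exists_norm_inv_qPochInf_le {q : ℂ} (hq : ‖q‖ < 1) {ρ : ℝ} (hρ : ρ < 1) :
    ∃ B : ℝ, ∀ a : ℂ, ‖a‖ ≤ ρ → ‖(qPochInf a q)⁻¹‖ ≤ B := by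
  obtain ⟨B, hB⟩ := (isCompact_closedBall (0 : ℂ) ρ).exists_bound_of_continuousOn
    (f := fun a => (qPochInf a q)⁻¹) fun a ha => by
      have ha' : ‖a‖ < 1 := (mem_closedBall_zero_iff.1 ha).trans_lt hρ
      exact (((differentiable_qPochInf hq).continuous.continuousAt).inv₀
        (qPochInf_ne_zero hq ha')).continuousWithinAt
  exact ⟨B, fun a ha => hB a (by simpa using ha)⟩

lemma norm_one_sub_sq_mul_le {s : ℂ} (hs : ‖s‖ = 1) : ‖(1 - s ^ 2) * (1 - s⁻¹ ^ 2)‖ ≤ 2 * 2 := by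
  rw [norm_mul]
  gcongr
  · exact (norm_sub_le _ _).trans (by rw [norm_pow, hs]; norm_num)
  · exact (norm_sub_le _ _).trans (by rw [norm_pow, norm_inv, hs]; norm_num)

variable {q α : ℝ}

lemma tendsto_ascMass_mul_pow (hq0 : 0 < q) (hq1 : q < 1) (hα : |α| < 1) :
    Tendsto (fun n : ℕ => ascMass q (α * q ^ n)) atTop (𝓝 (ascMass q 0)) := by
  have hq2 := norm_sq_ofReal_lt_one hq0 hq1
  obtain ⟨B, hB⟩ := exists_norm_inv_qPochInf_le hq2 hα
  have hsmall : ∀ n : ℕ, |α * q ^ n| ≤ |α| := fun n => by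
    rw [abs_mul, abs_of_pos (pow_pos hq0 n)]
    exact mul_le_of_le_one_right (abs_nonneg _) (pow_le_one₀ hq0.le hq1.le)
  refine intervalIntegral.tendsto_integral_filter_of_dominated_convergence
    (fun _ => 2 * 2 * (Real.exp (1 / (1 - q)) * Real.exp (1 / (1 - q)) * (B * B)))
    (Eventually.of_forall fun n => ?_) (Eventually.of_forall fun n => ?_)
    intervalIntegrable_const (Eventually.of_forall fun θ _ => ?_)
  · exact (continuous_ascWeight_circle hq0 hq1
      ((hsmall n).trans_lt hα)).aestronglyMeasurable
  · refine Eventually.of_forall fun θ _ => ?_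
    have hs : ‖circleMap 0 1 θ‖ = 1 := by simp
    generalize circleMap 0 1 θ = s at *
    have hB0 : 0 ≤ B := (norm_nonneg _).trans (hB 0 (by simp))
    rw [ascWeight, norm_mul]
    refine mul_le_mul (norm_one_sub_sq_mul_le hs) ?_ (norm_nonneg _) (by norm_num)
    rw [ascCore, norm_mul, norm_mul, norm_mul]
    have e1 : ‖(q : ℂ) * s ^ 2‖ ≤ 1 := by simpa [hs, abs_of_pos hq0] using hq1.le
    have e2 : ‖(q : ℂ) * s⁻¹ ^ 2‖ ≤ 1 := by simpa [hs, abs_of_pos hq0] using hq1.le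
    have e3 : ‖((α * q ^ n : ℝ) : ℂ) * s ^ 2‖ ≤ |α| := by
      rw [norm_mul, norm_pow, hs, Complex.norm_real]; simpa using hsmall n
    have e4 : ‖((α * q ^ n : ℝ) : ℂ) * s⁻¹ ^ 2‖ ≤ |α| := by
      rw [norm_mul, norm_pow, norm_inv, hs, Complex.norm_real]; simpa using hsmall n
    gcongr
    exacts [norm_qPochInf_le hq0 hq1 e1, norm_qPochInf_le hq0 hq1 e2, hB _ e3, hB _ e4]
  · have hlim : Tendsto (fun n : ℕ => ((α * q ^ n : ℝ) : ℂ)) atTop (𝓝 ((0 : ℝ) : ℂ)) := by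
      refine (Complex.continuous_ofReal.tendsto _).comp ?_
      simpa using (tendsto_pow_atTop_nhds_zero_of_lt_one hq0.le hq1).const_mul α
    have hD : ∀ x : ℂ, Tendsto (fun n : ℕ =>
        (qPochInf (((α * q ^ n : ℝ) : ℂ) * x) ((q : ℂ) ^ 2))⁻¹) atTop
        (𝓝 (qPochInf (((0 : ℝ) : ℂ) * x) ((q : ℂ) ^ 2))⁻¹) := fun x =>
      (((differentiable_qPochInf hq2).continuous.tendsto _).comp (hlim.mul_const x)).inv₀
        (by simp [qPochInf_zero])
    exact ((((hD _).mul (hD _)).const_mul _).const_mul _)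

lemma ascMass_mul_qPoch (hq0 : 0 < q) (hq1 : q < 1) (hα : |α| < 1) (n : ℕ) :
    ascMass q α * qPoch (-(α : ℂ)) (q : ℂ) n = ascMass q (α * q ^ n) := by
  induction n with
  | zero => simp [qPoch_zero]
  | succ n ih =>
    have h : |α * q ^ n| < 1 := by
      rw [abs_mul, abs_of_pos (pow_pos hq0 n)]
      exact (mul_le_of_le_one_right (abs_nonneg _) (pow_le_one₀ hq0.le hq1.le)).trans_lt hα
    rw [pow_succ, ← mul_assoc, ← ascMass_mul hq0 hq1 h, ← ih, qPoch_succ]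
    push_cast
    ring

lemma ascMass_mul_qPochInf (hq0 : 0 < q) (hq1 : q < 1) (hα : |α| < 1) :
    ascMass q α * qPochInf (-(α : ℂ)) (q : ℂ) = ascMass q 0 := by
  refine tendsto_nhds_unique (((tendsto_qPoch (norm_ofReal_lt_one hq0 hq1) _).const_mul _).congr
    (ascMass_mul_qPoch hq0 hq1 hα)) (tendsto_ascMass_mul_pow hq0 hq1 hα)

/-- At `α = q` the denominator `(q s²; q²)_∞` cancels every other factor of `(q s²; q)_∞` and leaves
`(q² s²; q²)_∞`. -/
lemma ascMass_self (hq0 : 0 < q) (hq1 : q < 1) : ascMass q q = ascMass (q ^ 2) 0 := by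
  have hqn := norm_ofReal_lt_one hq0 hq1
  have hq2 := norm_sq_ofReal_lt_one hq0 hq1
  refine intervalIntegral.integral_congr fun θ _ => ?_
  have hs : ‖circleMap 0 1 θ‖ = 1 := by simp
  simp only [ascWeight, ascCore, Complex.ofReal_zero, zero_mul, qPochInf_zero, inv_one, mul_one]
  generalize circleMap 0 1 θ = s at *
  have n1 : ‖(q : ℂ) * s ^ 2‖ < 1 := by simpa [hs, abs_of_pos hq0] using hq1
  have n2 : ‖(q : ℂ) * s⁻¹ ^ 2‖ < 1 := by simpa [hs, abs_of_pos hq0] using hq1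
  have h1 := qPochInf_sq_ne_zero hq0 hq1 n1
  have h2 := qPochInf_sq_ne_zero hq0 hq1 n2
  rw [← qPochInf_even_odd hqn, ← qPochInf_even_odd hqn (q * s⁻¹ ^ 2)]
  push_cast
  rw [show (q : ℂ) * s ^ 2 * q = q ^ 2 * s ^ 2 by ring,
    show (q : ℂ) * s⁻¹ ^ 2 * q = q ^ 2 * s⁻¹ ^ 2 by ring]
  generalize qPochInf (q * s ^ 2) ((q : ℂ) ^ 2) = A at *
  generalize qPochInf (q * s⁻¹ ^ 2) ((q : ℂ) ^ 2) = B at *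
  field_simp

lemma ascMass_zero_mul_sq (hq0 : 0 < q) (hq1 : q < 1) :
    ascMass q 0 * qPochInf (q : ℂ) q =
      ascMass (q ^ 2) 0 * qPochInf ((q ^ 2 : ℝ) : ℂ) ((q ^ 2 : ℝ) : ℂ) := by
  rw [← ascMass_mul_qPochInf hq0 hq1 (by rwa [abs_of_pos hq0] : |q| < 1), ascMass_self hq0 hq1]
  push_cast
  rw [← qPochInf_sq (norm_ofReal_lt_one hq0 hq1)]
  ring

lemma tendsto_qPochInf_of_le {p : ℕ → ℝ} {x : ℕ → ℂ} {c : ℝ} (hc : c < 1) (hp0 : ∀ n, 0 < p n)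
    (hpc : ∀ n, p n ≤ c) (hp : Tendsto p atTop (𝓝 0)) (hx : ∀ n, ‖x n‖ ≤ p n) :
    Tendsto (fun n => qPochInf (x n) (p n : ℂ)) atTop (𝓝 1) := by
  rw [tendsto_iff_norm_sub_tendsto_zero]
  have hlim : Tendsto (fun n => Real.exp (p n / (1 - c)) - 1) atTop (𝓝 0) := by
    have := ((Real.continuous_exp.tendsto _).comp (hp.div_const (1 - c))).sub_const 1
    simpa using this
  refine squeeze_zero (fun _ => norm_nonneg _) (fun n => ?_) hlim
  refine (norm_qPochInf_sub_one_le (norm_ofReal_lt_one (hp0 n) ((hpc n).trans_lt hc)) _).trans ?_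
  rw [Complex.norm_real, Real.norm_eq_abs, abs_of_pos (hp0 n)]
  have h1 : 0 < 1 - c := by linarith
  gcongr
  exacts [(hp0 n).le, hx n, hpc n]

/-- By `ascMass_zero_mul_sq` the left side is invariant under `q ↦ q²`, so it equals its limit along
`q^(2^n) → 0`. There the infinite products tend to `1` and the integral to that of `(1 - s²)(1 -
s⁻²) = 2 - 2 cos 2θ`. -/
lemma ascMass_zero_mul (hq0 : 0 < q) (hq1 : q < 1) :
    ascMass q 0 * qPochInf (q : ℂ) q = 4 * Real.pi := by
  set p : ℕ → ℝ := fun n => q ^ 2 ^ n with hpdef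
  have hp0 : ∀ n, 0 < p n := fun n => pow_pos hq0 _
  have hpq : ∀ n, p n ≤ q := fun n => pow_le_of_le_one hq0.le hq1.le (by positivity)
  have hp1 : ∀ n, p n < 1 := fun n => (hpq n).trans_lt hq1
  have hp : Tendsto p atTop (𝓝 0) := (tendsto_pow_atTop_nhds_zero_of_lt_one hq0.le hq1).comp
    (tendsto_pow_atTop_atTop_of_one_lt one_lt_two)
  have hconst : ∀ n, ascMass (p n) 0 * qPochInf (p n : ℂ) (p n) =
      ascMass q 0 * qPochInf (q : ℂ) q := by
    intro n
    induction n with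
    | zero => simp [hpdef]
    | succ n ih =>
      rw [← ih, ascMass_zero_mul_sq (hp0 n) (hp1 n)]
      simp only [hpdef, pow_succ 2 n, pow_mul]
  have h1 : Tendsto (fun n => qPochInf (p n : ℂ) (p n : ℂ)) atTop (𝓝 1) :=
    tendsto_qPochInf_of_le hq1 hp0 hpq hp fun n => by simp [abs_of_pos (hp0 n)]
  have hI : ∫ θ in 0..2 * Real.pi, (1 - circleMap 0 1 θ ^ 2) * (1 - (circleMap 0 1 θ)⁻¹ ^ 2) =
      (4 * Real.pi : ℂ) := by
    have e : ∀ θ : ℝ, (1 - circleMap 0 1 θ ^ 2) * (1 - (circleMap 0 1 θ)⁻¹ ^ 2) =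
        ((2 - 2 * Real.cos (2 * θ) : ℝ) : ℂ) := by
      intro θ
      have : circleMap 0 1 θ ≠ 0 := by simp
      rw [Complex.ofReal_sub, Complex.ofReal_mul, Complex.ofReal_ofNat, Complex.ofReal_cos,
        Complex.two_cos]
      have a1 : Complex.exp (((2 * θ : ℝ) : ℂ) * Complex.I) = circleMap 0 1 θ ^ 2 := by
        simp [circleMap, ← Complex.exp_nat_mul]; ring_nf
      have a2 : Complex.exp (-((2 * θ : ℝ) : ℂ) * Complex.I) = (circleMap 0 1 θ)⁻¹ ^ 2 := by
        rw [neg_mul, Complex.exp_neg, a1, inv_pow]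
      rw [a1, a2]
      field_simp
      ring
    simp only [e]
    rw [intervalIntegral.integral_ofReal, intervalIntegral.integral_sub
      (by simp) (Continuous.intervalIntegrable (by fun_prop) _ _),
      intervalIntegral.integral_const_mul, intervalIntegral.integral_comp_mul_left _ two_ne_zero]
    have hsin : Real.sin (2 * (2 * Real.pi)) = 0 := by
      rw [show (2 : ℝ) * (2 * Real.pi) = ((4 : ℕ) : ℝ) * Real.pi by push_cast; ring,
        Real.sin_nat_mul_pi]
    rw [integral_cos, hsin]
    simp
    ring
  have h2 : Tendsto (fun n => ascMass (p n) 0) atTop (𝓝 (4 * Real.pi)) := by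
    rw [← hI]
    refine intervalIntegral.tendsto_integral_filter_of_dominated_convergence
      (fun _ => 2 * 2 * (Real.exp (1 / (1 - q)) * Real.exp (1 / (1 - q))))
      (Eventually.of_forall fun n => ?_) (Eventually.of_forall fun n => ?_)
      intervalIntegrable_const (Eventually.of_forall fun θ _ => ?_)
    · exact (continuous_ascWeight_circle (hp0 n) (hp1 n) (by simp)).aestronglyMeasurable
    · refine Eventually.of_forall fun θ _ => ?_
      have hs : ‖circleMap 0 1 θ‖ = 1 := by simp
      simp only [ascWeight, ascCore, Complex.ofReal_zero, zero_mul, qPochInf_zero, inv_one, mul_one]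
      generalize circleMap 0 1 θ = s at *
      rw [norm_mul]
      refine mul_le_mul (norm_one_sub_sq_mul_le hs) ?_ (norm_nonneg _) (by norm_num)
      have e0 : Real.exp (1 / (1 - p n)) ≤ Real.exp (1 / (1 - q)) := by
        have : 0 < 1 - q := by linarith
        gcongr
        exact hpq n
      have e1 : ‖(p n : ℂ) * s ^ 2‖ ≤ 1 := by simpa [hs, abs_of_pos (hp0 n)] using (hp1 n).le
      have e2 : ‖(p n : ℂ) * s⁻¹ ^ 2‖ ≤ 1 := by simpa [hs, abs_of_pos (hp0 n)] using (hp1 n).le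
      rw [norm_mul]
      gcongr
      exacts [(norm_qPochInf_le (hp0 n) (hp1 n) e1).trans e0,
        (norm_qPochInf_le (hp0 n) (hp1 n) e2).trans e0]
    · have hs : ‖circleMap 0 1 θ‖ = 1 := by simp
      simp only [ascWeight, ascCore, Complex.ofReal_zero, zero_mul, qPochInf_zero, inv_one, mul_one]
      generalize circleMap 0 1 θ = s at *
      have t1 := tendsto_qPochInf_of_le (x := fun n => (p n : ℂ) * s ^ 2) hq1 hp0 hpq hp
        fun n => by simp [hs, abs_of_pos (hp0 n)]
      have t2 := tendsto_qPochInf_of_le (x := fun n => (p n : ℂ) * s⁻¹ ^ 2) hq1 hp0 hpq hp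
        fun n => by simp [hs, abs_of_pos (hp0 n)]
      simpa only [mul_one] using (t1.mul t2).const_mul ((1 - s ^ 2) * (1 - s⁻¹ ^ 2))
  have := tendsto_nhds_unique ((h2.mul h1).congr hconst) tendsto_const_nhds
  rw [← this, mul_one]

/-- The total mass of the weight. -/
lemma ascMass_mul_eq (hq0 : 0 < q) (hq1 : q < 1) (hα : |α| < 1) :
    qPochInf (q : ℂ) q * qPochInf (-(α : ℂ)) (q : ℂ) * ascMass q α = 4 * Real.pi := by
  rw [← ascMass_zero_mul hq0 hq1, ← ascMass_mul_qPochInf hq0 hq1 hα]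
  ring

end Mass

/-! ### Orthogonality -/

section Orthogonality

/-- Orthogonality of a sequence with a symmetric three-term recurrence under a functional for which
the elements of positive degree have mean zero; `V` stands for the moments with one more factor. -/
lemma orthogonality_of_recurrence {K : Type*} [CommRing K] {M V : ℕ → ℕ → K} {lam h : ℕ → K}
    (h0 : M 0 0 = h 0) (hpos : ∀ n, M 0 (n + 1) = 0) (hh : ∀ n, h (n + 1) = lam n * h n)
    (r0 : ∀ m, V m 0 = M m 1) (r1 : ∀ m n, V m (n + 1) = M m (n + 2) + lam n * M m n)
    (l0 : ∀ n, V 0 n = M 1 n) (l1 : ∀ m n, V (m + 1) n = M (m + 2) n + lam m * M m n) (m n : ℕ) :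
    M m n = if m = n then h m else 0 := by
  induction m using Nat.twoStepInduction generalizing n with
  | zero =>
    cases n with
    | zero => simpa using h0
    | succ n => simpa using hpos n
  | one =>
    rw [← l0]
    cases n with
    | zero => simp [r0, hpos]
    | succ n =>
      rw [r1, hpos]
      cases n with
      | zero => simp [h0, hh]
      | succ n => simp [hpos]
  | more m i0 i1 =>
    -- `V` lets the extra factor be moved from the first index to the second, where `r0` or `r1`
    -- expands it.
    have e : M (m + 2) n = V (m + 1) n - lam m * M m n := by rw [l1]; ring
    rw [e]
    cases n with
    | zero =>
      rw [r0, i0, i1]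
      rcases eq_or_ne m 0 with rfl | hm
      · simp [hh]
      · simp [hm]
    | succ n =>
      rw [r1, i0, i1, i1]
      rcases eq_or_ne m (n + 1) with rfl | h1
      · have h2 : n + 1 + 1 ≠ n := by lia
        simp [hh, h2]
      · rcases eq_or_ne (m + 1) n with rfl | h2
        · simp [hh, h1]
        · have h4 : m + 2 ≠ n + 1 := by lia
          simp [h1, h2, h4]

variable {q α : ℝ}

lemma integral_ascWeight_mul_ascQ_mul_ascQ (hq0 : 0 < q) (hq1 : q < 1) (hα : |α| < 1) (m n : ℕ) :
    ∫ θ in 0..2 * Real.pi, ascWeight q α (circleMap 0 1 θ) *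
      (ascQ (q : ℂ) α (circleMap 0 1 θ + (circleMap 0 1 θ)⁻¹) m *
        ascQ (q : ℂ) α (circleMap 0 1 θ + (circleMap 0 1 θ)⁻¹) n) =
      if m = n then qPoch (-(α : ℂ)) (q : ℂ) m * qPoch (q : ℂ) q m * ascMass q α else 0 := by
  have cw := continuous_ascWeight_circle hq0 hq1 hα
  have ci : Continuous fun θ : ℝ => (circleMap 0 1 θ)⁻¹ :=
    (continuous_circleMap 0 1).inv₀ (by simp)
  have cz : Continuous fun θ : ℝ => circleMap 0 1 θ + (circleMap 0 1 θ)⁻¹ := by fun_prop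
  have cQ : ∀ n, Continuous fun θ : ℝ =>
      ascQ (q : ℂ) α (circleMap 0 1 θ + (circleMap 0 1 θ)⁻¹) n := fun n =>
    (differentiable_ascQ (q : ℂ) α n).continuous.comp cz
  have I : ∀ m n, IntervalIntegrable (fun θ => ascWeight q α (circleMap 0 1 θ) *
      (ascQ (q : ℂ) α (circleMap 0 1 θ + (circleMap 0 1 θ)⁻¹) m *
        ascQ (q : ℂ) α (circleMap 0 1 θ + (circleMap 0 1 θ)⁻¹) n)) volume 0 (2 * Real.pi) :=
    fun m n => (cw.mul ((cQ m).mul (cQ n))).intervalIntegrable _ _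
  refine orthogonality_of_recurrence (M := fun m n => ∫ θ in 0..2 * Real.pi,
      ascWeight q α (circleMap 0 1 θ) *
        (ascQ (q : ℂ) α (circleMap 0 1 θ + (circleMap 0 1 θ)⁻¹) m *
          ascQ (q : ℂ) α (circleMap 0 1 θ + (circleMap 0 1 θ)⁻¹) n)) (V := fun m n => ∫ θ in 0..2 * Real.pi,
      ascWeight q α (circleMap 0 1 θ) * ((circleMap 0 1 θ + (circleMap 0 1 θ)⁻¹) *
      (ascQ (q : ℂ) α (circleMap 0 1 θ + (circleMap 0 1 θ)⁻¹) m *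
        ascQ (q : ℂ) α (circleMap 0 1 θ + (circleMap 0 1 θ)⁻¹) n)))
    (lam := fun n => (1 - (q : ℂ) ^ (n + 1)) * (1 + α * (q : ℂ) ^ n))
    (h := fun m => qPoch (-(α : ℂ)) (q : ℂ) m * qPoch (q : ℂ) q m * ascMass q α)
    ?_ ?_ ?_ ?_ ?_ ?_ ?_ m n
  · simp [ascQ, qPoch_zero, ascMass]
  · intro n
    simpa [ascQ] using integral_ascWeight_mul_ascQ_succ hq0 hq1 hα n
  · intro n
    simp only [qPoch_succ]
    ring
  · intro m
    refine intervalIntegral.integral_congr fun θ _ => ?_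
    simp only [ascQ]
    ring
  · intro m n
    rw [← intervalIntegral.integral_const_mul,
      ← intervalIntegral.integral_add (I _ _) ((I _ _).const_mul _)]
    refine intervalIntegral.integral_congr fun θ _ => ?_
    simp only [ascQ]
    ring
  · intro n
    refine intervalIntegral.integral_congr fun θ _ => ?_
    simp only [ascQ]
    ring
  · intro m n
    rw [← intervalIntegral.integral_const_mul,
      ← intervalIntegral.integral_add (I _ _) ((I _ _).const_mul _)]
    refine intervalIntegral.integral_congr fun θ _ => ?_
    simp only [ascQ]
    ring

/-! ### From the circle to the interval, and orthonormality -/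

/-- The weight on the unit circle is the squared modulus of this function. -/
noncomputable def ascHalf (q α : ℝ) (s : ℂ) : ℂ :=
  qPochInf (s ^ 2) (q : ℂ) * (qPochInf (α * s ^ 2) ((q : ℂ) ^ 2))⁻¹

lemma ascWeight_eq_mul (hq0 : 0 < q) (hq1 : q < 1) (s : ℂ) :
    ascWeight q α s = ascHalf q α s * ascHalf q α s⁻¹ := by
  have hqn := norm_ofReal_lt_one hq0 hq1
  rw [ascHalf, ascHalf, qPochInf_eq_mul hqn (s ^ 2), qPochInf_eq_mul hqn (s⁻¹ ^ 2), ascWeight,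
    ascCore, mul_comm (q : ℂ), mul_comm (q : ℂ) (s⁻¹ ^ 2)]
  ring

lemma conj_ascHalf (hq0 : 0 < q) (hq1 : q < 1) {s : ℂ} (hs : ‖s‖ = 1) :
    conj (ascHalf q α s) = ascHalf q α s⁻¹ := by
  have hq : ‖q‖ < 1 := by rwa [Real.norm_eq_abs, abs_of_pos hq0]
  have hq2 : ‖q ^ 2‖ < 1 := by rw [norm_pow]; exact pow_lt_one₀ (norm_nonneg _) hq two_ne_zero
  have h := conj_qPochInf hq2 (α * s ^ 2)
  push_cast at h
  rw [ascHalf, ascHalf, map_mul, map_inv₀, conj_qPochInf hq, h]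
  simp [Complex.inv_eq_conj hs]

lemma ascWeight_eq_normSq (hq0 : 0 < q) (hq1 : q < 1) {s : ℂ} (hs : ‖s‖ = 1) :
    ascWeight q α s = (Complex.normSq (ascHalf q α s) : ℝ) := by
  rw [ascWeight_eq_mul hq0 hq1, ← conj_ascHalf hq0 hq1 hs, Complex.mul_conj]

lemma gProd_eq (hq0 : 0 < q) (hq1 : q < 1) {x : ℝ} {s : ℂ} (hs0 : s ≠ 0)
    (hs : (x : ℂ) * √(1 - q) = s + s⁻¹) (γ : ℂ) :
    gProd q x γ = qPochInf (γ * s) (q : ℂ) * qPochInf (γ * s⁻¹) (q : ℂ) := by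
  have hqn := norm_ofReal_lt_one hq0 hq1
  rw [gProd, qPochInf, qPochInf,
    ← (multipliable_qPochInf hqn _).tprod_mul (multipliable_qPochInf hqn _)]
  refine tprod_congr fun k => ?_
  rw [mul_assoc γ, hs]
  field_simp
  ring

/-- Pairing `γ` with `-γ` gives products in base `q²` depending on `γ²` only. The pairs `±1` and
`±√q` supply the even and odd factors of `(s^{±2}; q)_∞`, and `±√α` supplies the denominators. -/
lemma gProd_ratio (hq0 : 0 < q) (hq1 : q < 1) {x : ℝ} {s : ℂ} (hn : ‖s‖ = 1)
    (hs : (x : ℂ) * √(1 - q) = s + s⁻¹) :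
    gProd q x 1 * gProd q x (-1) * gProd q x (√q : ℂ) * gProd q x (-(√q : ℂ)) /
      (gProd q x (sqrtC α) * gProd q x (-sqrtC α)) = (Complex.normSq (ascHalf q α s) : ℝ) := by
  have hqn := norm_ofReal_lt_one hq0 hq1
  have hs0 : s ≠ 0 := by rintro rfl; simp at hn
  have hr : (√q : ℂ) ^ 2 = q := by exact_mod_cast Real.sq_sqrt hq0.le
  have key : ∀ γ : ℂ, gProd q x γ * gProd q x (-γ) =
      qPochInf (γ ^ 2 * s ^ 2) ((q : ℂ) ^ 2) * qPochInf (γ ^ 2 * s⁻¹ ^ 2) ((q : ℂ) ^ 2) := by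
    intro γ
    rw [gProd_eq hq0 hq1 hs0 hs, gProd_eq hq0 hq1 hs0 hs, ← mul_pow, ← mul_pow, ← qPochInf_sq hqn,
      ← qPochInf_sq hqn, neg_mul, neg_mul]
    ring
  rw [mul_assoc (gProd q x 1 * gProd q x (-1)), key, key, key, sqrtC_sq, hr,
    ← ascWeight_eq_normSq hq0 hq1 hn, ascWeight_eq_mul hq0 hq1, ascHalf, ascHalf,
    ← qPochInf_even_odd hqn (s ^ 2), ← qPochInf_even_odd hqn (s⁻¹ ^ 2)]
  rw [mul_comm (s ^ 2) (q : ℂ), mul_comm (s⁻¹ ^ 2) (q : ℂ), one_pow, one_mul, one_mul]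
  rw [div_eq_mul_inv, mul_inv]
  ring

lemma circleMap_add_inv (θ : ℝ) :
    circleMap 0 1 θ + (circleMap 0 1 θ)⁻¹ = ((2 * Real.cos θ : ℝ) : ℂ) := by
  rw [two_cos_eq]
  simp [circleMap, ← Complex.exp_neg, mul_comm]

/-- The point of `I_q` with angle `θ`. -/
noncomputable def pointIq (q θ : ℝ) : ℝ := 2 * Real.cos θ / √(1 - q)

lemma angle_pointIq (hq1 : q < 1) {θ : ℝ} (h0 : 0 ≤ θ) (h1 : θ ≤ Real.pi) :
    angle q (pointIq q θ) = θ := by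
  have h : 0 < √(1 - q) := Real.sqrt_pos.2 (by linarith)
  rw [angle, pointIq, div_mul_cancel₀ _ h.ne', mul_div_cancel_left₀ _ two_ne_zero,
    Real.arccos_cos h0 h1]

/-- The Jacobian `2 sin θ / √(1 - q)` of `x = 2 cos θ / √(1 - q)` is the reciprocal of the square
root factor of the weight. -/
lemma weight_pointIq (hq0 : 0 < q) (hq1 : q < 1) {θ : ℝ} (h0 : 0 < θ) (h1 : θ < Real.pi) :
    2 * Real.sin θ / √(1 - q) * weight q α (pointIq q θ) =
      qPochInf q q * qPochInf (-α) q / (2 * Real.pi) *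
        Complex.normSq (ascHalf q α (circleMap 0 1 θ)) := by
  have hq : 0 < 1 - q := by linarith
  have h : 0 < √(1 - q) := Real.sqrt_pos.2 hq
  have hsin := Real.sin_pos_of_pos_of_lt_pi h0 h1
  have hr := gProd_ratio (α := α) hq0 hq1 (x := pointIq q θ) (s := circleMap 0 1 θ) (by simp) (by
    rw [circleMap_add_inv, ← Complex.ofReal_mul, pointIq, div_mul_cancel₀ _ h.ne'])
  rw [weight, hr, Complex.ofReal_re]
  have e : (1 - q) / (4 - (1 - q) * pointIq q θ ^ 2) = (√(1 - q) / (2 * Real.sin θ)) ^ 2 := by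
    rw [pointIq, div_pow, div_pow, Real.sq_sqrt hq.le]
    have : Real.sin θ ^ 2 = 1 - Real.cos θ ^ 2 := by rw [Real.sin_sq]
    have h3 : 1 - Real.cos θ ^ 2 ≠ 0 := by rw [← this]; positivity
    rw [mul_div_cancel₀ _ hq.ne', mul_pow, mul_pow, this]
    congr 1
    ring
  rw [e, Real.sqrt_sq (by positivity)]
  field_simp

lemma image_pointIq (hq1 : q < 1) : pointIq q '' Set.Ioo 0 Real.pi = intervalIq q := by
  have h : 0 < √(1 - q) := Real.sqrt_pos.2 (by linarith)
  ext x
  simp only [Set.mem_image, Set.mem_Ioo, intervalIq, pointIq]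
  constructor
  · rintro ⟨θ, ⟨h0, h1⟩, rfl⟩
    have hc := Real.strictAntiOn_cos
    have a1 : Real.cos θ < 1 := by
      simpa using hc ⟨le_rfl, Real.pi_pos.le⟩ ⟨h0.le, h1.le⟩ h0
    have a2 : -1 < Real.cos θ := by
      simpa using hc ⟨h0.le, h1.le⟩ ⟨Real.pi_pos.le, le_rfl⟩ h1
    constructor <;> gcongr <;> linarith
  · rintro ⟨h0, h1⟩
    rw [div_lt_iff₀ h] at h0
    rw [lt_div_iff₀ h] at h1
    refine ⟨Real.arccos (x * √(1 - q) / 2), ⟨Real.arccos_pos.2 (by linarith), ?_⟩, ?_⟩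
    · rw [← Real.arccos_neg_one]
      exact Real.strictAntiOn_arccos ⟨le_rfl, by norm_num⟩ ⟨by linarith, by linarith⟩ (by linarith)
    · rw [Real.cos_arccos (by linarith) (by linarith)]
      field_simp

lemma hasDerivAt_pointIq (q θ : ℝ) :
    HasDerivAt (pointIq q) (-(2 * Real.sin θ / √(1 - q))) θ := by
  have h : -(2 * Real.sin θ / √(1 - q)) = 2 * -Real.sin θ / √(1 - q) := by ring
  rw [h]
  exact ((Real.hasDerivAt_cos θ).const_mul 2).div_const (√(1 - q))

lemma injOn_pointIq (hq1 : q < 1) : Set.InjOn (pointIq q) (Set.Ioo 0 Real.pi) := by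
  intro a ha b hb hab
  rw [← angle_pointIq hq1 ha.1.le ha.2.le, hab, angle_pointIq hq1 hb.1.le hb.2.le]

lemma abs_deriv_mul_weight (hq0 : 0 < q) (hq1 : q < 1) {E : Type*} [NormedAddCommGroup E]
    [NormedSpace ℝ E] (g : ℝ → E) {θ : ℝ} (hθ : θ ∈ Set.Ioo 0 Real.pi) :
    |-(2 * Real.sin θ / √(1 - q))| • (weight q α (pointIq q θ) • g (pointIq q θ)) =
      (qPochInf q q * qPochInf (-α) q / (2 * Real.pi) *
        Complex.normSq (ascHalf q α (circleMap 0 1 θ))) • g (pointIq q θ) := by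
  have hsin := Real.sin_pos_of_pos_of_lt_pi hθ.1 hθ.2
  rw [abs_neg, abs_of_nonneg (by positivity), smul_smul, weight_pointIq hq0 hq1 hθ.1 hθ.2]

lemma setIntegral_weight_smul (hq0 : 0 < q) (hq1 : q < 1) {E : Type*} [NormedAddCommGroup E]
    [NormedSpace ℝ E] (g : ℝ → E) :
    ∫ x in intervalIq q, weight q α x • g x = ∫ θ in Set.Ioo 0 Real.pi,
      (qPochInf q q * qPochInf (-α) q / (2 * Real.pi) *
        Complex.normSq (ascHalf q α (circleMap 0 1 θ))) • g (pointIq q θ) := by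
  rw [← image_pointIq hq1, integral_image_eq_integral_abs_deriv_smul measurableSet_Ioo
    (fun θ _ => (hasDerivAt_pointIq q θ).hasDerivWithinAt) (injOn_pointIq hq1)]
  exact setIntegral_congr_fun measurableSet_Ioo fun θ hθ => abs_deriv_mul_weight hq0 hq1 g hθ

lemma continuous_normSq_ascHalf (hq0 : 0 < q) (hq1 : q < 1) (hα : |α| < 1) :
    Continuous fun θ : ℝ => Complex.normSq (ascHalf q α (circleMap 0 1 θ)) := by
  have h := Complex.continuous_re.comp (continuous_ascWeight_circle hq0 hq1 hα)
  refine h.congr fun θ => ?_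
  rw [Function.comp_apply, ascWeight_eq_normSq hq0 hq1 (by simp), Complex.ofReal_re]

lemma integrableOn_weight (hq0 : 0 < q) (hq1 : q < 1) (hα : |α| < 1) :
    IntegrableOn (weight q α) (intervalIq q) := by
  rw [← image_pointIq hq1, integrableOn_image_iff_integrableOn_abs_deriv_smul measurableSet_Ioo
    (fun θ _ => (hasDerivAt_pointIq q θ).hasDerivWithinAt) (injOn_pointIq hq1)]
  refine IntegrableOn.congr_fun (f := fun θ => (qPochInf q q * qPochInf (-α) q / (2 * Real.pi) *
    Complex.normSq (ascHalf q α (circleMap 0 1 θ))) • (1 : ℝ)) ?_ (fun θ hθ => ?_)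
    measurableSet_Ioo
  · have c := continuous_normSq_ascHalf hq0 hq1 hα
    have c' : Continuous fun θ => (qPochInf q q * qPochInf (-α) q / (2 * Real.pi) *
      Complex.normSq (ascHalf q α (circleMap 0 1 θ))) • (1 : ℝ) := by fun_prop
    exact (c'.integrableOn_Icc (a := 0) (b := Real.pi)).mono_set Set.Ioo_subset_Icc_self
  · have := abs_deriv_mul_weight (α := α) hq0 hq1 (fun _ => (1 : ℝ)) hθ
    simp only [smul_eq_mul, mul_one] at this ⊢
    exact this.symm

lemma weight_nonneg (hq0 : 0 < q) (hq1 : q < 1) (hα : |α| < 1) {x : ℝ} (hx : x ∈ intervalIq q) :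
    0 ≤ weight q α x := by
  rw [← image_pointIq hq1] at hx
  obtain ⟨θ, hθ, rfl⟩ := hx
  have hsin := Real.sin_pos_of_pos_of_lt_pi hθ.1 hθ.2
  have h : 0 < √(1 - q) := Real.sqrt_pos.2 (by linarith)
  have h1 := qPochInf_pos hq0 hq1 (a := q) (by rwa [abs_of_pos hq0])
  have h2 := qPochInf_pos hq0 hq1 (a := -α) (by rwa [abs_neg])
  have e := weight_pointIq (α := α) hq0 hq1 hθ.1 hθ.2
  have h3 : 0 ≤ qPochInf q q * qPochInf (-α) q / (2 * Real.pi) *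
        Complex.normSq (ascHalf q α (circleMap 0 1 θ)) :=
    mul_nonneg (by positivity) (Complex.normSq_nonneg _)
  rw [← e] at h3
  exact nonneg_of_mul_nonneg_right h3 (by positivity)

lemma measurableSet_intervalIq (q : ℝ) : MeasurableSet (intervalIq q) := measurableSet_Ioo

lemma integral_weightMeasure (hq0 : 0 < q) (hq1 : q < 1) (hα : |α| < 1) {E : Type*}
    [NormedAddCommGroup E] [NormedSpace ℝ E] (g : ℝ → E) :
    ∫ x, g x ∂(weightMeasure q α) = ∫ x in intervalIq q, weight q α x • g x := by
  rw [weightMeasure, integral_withDensity_eq_integral_toReal_smul₀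
    (integrableOn_weight hq0 hq1 hα).aestronglyMeasurable.aemeasurable.ennreal_ofReal
    (Eventually.of_forall fun _ => ENNReal.ofReal_lt_top)]
  refine setIntegral_congr_fun (measurableSet_intervalIq q) fun x hx => ?_
  rw [ENNReal.toReal_ofReal (weight_nonneg hq0 hq1 hα hx)]

lemma integrable_weightMeasure_iff (hq0 : 0 < q) (hq1 : q < 1) (hα : |α| < 1) {E : Type*}
    [NormedAddCommGroup E] [NormedSpace ℝ E] (g : ℝ → E) :
    Integrable g (weightMeasure q α) ↔
      IntegrableOn (fun x => weight q α x • g x) (intervalIq q) := by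
  rw [weightMeasure, integrable_withDensity_iff_integrable_smul₀'
    (integrableOn_weight hq0 hq1 hα).aestronglyMeasurable.aemeasurable.ennreal_ofReal
    (Eventually.of_forall fun _ => ENNReal.ofReal_lt_top)]
  refine integrableOn_congr_fun (fun x hx => ?_) (measurableSet_intervalIq q)
  rw [ENNReal.toReal_ofReal (weight_nonneg hq0 hq1 hα hx)]

lemma isFiniteMeasure_weightMeasure (hq0 : 0 < q) (hq1 : q < 1) (hα : |α| < 1) :
    IsFiniteMeasure (weightMeasure q α) :=
  isFiniteMeasure_withDensity_ofReal (integrableOn_weight hq0 hq1 hα).2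

lemma integral_zero_pi_of_symm {g : ℝ → ℂ} (hg : Continuous g)
    (hs : ∀ θ, g (2 * Real.pi - θ) = g θ) :
    ∫ θ in 0..2 * Real.pi, g θ = 2 * ∫ θ in Set.Ioo 0 Real.pi, g θ := by
  rw [← integral_Ioc_eq_integral_Ioo, ← intervalIntegral.integral_of_le Real.pi_pos.le,
    ← intervalIntegral.integral_add_adjacent_intervals (b := Real.pi)
    (hg.intervalIntegrable _ _) (hg.intervalIntegrable _ _)]
  have h := intervalIntegral.integral_comp_sub_left g (a := 0) (b := Real.pi) (2 * Real.pi)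
  rw [show 2 * Real.pi - Real.pi = Real.pi by ring, sub_zero] at h
  simp only [hs] at h
  rw [← h]
  ring

lemma basisFun_pointIq (hq0 : 0 < q) (hq1 : q < 1) (hα : -1 < α) (n : ℕ) {θ : ℝ}
    (hθ : θ ∈ Set.Ioo 0 Real.pi) :
    basisFun q α n (pointIq q θ) = ((√(qPoch (-α) q n * qPoch q q n))⁻¹ : ℝ) *
      ascQ (q : ℂ) α (circleMap 0 1 θ + (circleMap 0 1 θ)⁻¹) n := by
  rw [basisFun_eq hq0 hq1 hα, angle_pointIq hq1 hθ.1.le hθ.2.le, circleMap_add_inv, ← ascQ_ofReal,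
    Complex.ofReal_mul]

/-- Orthonormality of the basis functions. -/
lemma integral_basisFun_mul_basisFun (hq0 : 0 < q) (hq1 : q < 1) (hα : |α| < 1) (m n : ℕ) :
    ∫ x, basisFun q α m x * basisFun q α n x ∂(weightMeasure q α) = if m = n then 1 else 0 := by
  have hα1 := (abs_lt.1 hα).1
  have cw := continuous_ascWeight_circle hq0 hq1 hα
  have cz : Continuous fun θ : ℝ => circleMap 0 1 θ + (circleMap 0 1 θ)⁻¹ := by
    simp only [circleMap_add_inv]; fun_prop
  have cQ : ∀ n, Continuous fun θ : ℝ =>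
      ascQ (q : ℂ) α (circleMap 0 1 θ + (circleMap 0 1 θ)⁻¹) n := fun n =>
    (differentiable_ascQ (q : ℂ) α n).continuous.comp cz
  have hsym := integral_zero_pi_of_symm (g := fun θ => ascWeight q α (circleMap 0 1 θ) *
      (ascQ (q : ℂ) α (circleMap 0 1 θ + (circleMap 0 1 θ)⁻¹) m *
        ascQ (q : ℂ) α (circleMap 0 1 θ + (circleMap 0 1 θ)⁻¹) n))
      (cw.mul ((cQ m).mul (cQ n))) (fun θ => by
    have : circleMap 0 1 (2 * Real.pi - θ) = (circleMap 0 1 θ)⁻¹ := by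
      simp [circleMap, ← Complex.exp_neg, sub_mul, Complex.exp_sub]
    simp only [this, inv_inv, ascWeight, ascCore_inv,
      add_comm (circleMap 0 1 θ)⁻¹ (circleMap 0 1 θ)]
    ring)
  rw [integral_ascWeight_mul_ascQ_mul_ascQ hq0 hq1 hα] at hsym
  rw [integral_weightMeasure hq0 hq1 hα, setIntegral_weight_smul hq0 hq1]
  have e : ∀ θ ∈ Set.Ioo 0 Real.pi, (qPochInf q q * qPochInf (-α) q / (2 * Real.pi) *
        Complex.normSq (ascHalf q α (circleMap 0 1 θ))) •
          (basisFun q α m (pointIq q θ) * basisFun q α n (pointIq q θ)) =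
      ((qPochInf q q * qPochInf (-α) q / (2 * Real.pi) *
        ((√(qPoch (-α) q m * qPoch q q m))⁻¹ * (√(qPoch (-α) q n * qPoch q q n))⁻¹) : ℝ) : ℂ) *
      (ascWeight q α (circleMap 0 1 θ) *
        (ascQ (q : ℂ) α (circleMap 0 1 θ + (circleMap 0 1 θ)⁻¹) m *
          ascQ (q : ℂ) α (circleMap 0 1 θ + (circleMap 0 1 θ)⁻¹) n)) := by
    intro θ hθ
    rw [basisFun_pointIq hq0 hq1 hα1 m hθ, basisFun_pointIq hq0 hq1 hα1 n hθ,
      ascWeight_eq_normSq hq0 hq1 (by simp), Complex.real_smul]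
    push_cast
    ring
  rw [setIntegral_congr_fun measurableSet_Ioo e, integral_const_mul]
  split_ifs at hsym ⊢ with h
  · subst h
    have hm := ascMass_mul_eq hq0 hq1 hα
    have p1 := qPoch_pos hq0 hq1 (a := -α) (by linarith) m
    have p2 := qPoch_pos hq0 hq1 (a := q) hq1 m
    have hq : ‖q‖ < 1 := by rwa [Real.norm_eq_abs, abs_of_pos hq0]
    have hpi : (Real.pi : ℂ) ≠ 0 := by exact_mod_cast Real.pi_ne_zero
    rw [← mul_inv, Real.mul_self_sqrt (by positivity)]
    push_cast
    rw [qPochInf_ofReal hq, qPochInf_ofReal hq, qPoch_ofReal, qPoch_ofReal]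
    push_cast
    have n1 := qPoch_neg_ne_zero hq0 hq1 hα1 m
    have n2 := qPoch_self_ne_zero (norm_ofReal_lt_one hq0 hq1) m
    generalize ∫ θ in Set.Ioo 0 Real.pi, (_ : ℂ) = J at *
    field_simp
    -- The constant is `(1 / 2π) · (1 / 2) · 4π = 1`: the prefactor of the weight, the half circle,
    -- and the total mass `hm`.
    linear_combination (-qPochInf (q : ℂ) q * qPochInf (-(α : ℂ)) (q : ℂ)) * hsym / 2 +
      (qPoch (-(α : ℂ)) (q : ℂ) m * qPoch (q : ℂ) q m) / 2 * hm
  · have : ∫ θ in Set.Ioo 0 Real.pi, (ascWeight q α (circleMap 0 1 θ) *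
        (ascQ (q : ℂ) α (circleMap 0 1 θ + (circleMap 0 1 θ)⁻¹) m *
          ascQ (q : ℂ) α (circleMap 0 1 θ + (circleMap 0 1 θ)⁻¹) n)) = 0 := by
      simpa using hsym.symm
    rw [this, mul_zero]

end Orthogonality

/-! ### Completeness of the polynomials in the weighted space -/

section Completeness

variable {q α : ℝ}

lemma ae_mem_intervalIq (q α : ℝ) : ∀ᵐ x ∂(weightMeasure q α), x ∈ intervalIq q :=
  (withDensity_absolutelyContinuous _ _).ae_le (ae_restrict_mem (measurableSet_intervalIq q))

lemma two_cos_angle (hq1 : q < 1) {x : ℝ} (hx : x ∈ intervalIq q) :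
    2 * Real.cos (angle q x) = x * √(1 - q) := by
  have h : 0 < √(1 - q) := Real.sqrt_pos.2 (by linarith)
  have h1 := (div_lt_iff₀ h).1 hx.1
  have h2 := (lt_div_iff₀ h).1 hx.2
  rw [angle, Real.cos_arccos (by linarith) (by linarith)]
  ring

lemma continuous_angle (q : ℝ) : Continuous (angle q) := by
  unfold angle
  fun_prop

lemma integrable_comp_smul {X E : Type*} [MeasurableSpace X] {μ : Measure X}
    [NormedAddCommGroup E] [NormedSpace ℝ E] {f : X → E} (hf : Integrable f μ)
    {ζ : X → ℝ} (hζ : AEStronglyMeasurable ζ μ) {a b : ℝ} (hb : ∀ x, ζ x ∈ Set.Icc a b)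
    {g : ℝ → ℝ} (hg : Continuous g) : Integrable (fun x => g (ζ x) • f x) μ := by
  obtain ⟨C, hC⟩ := isCompact_Icc.exists_bound_of_continuousOn (s := Set.Icc a b) hg.continuousOn
  exact hf.bdd_smul C (hg.comp_aestronglyMeasurable hζ) (Eventually.of_forall fun x => hC _ (hb x))

/-- An integrable function orthogonal to all powers of a bounded coordinate function is orthogonal
to all continuous functions of the coordinate. -/
lemma integral_comp_smul_eq_zero {X E : Type*} [MeasurableSpace X] {μ : Measure X}
    [NormedAddCommGroup E] [NormedSpace ℝ E] {f : X → E} (hf : Integrable f μ)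
    {ζ : X → ℝ} (hζ : AEStronglyMeasurable ζ μ) {a b : ℝ} (hb : ∀ x, ζ x ∈ Set.Icc a b)
    (h : ∀ k : ℕ, ∫ x, ζ x ^ k • f x ∂μ = 0) {g : ℝ → ℝ} (hg : Continuous g) :
    ∫ x, g (ζ x) • f x ∂μ = 0 := by
  have hint : ∀ {g : ℝ → ℝ}, Continuous g → Integrable (fun x => g (ζ x) • f x) μ :=
    integrable_comp_smul hf hζ hb
  have hp : ∀ p : Polynomial ℝ, ∫ x, p.eval (ζ x) • f x ∂μ = 0 := by
    intro p
    simp_rw [Polynomial.eval_eq_sum_range, Finset.sum_smul, mul_smul]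
    have hi : ∀ i, Integrable (fun x => p.coeff i • ζ x ^ i • f x) μ := fun i =>
      (hint (continuous_pow i)).smul _
    rw [integral_finsetSum _ fun i _ => hi i]
    simp [integral_smul, h]
  refine norm_eq_zero.1 (le_antisymm (le_of_forall_pos_le_add fun ε hε => ?_) (norm_nonneg _))
  have hM : 0 < (∫ x, ‖f x‖ ∂μ) + 1 := by
    have : 0 ≤ ∫ x, ‖f x‖ ∂μ := integral_nonneg fun x => norm_nonneg _
    linarith
  obtain ⟨p, hpg⟩ := exists_polynomial_near_of_continuousOn a b g hg.continuousOn
    (ε / ((∫ x, ‖f x‖ ∂μ) + 1)) (by positivity)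
  have e : ∫ x, g (ζ x) • f x ∂μ = ∫ x, (g (ζ x) - p.eval (ζ x)) • f x ∂μ := by
    simp_rw [sub_smul]
    rw [integral_sub (hint hg) (hint p.continuous), hp, sub_zero]
  rw [e]
  calc ‖∫ x, (g (ζ x) - p.eval (ζ x)) • f x ∂μ‖
      ≤ ∫ x, ε / ((∫ x, ‖f x‖ ∂μ) + 1) * ‖f x‖ ∂μ := by
        refine norm_integral_le_of_norm_le (hf.norm.const_mul _) (Eventually.of_forall fun x => ?_)
        rw [norm_smul, Real.norm_eq_abs, abs_sub_comm]
        gcongr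
        exact (hpg _ (hb x)).le
    _ ≤ 0 + ε := by
        rw [integral_const_mul, div_mul_eq_mul_div, div_le_iff₀ hM]
        nlinarith

/-- A function orthogonal to the polynomials `Q_n` in a coordinate function is orthogonal to their
products with powers of the coordinate. -/
lemma integral_pow_mul_ascQ_smul_eq_zero {X E : Type*} [MeasurableSpace X] {μ : Measure X}
    [NormedAddCommGroup E] [NormedSpace ℝ E] {f : X → E} {ζ : X → ℝ}
    (hint : ∀ {g : ℝ → ℝ}, Continuous g → Integrable (fun x => g (ζ x) • f x) μ)
    (h0 : ∀ n, ∫ x, ascQ q α (ζ x) n • f x ∂μ = 0) (k n : ℕ) :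
    ∫ x, (ζ x ^ k * ascQ q α (ζ x) n) • f x ∂μ = 0 := by
  induction k generalizing n with
  | zero => simpa using h0 n
  | succ k ih =>
    cases n with
    | zero => simpa [ascQ, pow_succ] using ih 1
    | succ n =>
      have hQ : ∀ m, Continuous fun z : ℝ => z ^ k * ascQ q α z m := fun m =>
        (continuous_pow k).mul (continuous_ascQ m)
      -- The recurrence read as a formula for `z Q_{n+1}` trades one power of the coordinate for
      -- neighbouring degrees.
      have e : ∀ x, (ζ x ^ (k + 1) * ascQ q α (ζ x) (n + 1)) • f x =
          (ζ x ^ k * ascQ q α (ζ x) (n + 2)) • f x +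
            ((1 - q ^ (n + 1)) * (1 + α * q ^ n)) • ((ζ x ^ k * ascQ q α (ζ x) n) • f x) := by
        intro x
        rw [smul_smul, ← add_smul]
        congr 1
        rw [ascQ]
        ring
      have hi : Integrable (fun x => ((1 - q ^ (n + 1)) * (1 + α * q ^ n)) •
          ((ζ x ^ k * ascQ q α (ζ x) n) • f x)) μ := (hint (hQ n)).smul _
      simp_rw [e]
      rw [integral_add (hint (hQ (n + 2))) hi, integral_smul, ih, ih]
      simp

/-- The functions `φ_n` are total: an integrable function orthogonal to all of them vanishes. -/
lemma ae_eq_zero_of_integral_basisFun (hq0 : 0 < q) (hq1 : q < 1) (hα : |α| < 1) {f : ℝ → ℂ}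
    (hf : Integrable f (weightMeasure q α))
    (h : ∀ n, ∫ x, basisFun q α n x * f x ∂(weightMeasure q α) = 0) :
    f =ᵐ[weightMeasure q α] 0 := by
  have hα' := (abs_lt.1 hα).1
  set ζ : ℝ → ℝ := fun x => 2 * Real.cos (angle q x) with hζ
  have hζc : Continuous ζ := by
    have := continuous_angle q
    fun_prop
  have hζb : ∀ x, ζ x ∈ Set.Icc (-2 : ℝ) 2 := fun x => by
    have := Real.neg_one_le_cos (angle q x)
    have := Real.cos_le_one (angle q x)
    constructor <;> simp only [hζ] <;> linarith
  have hint : ∀ {g : ℝ → ℝ}, Continuous g →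
      Integrable (fun x => g (ζ x) • f x) (weightMeasure q α) :=
    integrable_comp_smul hf hζc.aestronglyMeasurable hζb
  have h0 : ∀ n, ∫ x, ascQ q α (ζ x) n • f x ∂(weightMeasure q α) = 0 := by
    intro n
    have hc : 0 < √(qPoch (-α) q n * qPoch q q n) := Real.sqrt_pos.2
      (mul_pos (qPoch_pos hq0 hq1 (by linarith) n) (qPoch_pos hq0 hq1 hq1 n))
    have := h n
    simp_rw [basisFun_eq hq0 hq1 hα' n, ← Complex.real_smul, mul_smul] at this
    rw [integral_smul, smul_eq_zero] at this
    exact this.resolve_left (inv_ne_zero hc.ne')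
  have hk := integral_pow_mul_ascQ_smul_eq_zero hint h0
  refine ae_eq_zero_of_integral_contDiff_smul_eq_zero hf.locallyIntegrable fun g hg _ => ?_
  -- On the interval `ζ(x) = x √(1 - q)`, so a test function of `x` is a continuous function of the
  -- bounded coordinate `ζ`.
  rw [← integral_comp_smul_eq_zero hf hζc.aestronglyMeasurable hζb
    (fun k => by simpa [ascQ] using hk k 0) (g := fun z => g (z / √(1 - q)))
    (hg.continuous.comp (continuous_id.div_const _))]
  refine integral_congr_ae ?_
  filter_upwards [ae_mem_intervalIq q α] with x hx
  have h1 : √(1 - q) ≠ 0 := (Real.sqrt_pos.2 (by linarith)).ne'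
  simp only [hζ]
  rw [two_cos_angle hq1 hx, mul_div_cancel_right₀ _ h1]

lemma memLp_basisFun (hq0 : 0 < q) (hq1 : q < 1) (hα : |α| < 1) (n : ℕ) :
    MemLp (basisFun q α n) 2 (weightMeasure q α) := by
  have := isFiniteMeasure_weightMeasure hq0 hq1 hα
  obtain ⟨C, hC⟩ := exists_norm_basisFun_le hq0 hq1 hα n
  exact MemLp.of_bound
    (continuous_basisFun hq0 hq1 (abs_lt.1 hα).1 n).aestronglyMeasurable C
    (Eventually.of_forall hC)

/-- The functions `φ_n` form a Hilbert basis of `ℋ_{q,α}`. -/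
lemma exists_hilbertBasis_weightMeasure (hq0 : 0 < q) (hq1 : q < 1) (hα : |α| < 1) :
    ∃ b : HilbertBasis ℕ ℂ (Lp ℂ 2 (weightMeasure q α)),
      ∀ n, b n = (memLp_basisFun hq0 hq1 hα n).toLp := by
  have hfin := isFiniteMeasure_weightMeasure hq0 hq1 hα
  have hinner : ∀ (n : ℕ) (f : Lp ℂ 2 (weightMeasure q α)),
      inner ℂ (memLp_basisFun hq0 hq1 hα n).toLp f =
        ∫ x, basisFun q α n x * f x ∂(weightMeasure q α) := by
    intro n f
    rw [L2.inner_def]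
    refine integral_congr_ae ?_
    filter_upwards [(memLp_basisFun hq0 hq1 hα n).coeFn_toLp] with x hx
    rw [hx, RCLike.inner_apply, conj_basisFun hq0 hq1 (abs_lt.1 hα).1, mul_comm]
  have hv : Orthonormal ℂ fun n => (memLp_basisFun hq0 hq1 hα n).toLp := by
    rw [orthonormal_iff_ite]
    intro m n
    rw [hinner, ← integral_basisFun_mul_basisFun hq0 hq1 hα m n]
    refine integral_congr_ae ?_
    filter_upwards [(memLp_basisFun hq0 hq1 hα n).coeFn_toLp] with x hx
    rw [hx]
  have hsp : (Submodule.span ℂ (Set.range fun n => (memLp_basisFun hq0 hq1 hα n).toLp))ᗮ = ⊥ := by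
    rw [Submodule.eq_bot_iff]
    intro f hf
    rw [Submodule.mem_orthogonal] at hf
    have hf' : f =ᵐ[weightMeasure q α] 0 :=
      ae_eq_zero_of_integral_basisFun hq0 hq1 hα ((Lp.memLp f).integrable (by norm_num)) fun n => by
        rw [← hinner]
        exact hf _ (Submodule.subset_span ⟨n, rfl⟩)
    exact Lp.eq_zero_iff_ae_eq_zero.2 hf'
  exact ⟨HilbertBasis.mkOfOrthogonalEqBot hv hsp, fun n => by
    rw [HilbertBasis.coe_mkOfOrthogonalEqBot]⟩

end Completeness

/-! ### The radial measure and the plane measure -/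

section Plane

variable {q α : ℝ}

lemma rogersSzego_eq (hq : ‖q‖ < 1) (n : ℕ) (y : ℝ) :
    rogersSzego q n y = qPoch q q n *
      ∑ p ∈ antidiagonal n, 1 ^ p.1 / qPoch q q p.1 * (y ^ p.2 / qPoch q q p.2) := by
  rw [← Finset.Nat.sum_antidiagonal_swap, rogersSzego]
  simp only [Prod.fst_swap, Prod.snd_swap]
  rw [Finset.Nat.sum_antidiagonal_eq_sum_range_succ
    (fun i j => 1 ^ j / qPoch q q j * (y ^ i / qPoch q q i)), Finset.mul_sum]
  refine Finset.sum_congr rfl fun k _ => ?_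
  have := qPoch_self_ne_zero hq k
  have := qPoch_self_ne_zero hq (n - k)
  field_simp
  simp

/-- For `-1 < y < 0` the terms alternate in sign, but `H_n = h_n(y) / (q; q)_n` satisfies `(1 -
q^(n+2)) H_{n+2} = (1 + y) H_{n+1} - y H_n`, whose coefficients are positive. With `y = -α / q` the
bound `-1 < y` is the condition `α < q`. -/
lemma rogersSzego_nonneg (hq0 : 0 < q) (hq1 : q < 1) {y : ℝ} (hy : -1 < y) (n : ℕ) :
    0 ≤ rogersSzego q n y := by
  have hq : ‖q‖ < 1 := by rwa [Real.norm_of_nonneg hq0.le]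
  have hp := qPoch_pos hq0 hq1 hq1
  rcases le_or_gt 0 y with h0 | h0
  · refine Finset.sum_nonneg fun k _ => ?_
    have := hp n
    have := hp k
    have := hp (n - k)
    positivity
  rw [rogersSzego_eq hq]
  refine mul_nonneg (hp n).le ?_
  -- The hypothesis of `conv_recurrence` at `α = 0`, `u = y`, `v = 1`; the zero terms are kept to
  -- match its form.
  have hf : ∀ j, y ^ (j + 1) / qPoch q q (j + 1) * ((1 - q ^ (j + 1)) * (1 + 0 * q ^ j)) =
      y ^ j / qPoch q q j * (y - 0 * 1 * q ^ (2 * j)) := by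
    intro j
    have h1 := (hp j).ne'
    have h2 := (hp (j + 1)).ne'
    have h3 : qPoch q q (j + 1) = qPoch q q j * (1 - q ^ (j + 1)) := by
      rw [qPoch_succ, pow_succ']
    rw [h3] at h2 ⊢
    have h4 := right_ne_zero_of_mul h2
    field_simp
    ring
  induction n using Nat.twoStepInduction with
  | zero => simp [qPoch_zero]
  | one =>
    have h1 : 0 < 1 - q := by linarith
    simp [Finset.Nat.antidiagonal_succ, qPoch]
    rw [← one_div, ← add_div]
    exact div_nonneg (by linarith) h1.le
  | more n i0 i1 =>
    have h := conv_recurrence (v := 1) (f := fun j => y ^ j / qPoch q q j) hq0.ne' (fun n => (hp n).ne') hf n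
    have h1 : 0 < (1 - q ^ (n + 2)) * (1 + 0 * q ^ (n + 1)) := by
      have := pow_lt_one₀ hq0.le hq1 (n := n + 2) (by omega)
      simpa using this
    refine nonneg_of_mul_nonneg_right (a := (1 - q ^ (n + 2)) * (1 + 0 * q ^ (n + 1))) ?_ h1
    rw [h]
    nlinarith

/-- The weights of the radial measure. -/
noncomputable def radialCoeff (q α : ℝ) (n : ℕ) : ℝ :=
  qPochInf (-α) q * qPochInf q q * (q ^ n / qPoch q q n * rogersSzego q n (-α * q⁻¹))

/-- The atoms of the radial measure. -/
noncomputable def radialPoint (q : ℝ) (n : ℕ) : ℝ := (√(1 - q))⁻¹ * q ^ ((n : ℝ) / 2)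

lemma radialMeasure_eq (q α : ℝ) : radialMeasure q α = Measure.sum fun n =>
    ENNReal.ofReal (radialCoeff q α n) • Measure.dirac (radialPoint q n) := rfl

lemma radialCoeff_nonneg (hq0 : 0 < q) (hq1 : q < 1) (hα : |α| < 1) (hαq : α < q) (n : ℕ) :
    0 ≤ radialCoeff q α n := by
  have h1 := qPochInf_pos hq0 hq1 (a := -α) (by rwa [abs_neg])
  have h2 := qPochInf_pos hq0 hq1 (a := q) (by rwa [abs_of_pos hq0])
  have h3 := qPoch_pos hq0 hq1 hq1 n
  have h4 : 0 ≤ rogersSzego q n (-α * q⁻¹) := by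
    refine rogersSzego_nonneg hq0 hq1 ?_ n
    rw [← div_eq_mul_inv, lt_div_iff₀ hq0]
    linarith
  unfold radialCoeff
  positivity

lemma radialPoint_nonneg (hq0 : 0 < q) (n : ℕ) : 0 ≤ radialPoint q n := by
  unfold radialPoint
  positivity

lemma radialPoint_sq (hq0 : 0 < q) (hq1 : q < 1) (n : ℕ) :
    radialPoint q n ^ 2 = q ^ n / (1 - q) := by
  rw [radialPoint, mul_pow, inv_pow, Real.sq_sqrt (by linarith), ← Real.rpow_natCast (q ^ _),
    ← Real.rpow_mul hq0.le, ← Real.rpow_natCast]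
  push_cast
  rw [div_mul_cancel₀ _ (two_ne_zero), inv_mul_eq_div]

lemma radialPoint_le (hq0 : 0 < q) (hq1 : q < 1) (n : ℕ) : radialPoint q n ≤ (√(1 - q))⁻¹ := by
  refine mul_le_of_le_one_right (by positivity) ?_
  exact Real.rpow_le_one hq0.le hq1.le (by positivity)

/-- `h_n(y) / (q; q)_n` is a Cauchy product coefficient, so Euler's expansion sums the series to `1
/ ((q^(m+1); q)_∞ (-α q^m; q)_∞)`. Multiplying by `(-α, q; q)_∞` leaves the first `m` factors. -/
lemma hasSum_radialCoeff_mul_pow (hq0 : 0 < q) (hq1 : q < 1) (hα : |α| < 1) (m : ℕ) :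
    HasSum (fun n => radialCoeff q α n * (q ^ n) ^ m) (qPoch (-α) q m * qPoch q q m) := by
  have hq : ‖q‖ < 1 := by rwa [Real.norm_of_nonneg hq0.le]
  have hp := fun n => (qPoch_pos hq0 hq1 hq1 n).ne'
  have h1 : ‖q ^ (m + 1)‖ < 1 := by
    rw [norm_pow]
    exact pow_lt_one₀ (norm_nonneg _) hq (by omega)
  have h2 : ‖-α * q ^ m‖ < 1 := by
    rw [norm_mul, norm_neg, norm_pow, Real.norm_eq_abs]
    exact mul_lt_one_of_nonneg_of_lt_one_left (abs_nonneg _) hα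
      (pow_le_one₀ (norm_nonneg _) hq.le)
  have s1 := summable_norm_pow_div_qPoch hq h1
  have s2 := summable_norm_pow_div_qPoch hq h2
  have hs := (summable_norm_sum_mul_antidiagonal_of_summable_norm s1 s2).of_norm.hasSum
  rw [← tsum_mul_tsum_eq_tsum_sum_antidiagonal_of_summable_norm s1 s2, tsum_pow_div_qPoch hq h1,
    tsum_pow_div_qPoch hq h2] at hs
  have hs := hs.mul_left (qPochInf (-α) q * qPochInf q q)
  have n1 := (qPochInf_pos hq0 hq1 (a := -α) (by rwa [abs_neg])).ne'
  have n2 := (qPochInf_pos hq0 hq1 (a := q) (by rwa [abs_of_pos hq0])).ne'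
  have e1 := qPochInf_eq_qPoch_mul hq (-α) m
  have e2 := qPochInf_eq_qPoch_mul hq q m
  rw [← pow_succ'] at e2
  convert! hs using 1
  · ext n
    have := hp n
    rw [radialCoeff, rogersSzego_eq hq, mul_assoc]
    congr 1
    rw [div_mul_eq_mul_div, mul_left_comm, mul_div_cancel_left₀ _ this, Finset.mul_sum,
      Finset.sum_mul]
    refine Finset.sum_congr rfl fun p hpn => ?_
    rw [← Finset.HasAntidiagonal.mem_antidiagonal.1 hpn, one_pow]
    have := hp p.1
    have := hp p.2
    rw [show -α * q ^ m = -α * q⁻¹ * q ^ (m + 1) by field_simp; ring]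
    generalize -α * q⁻¹ = y
    field_simp
    ring
  · rw [e1, e2]
    rw [e1] at n1
    rw [e2] at n2
    have := right_ne_zero_of_mul n1
    have := right_ne_zero_of_mul n2
    generalize qPochInf (-α * q ^ m) q = A at *
    field_simp

lemma summable_radialCoeff (hq0 : 0 < q) (hq1 : q < 1) (hα : |α| < 1) :
    Summable (radialCoeff q α) := by
  simpa using (hasSum_radialCoeff_mul_pow hq0 hq1 hα 0).summable

lemma isFiniteMeasure_radialMeasure (hq0 : 0 < q) (hq1 : q < 1) (hα : |α| < 1) :
    IsFiniteMeasure (radialMeasure q α) := by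
  refine ⟨?_⟩
  rw [radialMeasure_eq, Measure.sum_apply _ MeasurableSet.univ]
  simpa using (summable_radialCoeff hq0 hq1 hα).tsum_ofReal_lt_top

lemma ae_radialMeasure (hq0 : 0 < q) (hq1 : q < 1) (α : ℝ) :
    ∀ᵐ r ∂(radialMeasure q α), r ∈ Set.Icc 0 (√(1 - q))⁻¹ := by
  rw [radialMeasure_eq]
  refine (Measure.ae_sum_iff' measurableSet_Icc).2 fun n => ?_
  refine Measure.ae_smul_measure ?_ _
  rw [ae_dirac_iff measurableSet_Icc]
  exact ⟨radialPoint_nonneg hq0 n, radialPoint_le hq0 hq1 n⟩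

lemma integral_radialMeasure_pow (hq0 : 0 < q) (hq1 : q < 1) (hα : |α| < 1) (hαq : α < q) (m : ℕ) :
    ∫ r, r ^ (2 * m) ∂(radialMeasure q α) = genFact q α m := by
  have h := (hasSum_radialCoeff_mul_pow hq0 hq1 hα m).mul_right (((1 - q) ^ m)⁻¹)
  rw [← genFact_mul_pow hq1, mul_assoc,
    mul_inv_cancel₀ (pow_ne_zero _ (by linarith)), mul_one] at h
  rw [radialMeasure_eq, integral_sum_dirac fun _ => ENNReal.ofReal_ne_top, ← h.tsum_eq]
  refine tsum_congr fun n => ?_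
  rw [ENNReal.toReal_ofReal (radialCoeff_nonneg hq0 hq1 hα hαq n), pow_mul,
    radialPoint_sq hq0 hq1, div_pow, smul_eq_mul, div_eq_mul_inv, mul_assoc]

/-- The normalized angular measure. -/
noncomputable def angularMeasure : Measure ℝ :=
  ENNReal.ofReal (1 / (2 * Real.pi)) • volume.restrict (Set.Ico 0 (2 * Real.pi))

instance isFiniteMeasure_angularMeasure : IsFiniteMeasure angularMeasure := by
  unfold angularMeasure
  exact Measure.smul_finite _ ENNReal.ofReal_ne_top

lemma integral_angularMeasure_exp (k : ℤ) :
    ∫ θ : ℝ, Complex.exp (Complex.I * k * θ) ∂angularMeasure = if k = 0 then 1 else 0 := by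
  have hpi := Real.pi_pos
  rw [angularMeasure, integral_smul_measure, integral_Ico_eq_integral_Ioc,
    ← intervalIntegral.integral_of_le (by positivity), ENNReal.toReal_ofReal (by positivity)]
  split_ifs with hk
  · subst hk
    simp
    field_simp
  · rw [integral_exp_mul_complex (mul_ne_zero Complex.I_ne_zero (by exact_mod_cast hk))]
    have : Complex.I * k * ((2 * Real.pi : ℝ) : ℂ) = k * (2 * Real.pi * Complex.I) := by
      push_cast
      ring
    rw [this, Complex.exp_int_mul_two_pi_mul_I]
    simp

/-- Polar coordinates. -/
noncomputable def polarPoint (p : ℝ × ℝ) : ℂ := (p.1 : ℂ) * Complex.exp (Complex.I * (p.2 : ℂ))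

lemma continuous_polarPoint : Continuous polarPoint := by
  unfold polarPoint
  fun_prop

lemma planeMeasure_eq (q α : ℝ) : planeMeasure q α =
    ((radialMeasure q α).prod angularMeasure).map polarPoint := rfl

lemma isFiniteMeasure_planeMeasure (hq0 : 0 < q) (hq1 : q < 1) (hα : |α| < 1) :
    IsFiniteMeasure (planeMeasure q α) := by
  have := isFiniteMeasure_radialMeasure hq0 hq1 hα
  rw [planeMeasure_eq]
  infer_instance

lemma ae_norm_le_planeMeasure (hq0 : 0 < q) (hq1 : q < 1) (hα : |α| < 1) :
    ∀ᵐ z ∂(planeMeasure q α), ‖z‖ ≤ (√(1 - q))⁻¹ := by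
  have := isFiniteMeasure_radialMeasure hq0 hq1 hα
  rw [planeMeasure_eq, ae_map_iff continuous_polarPoint.aemeasurable
    (measurableSet_le measurable_norm measurable_const)]
  filter_upwards [Measure.quasiMeasurePreserving_fst.ae (ae_radialMeasure hq0 hq1 α)] with p hp
  rw [polarPoint, norm_mul, norm_exp_I_mul, mul_one, Complex.norm_real, Real.norm_of_nonneg hp.1]
  exact hp.2

/-- The angular integral of `e^{i(n-m)θ}` selects `m = n`, and the even radial moments are `x_n!`.
-/
lemma integral_planeMeasure_pow_mul_conj_pow (hq0 : 0 < q) (hq1 : q < 1) (hα : |α| < 1)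
    (hαq : α < q) (m n : ℕ) :
    ∫ z, z ^ n * conj z ^ m ∂(planeMeasure q α) =
      if m = n then (genFact q α n : ℂ) else 0 := by
  have := isFiniteMeasure_radialMeasure hq0 hq1 hα
  rw [planeMeasure_eq, integral_map continuous_polarPoint.aemeasurable
    (Continuous.aestronglyMeasurable (by fun_prop))]
  have e : ∀ p : ℝ × ℝ, polarPoint p ^ n * conj (polarPoint p) ^ m =
      ((p.1 ^ (n + m) : ℝ) : ℂ) * Complex.exp (Complex.I * ((n - m : ℤ) : ℂ) * p.2) := by
    intro p
    rw [polarPoint, map_mul, Complex.conj_ofReal, ← Complex.exp_conj, mul_pow, mul_pow,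
      ← Complex.exp_nat_mul, ← Complex.exp_nat_mul, mul_mul_mul_comm, ← Complex.exp_add]
    congr 2
    · push_cast
      ring
    · simp
      ring
  simp_rw [e]
  rw [integral_prod_mul (fun r : ℝ => ((r ^ (n + m) : ℝ) : ℂ))
    (fun θ : ℝ => Complex.exp (Complex.I * ((n - m : ℤ) : ℂ) * θ)), integral_angularMeasure_exp,
    integral_complex_ofReal]
  rcases eq_or_ne m n with rfl | h
  · simp [← two_mul, integral_radialMeasure_pow hq0 hq1 hα hαq]
  · rw [if_neg h, if_neg (by omega), mul_zero]

/-- The normalized monomials. -/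
noncomputable def monoFun (q α : ℝ) (n : ℕ) (z : ℂ) : ℂ := z ^ n / (√(genFact q α n) : ℂ)

lemma memLp_monoFun (hq0 : 0 < q) (hq1 : q < 1) (hα : |α| < 1) (n : ℕ) :
    MemLp (monoFun q α n) 2 (planeMeasure q α) := by
  have := isFiniteMeasure_planeMeasure hq0 hq1 hα
  refine MemLp.of_bound (Continuous.aestronglyMeasurable (by unfold monoFun; fun_prop))
    ((√(1 - q))⁻¹ ^ n / √(genFact q α n)) ?_
  filter_upwards [ae_norm_le_planeMeasure hq0 hq1 hα] with z hz
  rw [monoFun, norm_div, norm_pow, Complex.norm_real, Real.norm_of_nonneg (Real.sqrt_nonneg _)]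
  gcongr

lemma integral_conj_monoFun_mul_monoFun (hq0 : 0 < q) (hq1 : q < 1) (hα : |α| < 1)
    (hαq : α < q) (m n : ℕ) :
    ∫ z, monoFun q α n z * conj (monoFun q α m z) ∂(planeMeasure q α) =
      if m = n then 1 else 0 := by
  have e : ∀ z, monoFun q α n z * conj (monoFun q α m z) =
      ((√(genFact q α n) : ℂ)⁻¹ * (√(genFact q α m) : ℂ)⁻¹) * (z ^ n * conj z ^ m) := by
    intro z
    rw [monoFun, monoFun, map_div₀, map_pow, Complex.conj_ofReal]
    ring
  simp_rw [e]
  rw [integral_const_mul, integral_planeMeasure_pow_mul_conj_pow hq0 hq1 hα hαq]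
  split_ifs with h
  · subst h
    have := genFact_pos hq0 hq1 (abs_lt.1 hα).1 m
    rw [← mul_inv, ← Complex.ofReal_mul, Real.mul_self_sqrt this.le]
    exact inv_mul_cancel₀ (by exact_mod_cast this.ne')
  · simp

lemma setOf_monomials_eq (hq0 : 0 < q) (hq1 : q < 1) (hα : |α| < 1) :
    {F : Lp ℂ 2 (planeMeasure q α) | ∃ n : ℕ,
      F =ᵐ[planeMeasure q α] fun z => z ^ n / (√(genFact q α n) : ℂ)} =
      Set.range fun n => (memLp_monoFun hq0 hq1 hα n).toLp := by
  ext F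
  constructor
  · rintro ⟨n, hn⟩
    exact ⟨n, Lp.ext ((memLp_monoFun hq0 hq1 hα n).coeFn_toLp.trans hn.symm)⟩
  · rintro ⟨n, rfl⟩
    exact ⟨n, (memLp_monoFun hq0 hq1 hα n).coeFn_toLp⟩

/-- An orthonormal family is a Hilbert basis of the closure of its span. -/
lemma exists_hilbertBasis_topologicalClosure_span {𝕜 E ι : Type*} [RCLike 𝕜]
    [NormedAddCommGroup E] [InnerProductSpace 𝕜 E] [CompleteSpace E] {v : ι → E}
    (hv : Orthonormal 𝕜 v) :
    ∃ b : HilbertBasis ι 𝕜 (Submodule.span 𝕜 (Set.range v)).topologicalClosure,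
      ∀ i, (b i : E) = v i := by
  set S := (Submodule.span 𝕜 (Set.range v)).topologicalClosure with hS
  have hmem : ∀ i, v i ∈ S := fun i =>
    Submodule.le_topologicalClosure _ (Submodule.subset_span ⟨i, rfl⟩)
  have hw : Orthonormal 𝕜 fun i => (⟨v i, hmem i⟩ : S) := by
    classical
    rw [orthonormal_iff_ite] at hv ⊢
    exact hv
  have : CompleteSpace S := (Submodule.isClosed_topologicalClosure _).completeSpace_coe
  have hsp : (Submodule.span 𝕜 (Set.range fun i => (⟨v i, hmem i⟩ : S)))ᗮ = ⊥ := by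
    rw [Submodule.eq_bot_iff]
    intro f hf
    have h1 : S ≤ (Submodule.span 𝕜 {(f : E)})ᗮ := by
      refine Submodule.topologicalClosure_minimal _ (Submodule.span_le.2 ?_)
        (Submodule.isClosed_orthogonal _)
      rintro _ ⟨i, rfl⟩
      rw [SetLike.mem_coe, Submodule.mem_orthogonal_singleton_iff_inner_left]
      exact hf _ (Submodule.subset_span ⟨i, rfl⟩)
    exact Subtype.ext (inner_self_eq_zero.1
      (Submodule.mem_orthogonal_singleton_iff_inner_left.1 (h1 f.2)))
  exact ⟨HilbertBasis.mkOfOrthogonalEqBot hw hsp, fun i => by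
    rw [HilbertBasis.coe_mkOfOrthogonalEqBot]⟩

/-- The normalized monomials form a Hilbert basis. -/
lemma exists_hilbertBasis_spaceA2 (hq0 : 0 < q) (hq1 : q < 1) (hα : |α| < 1) (hαq : α < q) :
    ∃ b : HilbertBasis ℕ ℂ (spaceA2 q α),
      ∀ n, (b n : Lp ℂ 2 (planeMeasure q α)) =ᵐ[planeMeasure q α] monoFun q α n := by
  have hv : Orthonormal ℂ fun n => (memLp_monoFun hq0 hq1 hα n).toLp := by
    rw [orthonormal_iff_ite]
    intro m n
    rw [L2.inner_def, ← integral_conj_monoFun_mul_monoFun hq0 hq1 hα hαq m n]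
    refine integral_congr_ae ?_
    filter_upwards [(memLp_monoFun hq0 hq1 hα n).coeFn_toLp,
      (memLp_monoFun hq0 hq1 hα m).coeFn_toLp] with z h1 h2
    rw [h1, h2, RCLike.inner_apply]
  obtain ⟨b, hb⟩ := exists_hilbertBasis_topologicalClosure_span hv
  unfold spaceA2
  rw [setOf_monomials_eq hq0 hq1 hα]
  refine ⟨b, fun n => ?_⟩
  rw [hb]
  exact (memLp_monoFun hq0 hq1 hα n).coeFn_toLp

end Plane

/-! ### The reproducing kernel -/

section Kernel

variable {q α : ℝ}

lemma basicHyp_zero_zero {K : Type*} [Field K] [TopologicalSpace K] (c q ξ : K) :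
    basicHyp [0, 0] [c] q ξ = ∑' n : ℕ, ξ ^ n / (qPoch c q n * qPoch q q n) := by
  refine tsum_congr fun n => ?_
  simp [qPoch_zero_left, div_eq_mul_inv, mul_comm, mul_left_comm]

lemma normFactor_eq (hq1 : q < 1) (t : ℝ) :
    normFactor q α t = ∑' n : ℕ, t ^ n / genFact q α n := by
  rw [normFactor, basicHyp_zero_zero]
  refine tsum_congr fun n => ?_
  rw [← genFact_mul_pow hq1, mul_pow, mul_div_mul_right _ _ (pow_ne_zero _ (by linarith))]

lemma kernelK_eq (hq1 : q < 1) (z w : ℂ) :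
    kernelK q α z w = ∑' n : ℕ, (z * conj w) ^ n / (genFact q α n : ℂ) := by
  rw [kernelK, basicHyp_zero_zero]
  refine tsum_congr fun n => ?_
  have h : (genFact q α n : ℂ) * (1 - q) ^ n = qPoch (-(α : ℂ)) q n * qPoch (q : ℂ) q n := by
    have := congrArg (fun x : ℝ => (x : ℂ)) (genFact_mul_pow hq1 α n)
    push_cast [qPoch_ofReal] at this
    exact this
  have h1 : (1 - (q : ℂ)) ≠ 0 := by
    norm_cast
    linarith
  rw [← h, mul_pow, mul_div_mul_right _ _ (pow_ne_zero _ h1)]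

lemma exists_norm_monoFun_le (hq0 : 0 < q) (hq1 : q < 1) (hα : |α| < 1) :
    ∃ C, 0 ≤ C ∧ ∀ n z, ‖monoFun q α n z‖ ≤ C * ‖z * (√(1 - q) : ℝ)‖ ^ n := by
  obtain ⟨C1, hC1, h1⟩ := exists_qPoch_inv_le hq0 hq1 (a := -α) (by rwa [abs_neg])
  obtain ⟨C2, hC2, h2⟩ := exists_qPoch_inv_le hq0 hq1 (a := q) (by rwa [abs_of_pos hq0])
  refine ⟨√(C1 * C2), Real.sqrt_nonneg _, fun n z => ?_⟩
  have hp1 := qPoch_pos hq0 hq1 (a := -α) (by linarith [(abs_lt.1 hα).1]) n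
  have hp2 := qPoch_pos hq0 hq1 hq1 n
  have h3 : 0 < 1 - q := by linarith
  have hg : genFact q α n = qPoch (-α) q n * qPoch q q n / (1 - q) ^ n := by
    rw [← genFact_mul_pow hq1, mul_div_cancel_right₀ _ (pow_ne_zero _ h3.ne')]
  have e : (√(genFact q α n))⁻¹ =
      √((qPoch (-α) q n)⁻¹ * (qPoch q q n)⁻¹) * √(1 - q) ^ n := by
    rw [← Real.sqrt_inv, hg, inv_div, div_eq_inv_mul, Real.sqrt_mul (by positivity),
      mul_inv, Real.sqrt_eq_rpow ((1 - q) ^ n), Real.sqrt_eq_rpow (1 - q), ← Real.rpow_natCast,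
      ← Real.rpow_natCast, ← Real.rpow_mul h3.le, ← Real.rpow_mul h3.le, mul_comm (n : ℝ)]
  rw [monoFun, norm_div, norm_pow, norm_mul, Complex.norm_real, Complex.norm_real,
    Real.norm_of_nonneg (Real.sqrt_nonneg _), Real.norm_of_nonneg (Real.sqrt_nonneg _),
    div_eq_mul_inv, e, mul_pow, mul_left_comm]
  gcongr
  · exact h1 n
  · exact h2 n

lemma summable_norm_monoFun_mul {c : ℕ → ℂ} {M : ℝ} (hq0 : 0 < q) (hq1 : q < 1) (hα : |α| < 1)
    (hc : ∀ n, ‖c n‖ ≤ M) {z : ℂ} (hz : z ∈ discCq q) :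
    Summable fun n => ‖c n * monoFun q α n z‖ := by
  obtain ⟨C, hC, h⟩ := exists_norm_monoFun_le hq0 hq1 hα
  refine Summable.of_nonneg_of_le (fun n => norm_nonneg _) (fun n => ?_)
    ((summable_geometric_of_lt_one (norm_nonneg _) (norm_mul_sqrt_lt_one hq1 hz)).mul_left (M * C))
  rw [norm_mul, mul_assoc]
  exact mul_le_mul (hc n) (h n z) (norm_nonneg _) ((norm_nonneg _).trans (hc n))

lemma memℓp_conj_monoFun (hq0 : 0 < q) (hq1 : q < 1) (hα : |α| < 1) {z : ℂ} (hz : z ∈ discCq q) :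
    Memℓp (fun n => conj (monoFun q α n z)) 2 := by
  have h : Summable fun n => ‖monoFun q α n z‖ := by
    simpa using summable_norm_monoFun_mul (c := 1) (M := 1) hq0 hq1 hα (by simp) hz
  refine memℓp_gen ?_
  obtain ⟨B, hB⟩ := h.tendsto_atTop_zero.bddAbove_range
  refine Summable.of_nonneg_of_le (fun n => by positivity) (fun n => ?_) (h.mul_left B)
  have := hB ⟨n, rfl⟩
  simp only [RCLike.norm_conj, ENNReal.toReal_ofNat, Real.rpow_ofNat, sq]
  gcongr

lemma isOpen_discCq (q : ℝ) : IsOpen (discCq q) :=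
  isOpen_lt Complex.continuous_normSq continuous_const

/-- The sum of a series of normalized monomials. -/
noncomputable def seriesFun (q α : ℝ) (c : ℕ → ℂ) (z : ℂ) : ℂ := ∑' n, c n * monoFun q α n z

lemma differentiableOn_seriesFun {c : ℕ → ℂ} {M : ℝ} (hq0 : 0 < q) (hq1 : q < 1) (hα : |α| < 1)
    (hc : ∀ n, ‖c n‖ ≤ M) : DifferentiableOn ℂ (seriesFun q α c) (discCq q) := by
  intro z hz
  obtain ⟨C, hC, h⟩ := exists_norm_monoFun_le hq0 hq1 hα
  obtain ⟨r, hr1, hr2⟩ := exists_between (norm_mul_sqrt_lt_one hq1 hz)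
  have hr0 := (norm_nonneg _).trans hr1.le
  have hM := (norm_nonneg _).trans (hc 0)
  have hU : IsOpen {w : ℂ | ‖w * (√(1 - q) : ℝ)‖ < r} :=
    isOpen_lt (by fun_prop) continuous_const
  refine DifferentiableAt.differentiableWithinAt ?_
  refine DifferentiableOn.differentiableAt ?_ (hU.mem_nhds hr1)
  refine Complex.differentiableOn_tsum_of_summable_norm
    ((summable_geometric_of_lt_one hr0 hr2).mul_left (M * C)) (fun n => ?_) hU fun n w hw => ?_
  · unfold monoFun
    fun_prop
  · rw [norm_mul, mul_assoc]
    refine mul_le_mul (hc n) ((h n w).trans ?_) (norm_nonneg _) hM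
    gcongr
    exact hw.le

/-- Uniqueness of the Taylor coefficients at `0`. This is what makes the map from classes in `L²` to
functions on the disc injective. -/
lemma eq_zero_of_seriesFun_eq_zero {c : ℕ → ℂ} {M : ℝ} (hq0 : 0 < q) (hq1 : q < 1) (hα : |α| < 1)
    (hc : ∀ n, ‖c n‖ ≤ M) (h : ∀ z ∈ discCq q, seriesFun q α c z = 0) (n : ℕ) : c n = 0 := by
  have h0 : (0 : ℂ) ∈ discCq q := by
    simp only [discCq, Set.mem_ofPred_eq, map_zero, inv_pos]
    linarith
  have hp : HasFPowerSeriesAt (0 : ℂ → ℂ)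
      (FormalMultilinearSeries.ofScalars ℂ fun n => c n / (√(genFact q α n) : ℂ)) 0 := by
    rw [hasFPowerSeriesAt_iff]
    filter_upwards [(isOpen_discCq q).mem_nhds h0] with z hz
    have := (summable_norm_monoFun_mul hq0 hq1 hα hc hz).of_norm.hasSum
    rw [show ∑' n, c n * monoFun q α n z = 0 from h z hz] at this
    simp only [FormalMultilinearSeries.coeff_ofScalars, Pi.zero_apply]
    convert! this using 2 with n
    rw [monoFun, smul_eq_mul]
    ring
  have h1 := congrArg (fun p => FormalMultilinearSeries.coeff p n) hp.eq_zero
  simp only [FormalMultilinearSeries.coeff_ofScalars] at h1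
  have h2 : (√(genFact q α n) : ℂ) ≠ 0 := by
    exact_mod_cast (Real.sqrt_pos.2 (genFact_pos hq0 hq1 (abs_lt.1 hα).1 n)).ne'
  have h3 : c n / (√(genFact q α n) : ℂ) = 0 := h1
  exact (div_eq_zero_iff.1 h3).resolve_right h2

lemma norm_lp_two_apply_le (f : lp (fun _ : ℕ => ℂ) 2) (n : ℕ) : ‖f n‖ ≤ ‖f‖ :=
  lp.norm_apply_le_norm (by norm_num) f n

lemma conj_mul_monoFun (hq0 : 0 < q) (hq1 : q < 1) (hα : |α| < 1) (n : ℕ) (z w : ℂ) :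
    conj (monoFun q α n w) * monoFun q α n z = (z * conj w) ^ n / (genFact q α n : ℂ) := by
  have := genFact_pos hq0 hq1 (abs_lt.1 hα).1 n
  rw [monoFun, monoFun, map_div₀, map_pow, Complex.conj_ofReal, div_mul_div_comm, ← mul_pow,
    mul_comm (conj w), ← Complex.ofReal_mul, Real.mul_self_sqrt this.le]

lemma normFactor_pos (hq0 : 0 < q) (hq1 : q < 1) (hα : |α| < 1) {z : ℂ} (hz : z ∈ discCq q) :
    0 < normFactor q α (Complex.normSq z) := by
  have hg := fun n => genFact_pos hq0 hq1 (abs_lt.1 hα).1 n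
  have h : Summable fun n => ‖monoFun q α n z‖ ^ 2 := by
    simpa using (memℓp_gen_iff (by norm_num)).1 (memℓp_conj_monoFun hq0 hq1 hα hz)
  have e : ∀ n, ‖monoFun q α n z‖ ^ 2 = Complex.normSq z ^ n / genFact q α n := by
    intro n
    rw [monoFun, norm_div, norm_pow, Complex.norm_real, Real.norm_of_nonneg (Real.sqrt_nonneg _),
      div_pow, Real.sq_sqrt (hg n).le, Complex.normSq_eq_norm_sq, ← pow_mul, ← pow_mul, mul_comm]
  simp_rw [e] at h
  rw [normFactor_eq hq1]
  refine h.tsum_pos (fun n => ?_) 0 ?_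
  · exact div_nonneg (pow_nonneg (Complex.normSq_nonneg _) _) (hg n).le
  · simpa using hg 0

end Kernel

/-! ### The reproducing kernel Hilbert space -/

section Space

variable {q α : ℝ}

/-- A square summable series of normalized monomials that converges in `L²` converges almost
everywhere on the disc to the same sum. -/
lemma ae_eq_seriesFun (hq0 : 0 < q) (hq1 : q < 1) (hα : |α| < 1)
    {F : Lp ℂ 2 (planeMeasure q α)} {c : ℕ → ℂ} {M : ℝ} (hc : ∀ n, ‖c n‖ ≤ M)
    (h : HasSum (fun n => c n • (memLp_monoFun hq0 hq1 hα n).toLp) F) :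
    F =ᵐ[(planeMeasure q α).restrict (discCq q)] seriesFun q α c := by
  have hm : TendstoInMeasure (planeMeasure q α)
      (fun N => (∑ n ∈ Finset.range N, c n • (memLp_monoFun hq0 hq1 hα n).toLp :
        Lp ℂ 2 (planeMeasure q α))) atTop F :=
    tendstoInMeasure_of_tendsto_Lp h.tendsto_sum_nat
  -- Convergence in `L²` gives almost everywhere convergence of a subsequence of partial sums; on
  -- the disc all partial sums converge pointwise, so the limits agree.
  obtain ⟨ns, hns, hlim⟩ := hm.exists_seq_tendsto_ae
  have hS : ∀ N, (∑ n ∈ Finset.range N, c n • (memLp_monoFun hq0 hq1 hα n).toLp :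
      Lp ℂ 2 (planeMeasure q α)) =ᵐ[planeMeasure q α]
        fun z => ∑ n ∈ Finset.range N, c n * monoFun q α n z := by
    intro N
    have hn : ∀ᵐ z ∂(planeMeasure q α), ∀ n,
        (c n • (memLp_monoFun hq0 hq1 hα n).toLp : Lp ℂ 2 (planeMeasure q α)) z =
          c n * monoFun q α n z := by
      rw [ae_all_iff]
      intro n
      filter_upwards [Lp.coeFn_smul (c n) (memLp_monoFun hq0 hq1 hα n).toLp,
        (memLp_monoFun hq0 hq1 hα n).coeFn_toLp] with z h1 h2
      rw [h1, Pi.smul_apply, h2, smul_eq_mul]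
    filter_upwards [Lp.coeFn_finsetSum (Finset.range N)
      fun n => c n • (memLp_monoFun hq0 hq1 hα n).toLp, hn] with z h1 h2
    rw [h1, Finset.sum_apply]
    exact Finset.sum_congr rfl fun n _ => h2 n
  filter_upwards [ae_restrict_of_ae hlim, ae_restrict_of_ae (ae_all_iff.2 hS),
    ae_restrict_mem (isOpen_discCq q).measurableSet] with z h1 h2 hz
  have h3 := ((summable_norm_monoFun_mul hq0 hq1 hα hc hz).of_norm.hasSum.tendsto_sum_nat).comp
    hns.tendsto_atTop
  refine tendsto_nhds_unique h1 (h3.congr fun k => ?_)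
  exact (h2 (ns k)).symm

variable (hq0 : 0 < q) (hq1 : q < 1) (hα : |α| < 1)

/-- The square summable sequence representing the evaluation at a point of the disc. -/
noncomputable def evalSeq (z : discCq q) : lp (fun _ : ℕ => ℂ) 2 :=
  ⟨fun n => conj (monoFun q α n z), memℓp_conj_monoFun hq0 hq1 hα z.2⟩

lemma inner_evalSeq (z : discCq q) (c : lp (fun _ : ℕ => ℂ) 2) :
    inner ℂ (evalSeq hq0 hq1 hα z) c = seriesFun q α c z := by
  rw [lp.inner_eq_tsum]
  refine tsum_congr fun n => ?_
  rw [RCLike.inner_apply, evalSeq, Complex.conj_conj]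

/-- The reproducing kernel structure given by a Hilbert basis that corresponds to the normalized
monomials. -/
@[reducible]
noncomputable def seriesRKHS {H : Type*} [NormedAddCommGroup H] [InnerProductSpace ℂ H]
    (b : HilbertBasis ℕ ℂ H) : RKHS ℂ H (discCq q) ℂ where
  -- Evaluation at `z` is defined as the pairing with the vector of coefficients `conj (e_n(z))`, so
  -- continuity is automatic and this vector is the kernel function.
  coeCLM := ContinuousLinearMap.pi fun z => innerSL ℂ (b.repr.symm (evalSeq hq0 hq1 hα z))
  coeCLM_injective := by
    intro F G hFG
    rw [← sub_eq_zero, ← b.repr.map_eq_zero_iff]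
    ext n
    refine eq_zero_of_seriesFun_eq_zero hq0 hq1 hα (norm_lp_two_apply_le (b.repr (F - G)))
      (fun z hz => ?_) n
    have h := congrFun hFG ⟨z, hz⟩
    simp only [ContinuousLinearMap.coe_pi', innerSL_apply_apply] at h
    rw [← inner_evalSeq hq0 hq1 hα ⟨z, hz⟩, ← b.repr.symm.inner_map_map,
      LinearIsometryEquiv.symm_apply_apply, inner_sub_right, h, sub_self]

lemma seriesRKHS_apply {H : Type*} [NormedAddCommGroup H] [InnerProductSpace ℂ H]
    (b : HilbertBasis ℕ ℂ H) (F : H) (z : discCq q) :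
    (seriesRKHS hq0 hq1 hα b).coeCLM F z = seriesFun q α (b.repr F) z := by
  rw [← inner_evalSeq hq0 hq1 hα z, ← b.repr.symm.inner_map_map,
    LinearIsometryEquiv.symm_apply_apply]
  rfl

lemma kernel_seriesRKHS {H : Type*} [NormedAddCommGroup H] [InnerProductSpace ℂ H]
    [CompleteSpace H] (b : HilbertBasis ℕ ℂ H) (z w : discCq q) :
    letI := seriesRKHS hq0 hq1 hα b
    RKHS.kernel H z w 1 = kernelK q α z w := by
  let := seriesRKHS hq0 hq1 hα b
  have h : RKHS.kerFun H w (1 : ℂ) = b.repr.symm (evalSeq hq0 hq1 hα w) := by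
    refine ext_inner_right ℂ fun F => ?_
    rw [RKHS.kerFun_inner, RCLike.inner_apply, map_one, mul_one]
    rfl
  rw [← RKHS.kerFun_apply, h, ← RKHS.coeCLM_apply, seriesRKHS_apply,
    LinearIsometryEquiv.apply_symm_apply, kernelK_eq hq1]
  exact tsum_congr fun n => conj_mul_monoFun hq0 hq1 hα n z w

end Space

/-! ### The transform -/

section Transform

variable {q α : ℝ}

lemma continuous_and_bounded_kernelT (hq0 : 0 < q) (hq1 : q < 1) (hα : |α| < 1) {z : ℂ}
    (hz : z ∈ discCq q) : Continuous (kernelT q α z) ∧ ∃ C, ∀ x, ‖kernelT q α z x‖ ≤ C := by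
  obtain ⟨u, hu, hb⟩ := exists_summable_bound_wave hq0 hq1 hα hz
  rw [← funext (tsum_wave hq0 hq1 hα hz)]
  refine ⟨continuous_tsum (fun n => ?_) hu hb, ∑' n, u n, fun x => ?_⟩
  · exact continuous_const.mul (continuous_basisFun hq0 hq1 (abs_lt.1 hα).1 n)
  · exact tsum_of_norm_bounded hu.hasSum fun n => hb n x

lemma cohState_eq (hq0 : 0 < q) (hq1 : q < 1) (hα : |α| < 1) {z : ℂ} (hz : z ∈ discCq q) (x : ℝ) :
    cohState q α z x =
      ((√(normFactor q α (Complex.normSq z)))⁻¹ : ℝ) * conj (kernelT q α z x) := by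
  rw [cohState, ← tsum_wave hq0 hq1 hα hz, Complex.conj_tsum]
  congr 1
  refine tsum_congr fun n => ?_
  rw [map_mul, map_div₀, map_pow, Complex.conj_ofReal, conj_basisFun hq0 hq1 (abs_lt.1 hα).1]

lemma memLp_cohState (hq0 : 0 < q) (hq1 : q < 1) (hα : |α| < 1) {z : ℂ} (hz : z ∈ discCq q) :
    MemLp (cohState q α z) 2 (weightMeasure q α) := by
  have := isFiniteMeasure_weightMeasure hq0 hq1 hα
  obtain ⟨hc, C, hC⟩ := continuous_and_bounded_kernelT hq0 hq1 hα hz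
  rw [funext (cohState_eq hq0 hq1 hα hz)]
  refine MemLp.const_mul (MemLp.of_bound ?_ C (Eventually.of_forall fun x => ?_)) _
  · exact (Complex.continuous_conj.comp hc).aestronglyMeasurable
  · rw [RCLike.norm_conj]
    exact hC x

/-- The normalization of the coherent state cancels the prefactor of the transform, and conjugating
the wave function gives back `T`. -/
lemma bargmann_eq_integral (hq0 : 0 < q) (hq1 : q < 1) (hα : |α| < 1) {z : ℂ}
    (hz : z ∈ discCq q) (φ : ℝ → ℂ) :
    bargmann q α φ z = ∫ x, kernelT q α z x * φ x ∂(weightMeasure q α) := by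
  have hN := Real.sqrt_pos.2 (normFactor_pos hq0 hq1 hα hz)
  rw [bargmann, ← integral_const_mul]
  refine integral_congr_ae (Eventually.of_forall fun x => ?_)
  simp only [cohState_eq hq0 hq1 hα hz, map_mul, Complex.conj_ofReal, Complex.conj_conj]
  have : (√(normFactor q α (Complex.normSq z)) : ℂ) ≠ 0 := by exact_mod_cast hN.ne'
  push_cast
  field_simp

/-- The series for `T` is dominated uniformly in `x` by a summable sequence, so it may be integrated
term by term against an integrable function. -/
lemma integral_kernelT_mul (hq0 : 0 < q) (hq1 : q < 1) (hα : |α| < 1) {z : ℂ}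
    (hz : z ∈ discCq q) {φ : ℝ → ℂ} (hφ : Integrable φ (weightMeasure q α)) :
    ∫ x, kernelT q α z x * φ x ∂(weightMeasure q α) =
      seriesFun q α (fun n => ∫ x, basisFun q α n x * φ x ∂(weightMeasure q α)) z := by
  obtain ⟨u, hu, hb⟩ := exists_summable_bound_wave hq0 hq1 hα hz
  have hint : ∀ n, Integrable (fun x => monoFun q α n z * basisFun q α n x * φ x)
      (weightMeasure q α) := fun n =>
    hφ.bdd_mul (continuous_const.mul
      (continuous_basisFun hq0 hq1 (abs_lt.1 hα).1 n)).aestronglyMeasurable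
      (Eventually.of_forall (hb n))
  have hsum : Summable fun n => ∫ x, ‖monoFun q α n z * basisFun q α n x * φ x‖
      ∂(weightMeasure q α) := by
    refine Summable.of_nonneg_of_le (fun n => integral_nonneg fun x => norm_nonneg _) (fun n => ?_)
      (hu.mul_right (∫ x, ‖φ x‖ ∂(weightMeasure q α)))
    rw [← integral_const_mul]
    refine integral_mono (hint n).norm (hφ.norm.const_mul _) fun x => ?_
    simp only [norm_mul _ (φ x)]
    exact mul_le_mul_of_nonneg_right (hb n x) (norm_nonneg _)
  have h := integral_tsum_of_summable_integral_norm hint hsum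
  simp_rw [tsum_mul_right] at h
  rw [integral_congr_ae (g := fun x => (∑' n, monoFun q α n z * basisFun q α n x) * φ x)
    (Eventually.of_forall fun x => by
      simp only [← tsum_wave hq0 hq1 hα hz, monoFun]), ← h]
  refine tsum_congr fun n => ?_
  simp_rw [mul_assoc]
  rw [integral_const_mul, mul_comm]

end Transform

/-! ### The main theorem -/

theorem mainTheorem1 (q α : ℝ) (hq0 : 0 < q) (hq1 : q < 1) (hα : -1 < α) (hαq : α < q) :
    -- the coherent states are elements of `ℋ_{q,α}`
    (∀ z ∈ discCq q, MemLp (cohState q α z) 2 (weightMeasure q α)) ∧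
    -- `𝒜²_{q,α}(ℂ)` is a reproducing kernel Hilbert space of holomorphic functions on `ℂ_q`,
    -- with kernel `K_{q,α}`
    ∃ R : RKHS ℂ (spaceA2 q α) (discCq q) ℂ,
      (∀ F : spaceA2 q α, ∃ f : ℂ → ℂ, DifferentiableOn ℂ f (discCq q) ∧
        (∀ z : discCq q, R.coeCLM F z = f z) ∧
        (F : Lp ℂ 2 (planeMeasure q α)) =ᵐ[(planeMeasure q α).restrict (discCq q)] f) ∧
      (∀ z w : discCq q, RKHS.kernel (spaceA2 q α) z w 1 = kernelK q α z w) ∧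
      -- the coherent state transform is an isometric isomorphism onto it
      ∃ B : Lp ℂ 2 (weightMeasure q α) ≃ₗᵢ[ℂ] spaceA2 q α,
        ∀ (φ : Lp ℂ 2 (weightMeasure q α)) (z : discCq q),
          R.coeCLM (B φ) z = bargmann q α φ z ∧
          -- and it is given by the integral kernel `T`
          IntegrableOn (fun ξ => kernelT q α z ξ * φ ξ * (weight q α ξ : ℂ)) (intervalIq q) ∧
          bargmann q α φ z =
            ∫ ξ in intervalIq q, kernelT q α z ξ * φ ξ * (weight q α ξ : ℂ) := by
  have hα1 : |α| < 1 := abs_lt.2 ⟨hα, hαq.trans hq1⟩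
  have := isFiniteMeasure_weightMeasure hq0 hq1 hα1
  obtain ⟨b₁, hb₁⟩ := exists_hilbertBasis_weightMeasure hq0 hq1 hα1
  obtain ⟨b₂, hb₂⟩ := exists_hilbertBasis_spaceA2 hq0 hq1 hα1 hαq
  -- The isometry identifies the two Hilbert bases through `ℓ²`, sending `φ_n` to the `n`-th
  -- normalized monomial.
  refine ⟨fun z hz => memLp_cohState hq0 hq1 hα1 hz, seriesRKHS hq0 hq1 hα1 b₂, fun F => ?_,
    kernel_seriesRKHS hq0 hq1 hα1 b₂, b₁.repr.trans b₂.repr.symm, fun φ z => ?_⟩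
  · refine ⟨seriesFun q α (b₂.repr F), differentiableOn_seriesFun hq0 hq1 hα1
      (norm_lp_two_apply_le _), seriesRKHS_apply hq0 hq1 hα1 b₂ F,
      ae_eq_seriesFun hq0 hq1 hα1 (norm_lp_two_apply_le _) ?_⟩
    have h := (b₂.hasSum_repr F).mapL (spaceA2 q α).subtypeL
    convert! h using 2 with n
    rw [map_smul]
    congr 1
    exact Lp.ext ((memLp_monoFun hq0 hq1 hα1 n).coeFn_toLp.trans (hb₂ n).symm)
  · have hφ : Integrable φ (weightMeasure q α) := (Lp.memLp φ).integrable (by norm_num)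
    obtain ⟨hc, C, hC⟩ := continuous_and_bounded_kernelT hq0 hq1 hα1 z.2
    have hi : Integrable (fun x => kernelT q α z x * φ x) (weightMeasure q α) :=
      hφ.bdd_mul hc.aestronglyMeasurable (Eventually.of_forall hC)
    have e : ∀ x, kernelT q α z x * φ x * (weight q α x : ℂ) =
        weight q α x • (kernelT q α z x * φ x) := fun x => by
      rw [Complex.real_smul, mul_comm]
    simp_rw [e]
    refine ⟨?_, (integrable_weightMeasure_iff hq0 hq1 hα1 _).1 hi, ?_⟩
    -- Both sides are series of normalized monomials at `z`; it remains to match the coefficients,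
    -- which are `⟨φ_n, φ⟩` with `φ_n` real-valued.
    · rw [seriesRKHS_apply, bargmann_eq_integral hq0 hq1 hα1 z.2,
        integral_kernelT_mul hq0 hq1 hα1 z.2 hφ]
      congr 1
      ext n
      rw [LinearIsometryEquiv.trans_apply, LinearIsometryEquiv.apply_symm_apply,
        b₁.repr_apply_apply, hb₁, L2.inner_def]
      refine integral_congr_ae ?_
      filter_upwards [(memLp_basisFun hq0 hq1 hα1 n).coeFn_toLp] with x hx
      rw [hx, RCLike.inner_apply, conj_basisFun hq0 hq1 hα, mul_comm]
    · rw [bargmann_eq_integral hq0 hq1 hα1 z.2, integral_weightMeasure hq0 hq1 hα1]
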